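/- Let $m\ge 0$ and consider the free real scalar (minimally coupled Klein--Gordon) field of mass $m$ on four-dimensional Minkowski space $M$ with standard inertial coordinates $(t,\boldsymbol{x})$ and signature $+---$. Let $P=\Box+m^2$ and let $\mathcal A$ be the unital $*$-algebra generated by symbols $\Phi(f)$, $f\in C_0^\infty(M;\mathbb C)$, subject to: $f\mapsto\Phi(f)$ is complex linear, $\Phi(f)^*=\Phi(\overline f)$, $\Phi(Pf)=0$, and $[\Phi(f),\Phi(h)]=iE(f,h)\mathbf 1$, where $E(f,h)=\int_M f\,(E^-h-E^+h)$ and $E^{+}h$ (resp. $E^-h$) is the smooth solution of $P\phi=h$ with past-compact (resp. future-compact) support. A state is a normalized positive linear functional $\omega$ on $\mathcal A$; it is Hadamard if its two-point function $\omega_2(f,h)=\omega(\Phi(f)\Phi(h))$ is a distribution on $M\times M$ with wave-front set $\mathrm{WF}(\omega_2)\subset\mathcal N^+\times\mathcal N^-$, where $\mathcal N^{\pm}$ are the nonzero future/past-directed null covectors and wave-front sets are taken with the convention $\widehat{f}(k)=\int e^{ik\cdot x}f(x)\,dx$ (also used below). Let $\omega_2^{\rm vac}(x,x')=\int\frac{d^3\boldsymbol{k}}{(2\pi)^3}\frac{1}{2k_0}e^{-ik\cdot(x-x')}$,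 $k_0=\sqrt{\|\boldsymbol{k}\|^2+m^2}$, be the Minkowski vacuum two-point function. For every Hadamard state $\omega$, the difference $W=\omega_2-\omega_2^{\rm vac}$ is a smooth real-valued function on $M\times M$, and the normal-ordered energy density is $$\langle T_{00}\rangle_\omega(x)=\Bigl[\tfrac12\sum_{\mu=0}^3\partial_\mu\partial'_\mu W(x,x')+\tfrac12m^2W(x,x')\Bigr]_{x'=x}.$$ Define, for $x\ge1$, $$Q_3(x)=\Bigl(1-\frac1{x^2}\Bigr)^{1/2}\Bigl(1-\frac1{2x^2}\Bigr)-\frac1{2x^4}\ln\bigl(x+\sqrt{x^2-1}\bigr).$$ Then $0\le Q_3\le1$ on $[1,\infty)$ and $Q_3(x)\to1$ as $x\to\infty$; for $m=0$ we read $Q_3(u/m)$ as $1$. For every Hadamard state $\omega$, every $\boldsymbol{x}\in\mathbb R^3$ and every real-valued $g\in C_0^\infty(\mathbb R)$, $$\int\langle T_{00}\rangle_\omega(t,\boldsymbol{x})\,|g(t)|^2\,dt\ \ge\ -\frac1{16\pi^3}\int_m^\infty|\widehat g(u)|^2u^4Q_3(u/m)\,du ,$$ where the integral on the right-hand side converges.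 More generally, for complex-valued $g\in C_0^\infty(\mathbb R)$ the same holds with $|\widehat g(u)|^2$ replaced by $\frac12\bigl(|\widehat g(u)|^2+|\widehat g(-u)|^2\bigr)$. As a consequence, for all $m\ge0$ and all complex-valued $g\in C_0^\infty(\mathbb R)$, $$\int\langle T_{00}\rangle_\omega(t,\boldsymbol{x})\,|g(t)|^2\,dt\ \ge\ -\frac1{16\pi^2}\int_{-\infty}^\infty|g''(t)|^2\,dt .$$ -/

import Mathlib

open MeasureTheory Topology TopologicalSpace Set
open scoped ContDiff Distributions

noncomputable section

namespace QEI

/-! ### Minkowski spacetime, test functions and the Klein-Gordon operator -/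

/-- Four-dimensional Minkowski spacetime in standard inertial coordinates `(t, 𝐱)`;
the metric has signature `+ - - -`. -/
abbrev Spacetime : Type := ℝ × EuclideanSpace ℝ (Fin 3)

/-- Complex-valued smooth compactly supported functions on a normed space. -/
abbrev Test (E : Type) [NormedAddCommGroup E] [NormedSpace ℝ E] : Type :=
  𝓓((⊤ : Opens E), ℂ)

/-- The coordinate vector `∂/∂t`. -/
def eTime : Spacetime := (1, 0)

/-- The coordinate vector `∂/∂xⁱ`. -/
def eSpace (i : Fin 3) : Spacetime := (0, EuclideanSpace.single i 1)

/-- The partial derivative of `φ` in the direction of the constant vector field `v`. -/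
def pd {E F : Type} [NormedAddCommGroup E] [NormedSpace ℝ E] [NormedAddCommGroup F]
    [NormedSpace ℝ F] (v : E) (φ : E → F) : E → F :=
  fun x => fderiv ℝ φ x v

/-- The Klein-Gordon operator `P = □ + m²`, where `□ = ∂_t² - ∂_1² - ∂_2² - ∂_3²`. -/
def kgOp (m : ℝ) (φ : Spacetime → ℂ) : Spacetime → ℂ := fun x =>
  pd eTime (pd eTime φ) x - ∑ i, pd (eSpace i) (pd (eSpace i) φ) x + (m : ℂ) ^ 2 * φ x

theorem contDiff_pd {E F : Type} [NormedAddCommGroup E] [NormedSpace ℝ E]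
    [NormedAddCommGroup F] [NormedSpace ℝ F] (v : E) {φ : E → F} (h : ContDiff ℝ ∞ φ) :
    ContDiff ℝ ∞ (pd v φ) :=
  (h.fderiv_right (m := ∞) (by simp)).clm_apply contDiff_const

theorem hasCompactSupport_pd {E F : Type} [NormedAddCommGroup E] [NormedSpace ℝ E]
    [NormedAddCommGroup F] [NormedSpace ℝ F] (v : E) {φ : E → F} (h : HasCompactSupport φ) :
    HasCompactSupport (pd v φ) :=
  (h.fderiv ℝ).comp_left (g := fun L : E →L[ℝ] F => L v) (by simp)

theorem contDiff_kgOp (m : ℝ) {φ : Spacetime → ℂ} (h : ContDiff ℝ ∞ φ) :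
    ContDiff ℝ ∞ (kgOp m φ) :=
  ((contDiff_pd _ (contDiff_pd _ h)).sub
    (ContDiff.sum fun _ _ => contDiff_pd _ (contDiff_pd _ h))).add (contDiff_const.mul h)

theorem hasCompactSupport_kgOp (m : ℝ) {φ : Spacetime → ℂ} (h : HasCompactSupport φ) :
    HasCompactSupport (kgOp m φ) := by
  have h1 : ∀ v : Spacetime, HasCompactSupport (pd v (pd v φ)) := fun v =>
    hasCompactSupport_pd v (hasCompactSupport_pd v h)
  have h2 : HasCompactSupport (fun x => ∑ i, pd (eSpace i) (pd (eSpace i) φ) x) := by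
    simp only [Fin.sum_univ_three]
    exact ((h1 _).add (h1 _)).add (h1 _)
  exact ((h1 _).sub h2).add h.mul_left

/-- The test function `P f`. -/
def kgTest (m : ℝ) (f : Test Spacetime) : Test Spacetime :=
  ⟨kgOp m f, contDiff_kgOp m f.contDiff, hasCompactSupport_kgOp m f.hasCompactSupport,
    fun _ _ => trivial⟩

/-- The complex conjugate of a test function. -/
def conjTest {E : Type} [NormedAddCommGroup E] [NormedSpace ℝ E] (f : Test E) : Test E :=
  ⟨fun x => (starRingEnd ℂ) (f x), Complex.conjCLE.contDiff.comp f.contDiff,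
    f.hasCompactSupport.comp_left (map_zero _), fun _ _ => trivial⟩

/-- The test function `(x, x') ↦ f x * h x'`. -/
def tensorTest (f h : Test Spacetime) : Test (Spacetime × Spacetime) :=
  ⟨fun z => f z.1 * h z.2,
    (f.contDiff.comp contDiff_fst).mul (h.contDiff.comp contDiff_snd),
    HasCompactSupport.intro (f.hasCompactSupport.prod h.hasCompactSupport) (by
      intro z hz
      by_contra hne
      exact hz ⟨subset_tsupport _ (left_ne_zero_of_mul hne),
        subset_tsupport _ (right_ne_zero_of_mul hne)⟩),
    fun _ _ => trivial⟩

/-! ### Retarded and advanced solutions -/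

/-- The causal future `J⁺(p)`. -/
def causalFuture (p : Spacetime) : Set Spacetime := {q | ‖q.2 - p.2‖ ≤ q.1 - p.1}

/-- The causal past `J⁻(p)`. -/
def causalPast (p : Spacetime) : Set Spacetime := {q | ‖p.2 - q.2‖ ≤ p.1 - q.1}

/-- `φ = E⁺ f`: the (unique) smooth solution of `P φ = f` with past-compact support. -/
structure IsRetarded (m : ℝ) (f : Test Spacetime) (φ : Spacetime → ℂ) : Prop where
  smooth : ContDiff ℝ ∞ φ
  solves : ∀ x, kgOp m φ x = f x
  pastCompact : ∀ p, IsCompact (tsupport φ ∩ causalPast p)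

/-- `φ = E⁻ f`: the (unique) smooth solution of `P φ = f` with future-compact support. -/
structure IsAdvanced (m : ℝ) (f : Test Spacetime) (φ : Spacetime → ℂ) : Prop where
  smooth : ContDiff ℝ ∞ φ
  solves : ∀ x, kgOp m φ x = f x
  futureCompact : ∀ p, IsCompact (tsupport φ ∩ causalFuture p)

/-! ### The unital `*`-algebra of the quantized field -/

/-- The defining relations of the field algebra: linearity of `f ↦ Φ(f)`, the field equation
`Φ(P f) = 0` and the commutation relations `[Φ(f), Φ(h)] = i E(f, h) 1`, where
`E(f, h) = ∫ f (E h)` and `E = E⁻ - E⁺`. -/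
inductive FieldRel (m : ℝ) :
    FreeAlgebra ℂ (Test Spacetime) → FreeAlgebra ℂ (Test Spacetime) → Prop
  | add (f h : Test Spacetime) :
      FieldRel m (FreeAlgebra.ι ℂ (f + h)) (FreeAlgebra.ι ℂ f + FreeAlgebra.ι ℂ h)
  | smul (c : ℂ) (f : Test Spacetime) :
      FieldRel m (FreeAlgebra.ι ℂ (c • f)) (c • FreeAlgebra.ι ℂ f)
  | fieldEquation (f : Test Spacetime) :
      FieldRel m (FreeAlgebra.ι ℂ (kgTest m f)) 0
  | commutator (f h : Test Spacetime) (φret φadv : Spacetime → ℂ)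
      (hret : IsRetarded m h φret) (hadv : IsAdvanced m h φadv) :
      FieldRel m
        (FreeAlgebra.ι ℂ f * FreeAlgebra.ι ℂ h - FreeAlgebra.ι ℂ h * FreeAlgebra.ι ℂ f)
        (algebraMap ℂ _ (Complex.I * ∫ x, f x * (φadv x - φret x)))

/-- The algebra `𝒜` of the free scalar field of mass `m`, generated by the `Φ(f)`. -/
abbrev FieldAlgebra (m : ℝ) : Type := RingQuot (FieldRel m)

/-- The smeared quantum field `Φ(f)`. -/
def field (m : ℝ) (f : Test Spacetime) : FieldAlgebra m :=
  RingQuot.mkAlgHom ℂ (FieldRel m) (FreeAlgebra.ι ℂ f)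

theorem field_add (m : ℝ) (f h : Test Spacetime) :
    field m (f + h) = field m f + field m h := by
  have := RingQuot.mkAlgHom_rel ℂ (FieldRel.add (m := m) f h)
  simpa [field] using this

theorem field_smul (m : ℝ) (c : ℂ) (f : Test Spacetime) :
    field m (c • f) = c • field m f := by
  have := RingQuot.mkAlgHom_rel ℂ (FieldRel.smul (m := m) c f)
  simpa [field] using this

theorem field_kgTest (m : ℝ) (f : Test Spacetime) : field m (kgTest m f) = 0 := by
  have := RingQuot.mkAlgHom_rel ℂ (FieldRel.fieldEquation (m := m) f)
  simpa [field] using this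

theorem field_commutator (m : ℝ) (f h : Test Spacetime) (φret φadv : Spacetime → ℂ)
    (hret : IsRetarded m h φret) (hadv : IsAdvanced m h φadv) :
    field m f * field m h - field m h * field m f =
      algebraMap ℂ (FieldAlgebra m) (Complex.I * ∫ x, f x * (φadv x - φret x)) := by
  have := RingQuot.mkAlgHom_rel ℂ (FieldRel.commutator (m := m) f h φret φadv hret hadv)
  rw [AlgHom.commutes, map_sub, map_mul, map_mul] at this
  exact this

/-! The `*`-operation: the conjugate-linear anti-automorphism with `Φ(f)* = Φ(conj f)`. It is
obtained from the universal property, as an algebra homomorphism into the opposite algebra with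
the conjugate scalar multiplication. -/

/-- The opposite of the field algebra, with scalars acting through complex conjugation. -/
def ConjOp (m : ℝ) : Type := (FieldAlgebra m)ᵐᵒᵖ

instance (m : ℝ) : Ring (ConjOp m) := inferInstanceAs (Ring (FieldAlgebra m)ᵐᵒᵖ)

instance (m : ℝ) : Algebra ℂ (ConjOp m) :=
  ((algebraMap ℂ (FieldAlgebra m)ᵐᵒᵖ).comp (starRingEnd ℂ)).toAlgebra'
    (fun c x => Algebra.commutes (A := (FieldAlgebra m)ᵐᵒᵖ) (starRingEnd ℂ c) x)

/-- The identity map into `ConjOp`. -/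
def toConjOp {m : ℝ} (a : FieldAlgebra m) : ConjOp m := MulOpposite.op a

/-- The identity map out of `ConjOp`. -/
def ofConjOp {m : ℝ} (a : ConjOp m) : FieldAlgebra m :=
  MulOpposite.unop (α := FieldAlgebra m) a

theorem pd_conj (v : Spacetime) (φ : Spacetime → ℂ) :
    pd v (fun x => (starRingEnd ℂ) (φ x)) = fun x => (starRingEnd ℂ) (pd v φ x) := by
  funext x
  have := Complex.conjCLE.comp_fderiv (f := φ) (x := x)
  have h2 : (fun x => (starRingEnd ℂ) (φ x)) = Complex.conjCLE ∘ φ := rfl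
  unfold pd
  rw [h2, this]
  rfl

theorem kgOp_conj (m : ℝ) (φ : Spacetime → ℂ) (x : Spacetime) :
    kgOp m (fun x => (starRingEnd ℂ) (φ x)) x = (starRingEnd ℂ) (kgOp m φ x) := by
  simp [kgOp, pd_conj]

theorem tsupport_conj (φ : Spacetime → ℂ) :
    tsupport (fun x => (starRingEnd ℂ) (φ x)) = tsupport φ := by
  unfold tsupport
  congr 1
  ext x
  simp [Function.mem_support]

theorem IsRetarded.conj {m : ℝ} {f : Test Spacetime} {φ : Spacetime → ℂ}
    (h : IsRetarded m f φ) : IsRetarded m (conjTest f) (fun x => (starRingEnd ℂ) (φ x)) where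
  smooth := Complex.conjCLE.contDiff.comp h.smooth
  solves x := by rw [kgOp_conj, h.solves]; rfl
  pastCompact p := by rw [tsupport_conj]; exact h.pastCompact p

theorem IsAdvanced.conj {m : ℝ} {f : Test Spacetime} {φ : Spacetime → ℂ}
    (h : IsAdvanced m f φ) : IsAdvanced m (conjTest f) (fun x => (starRingEnd ℂ) (φ x)) where
  smooth := Complex.conjCLE.contDiff.comp h.smooth
  solves x := by rw [kgOp_conj, h.solves]; rfl
  futureCompact p := by rw [tsupport_conj]; exact h.futureCompact p

/-- The `*`-operation on words in the generators, with values in the field algebra. -/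
def starWords (m : ℝ) : FreeAlgebra ℂ (Test Spacetime) →ₐ[ℂ] ConjOp m :=
  FreeAlgebra.lift ℂ (fun f => toConjOp (field m (conjTest f)))

theorem starWords_ι (m : ℝ) (f : Test Spacetime) :
    starWords m (FreeAlgebra.ι ℂ f) =
      toConjOp (field m (conjTest f)) := by
  rw [starWords, FreeAlgebra.lift_ι_apply]

theorem algebraMap_conjOp (m : ℝ) (c : ℂ) :
    algebraMap ℂ (ConjOp m) c =
      toConjOp (algebraMap ℂ (FieldAlgebra m) (starRingEnd ℂ c)) := rfl

theorem starWords_rel (m : ℝ) ⦃a b : FreeAlgebra ℂ (Test Spacetime)⦄ (h : FieldRel m a b) :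
    starWords m a = starWords m b := by
  induction h with
  | add f h =>
    rw [map_add, starWords_ι, starWords_ι, starWords_ι]
    have : conjTest (f + h) = conjTest f + conjTest h := by
      ext x
      exact map_add (starRingEnd ℂ) (f x) (h x)
    rw [this, field_add]
    rfl
  | smul c f =>
    rw [Algebra.smul_def, map_mul, AlgHom.commutes, starWords_ι, starWords_ι,
      algebraMap_conjOp]
    have : conjTest (c • f) = (starRingEnd ℂ c) • conjTest f := by
      ext x
      exact map_mul (starRingEnd ℂ) c (f x)
    rw [this, field_smul, Algebra.smul_def, Algebra.commutes]
    rfl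
  | fieldEquation f =>
    rw [map_zero, starWords_ι]
    have : conjTest (kgTest m f) = kgTest m (conjTest f) := by
      ext x
      exact (kgOp_conj m f x).symm
    rw [this, field_kgTest]
    rfl
  | commutator f h φret φadv hret hadv =>
    rw [map_sub, map_mul, map_mul, AlgHom.commutes, starWords_ι, starWords_ι,
      algebraMap_conjOp]
    have key := field_commutator m (conjTest f) (conjTest h) _ _ hret.conj hadv.conj
    have hint : (∫ x, conjTest f x *
          ((starRingEnd ℂ) (φadv x) - (starRingEnd ℂ) (φret x))) =
        (starRingEnd ℂ) (∫ x, f x * (φadv x - φret x)) := by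
      rw [← integral_conj]
      refine integral_congr_ae (Filter.Eventually.of_forall fun x => ?_)
      show (starRingEnd ℂ) (f x) * _ = _
      simp
    rw [hint] at key
    have hneg : (starRingEnd ℂ) (Complex.I * ∫ x, f x * (φadv x - φret x)) =
        -(Complex.I * (starRingEnd ℂ) (∫ x, f x * (φadv x - φret x))) := by
      simp
    rw [hneg, map_neg, ← key, neg_sub]
    rfl

/-- The `*`-operation as a homomorphism into the conjugate opposite algebra. -/
def starHom (m : ℝ) : FieldAlgebra m →ₐ[ℂ] ConjOp m :=
  RingQuot.liftAlgHom ℂ ⟨starWords m, starWords_rel m⟩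

instance (m : ℝ) : Star (FieldAlgebra m) :=
  ⟨fun a => ofConjOp (starHom m a)⟩

theorem star_field (m : ℝ) (f : Test Spacetime) :
    star (field m f) = field m (conjTest f) := by
  show ofConjOp (starHom m (field m f)) = _
  rw [starHom, field, RingQuot.liftAlgHom_mkAlgHom_apply, starWords_ι]
  rfl

theorem star_algebraMap (m : ℝ) (c : ℂ) :
    star (algebraMap ℂ (FieldAlgebra m) c) = algebraMap ℂ (FieldAlgebra m) (starRingEnd ℂ c) := by
  show ofConjOp (starHom m (algebraMap ℂ _ c)) = _
  rw [AlgHom.commutes, algebraMap_conjOp]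
  rfl

theorem star_mul_aux (m : ℝ) (a b : FieldAlgebra m) : star (a * b) = star b * star a := by
  show ofConjOp (starHom m (a * b)) = _
  rw [map_mul]
  rfl

theorem star_add_aux (m : ℝ) (a b : FieldAlgebra m) : star (a + b) = star a + star b := by
  show ofConjOp (starHom m (a + b)) = _
  rw [map_add]
  rfl

theorem fieldAlgebra_induction {m : ℝ} {C : FieldAlgebra m → Prop}
    (hc : ∀ c : ℂ, C (algebraMap ℂ _ c)) (hf : ∀ f, C (field m f))
    (hmul : ∀ a b, C a → C b → C (a * b)) (hadd : ∀ a b, C a → C b → C (a + b))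
    (a : FieldAlgebra m) : C a := by
  obtain ⟨w, rfl⟩ := RingQuot.mkAlgHom_surjective ℂ (FieldRel m) a
  induction w using FreeAlgebra.induction with
  | grade0 c => rw [AlgHom.commutes]; exact hc c
  | grade1 f => exact hf f
  | mul a b ha hb => rw [map_mul]; exact hmul _ _ ha hb
  | add a b ha hb => rw [map_add]; exact hadd _ _ ha hb

instance (m : ℝ) : StarRing (FieldAlgebra m) where
  star_involutive a := by
    induction a using fieldAlgebra_induction with
    | hc c => rw [star_algebraMap, star_algebraMap, Complex.conj_conj]
    | hf f =>
      rw [star_field, star_field]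
      congr 1
      ext x
      exact Complex.conj_conj (f x)
    | hmul a b ha hb => rw [star_mul_aux, star_mul_aux, ha, hb]
    | hadd a b ha hb => rw [star_add_aux, star_add_aux, ha, hb]
  star_mul := star_mul_aux m
  star_add := star_add_aux m

instance (m : ℝ) : StarModule ℂ (FieldAlgebra m) where
  star_smul c a := by
    rw [Algebra.smul_def, star_mul_aux, star_algebraMap, ← Algebra.commutes,
      ← Algebra.smul_def]
    rfl

/-- A state: a normalized positive linear functional on the field algebra. -/
structure FieldState (m : ℝ) where
  /-- The expectation value functional. -/
  ev : FieldAlgebra m →ₗ[ℂ] ℂ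
  normalized : ev 1 = 1
  positive_re : ∀ a : FieldAlgebra m, 0 ≤ (ev (star a * a)).re
  positive_im : ∀ a : FieldAlgebra m, (ev (star a * a)).im = 0

/-- The two-point function `σ₂(f, h) = σ(Φ(f) Φ(h))` of a state `σ`. -/
def FieldState.twoPoint {m : ℝ} (σ : FieldState m) (f h : Test Spacetime) : ℂ :=
  σ.ev (field m f * field m h)

/-! ### Wave-front sets and Hadamard states -/

section WaveFront

variable {E : Type} [NormedAddCommGroup E] [NormedSpace ℝ E]

/-- The test function `χ e_ξ`, where `e_ξ(z) = exp(i ξ·z)`. -/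
def modulate (χ : Test E) (ξ : E →L[ℝ] ℝ) : Test E :=
  ⟨fun z => Complex.exp (Complex.I * (ξ z : ℂ)) * χ z,
    (Complex.contDiff_exp.comp (contDiff_const.mul
      (Complex.ofRealCLM.contDiff.comp ξ.contDiff))).mul χ.contDiff,
    χ.hasCompactSupport.mul_left, fun _ _ => trivial⟩

/-- `(z, ξ)` is a regular direction of the distribution `u`: for some test function `χ` with
`χ z ≠ 0`, the Fourier transform `ξ' ↦ u (χ e_ξ')` of `χ u` decays rapidly in a conic
neighbourhood of `ξ`. -/
def IsRegularDirection (u : Test E →L[ℂ] ℂ) (z : E) (ξ : E →L[ℝ] ℝ) : Prop :=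
  ∃ χ : Test E, χ z ≠ 0 ∧
    ∃ V : Set (E →L[ℝ] ℝ), IsOpen V ∧ ξ ∈ V ∧ (∀ η ∈ V, ∀ c : ℝ, 0 < c → c • η ∈ V) ∧
      ∀ N : ℕ, ∃ C : ℝ, ∀ η ∈ V, ‖u (modulate χ η)‖ < C / (1 + ‖η‖ ^ N)

/-- The wave-front set of a distribution. -/
def waveFrontSet (u : Test E →L[ℂ] ℂ) : Set (E × (E →L[ℝ] ℝ)) :=
  {p | p.2 ≠ 0 ∧ ¬ IsRegularDirection u p.1 p.2}

end WaveFront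

/-- Nonzero null covectors. -/
def IsNullCovector (ξ : Spacetime →L[ℝ] ℝ) : Prop :=
  ξ ≠ 0 ∧ ξ eTime ^ 2 = ∑ i, ξ (eSpace i) ^ 2

/-- Future-directed nonzero null covectors. -/
def IsFutureNull (ξ : Spacetime →L[ℝ] ℝ) : Prop := IsNullCovector ξ ∧ 0 < ξ eTime

/-- Past-directed nonzero null covectors. -/
def IsPastNull (ξ : Spacetime →L[ℝ] ℝ) : Prop := IsNullCovector ξ ∧ ξ eTime < 0

/-- A state is Hadamard if its two-point function is a distribution on `M × M` whose wave-front
set is contained in `𝒩⁺ × 𝒩⁻` (the microlocal spectrum condition). -/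
def FieldState.IsHadamard {m : ℝ} (σ : FieldState m) : Prop :=
  ∃ u : Test (Spacetime × Spacetime) →L[ℂ] ℂ,
    (∀ f h : Test Spacetime, u (tensorTest f h) = σ.twoPoint f h) ∧
    ∀ p ∈ waveFrontSet u,
      IsFutureNull (p.2.comp (ContinuousLinearMap.inl ℝ Spacetime Spacetime)) ∧
      IsPastNull (p.2.comp (ContinuousLinearMap.inr ℝ Spacetime Spacetime))

/-! ### Normal ordering and the energy density -/

/-- The energy `ω(𝐤) = √(‖𝐤‖² + m²)`. -/
def energy (m : ℝ) (k : EuclideanSpace ℝ (Fin 3)) : ℝ := Real.sqrt (‖k‖ ^ 2 + m ^ 2)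

/-- `∫ exp(i k·x) f(x) d⁴x` at the four-momentum `k = (k₀, 𝐤)`, where
`k·x = k₀ t - 𝐤·𝐱`. -/
def minkowskiFourier (f : Test Spacetime) (k : Spacetime) : ℂ :=
  ∫ x : Spacetime,
    Complex.exp (Complex.I * ((k.1 * x.1 - inner ℝ k.2 x.2 : ℝ) : ℂ)) * f x

/-- The two-point function of the Minkowski vacuum smeared with `f ⊗ h`: the kernel is
`∫ d³𝐤 / ((2π)³ 2ω) exp(-i k·(x - x'))`, with `k = (ω(𝐤), 𝐤)`. -/
def vacuumTwoPoint (m : ℝ) (f h : Test Spacetime) : ℂ :=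
  ∫ k : EuclideanSpace ℝ (Fin 3),
    ((1 / ((2 * Real.pi) ^ 3 * (2 * energy m k)) : ℝ) : ℂ) *
      (minkowskiFourier f (-(energy m k, k)) * minkowskiFourier h (energy m k, k))

/-- `W` is the smooth function `(x, x') ↦ (σ₂ - σ₂ᵛᵃᶜ)(x, x')`, that is, the two-point function
of `σ`, normal ordered with respect to the Minkowski vacuum. -/
def IsNormalOrderedTwoPoint {m : ℝ} (σ : FieldState m) (W : Spacetime × Spacetime → ℝ) : Prop :=
  ContDiff ℝ ∞ W ∧ ∀ f h : Test Spacetime,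
    σ.twoPoint f h - vacuumTwoPoint m f h =
      ∫ z : Spacetime × Spacetime, f z.1 * h z.2 * (W z : ℂ)

/-- The point-split derivative `(∂_v ⊗ ∂_v W)(x, x)`. -/
def pointSplit (v : Spacetime) (W : Spacetime × Spacetime → ℝ) (x : Spacetime) : ℝ :=
  pd (v, (0 : Spacetime)) (pd ((0 : Spacetime), v) W) (x, x)

/-- The expected energy density `⟨T₀₀⟩_σ(x)` of the minimally coupled field, for a state with
normal ordered two-point function `W`: classically
`T₀₀ = ½ ∑_μ (∂_μ φ)² + ½ m² φ²`. -/
def energyDensity (m : ℝ) (W : Spacetime × Spacetime → ℝ) (x : Spacetime) : ℝ :=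
  (pointSplit eTime W x + ∑ i, pointSplit (eSpace i) W x) / 2 + m ^ 2 * W (x, x) / 2

/-! ### The bound -/

/-- The Fourier transform `ĝ(u) = ∫ exp(i u t) g(t) dt`. -/
def ft (g : ℝ → ℂ) (u : ℝ) : ℂ := ∫ t : ℝ, Complex.exp (Complex.I * ((u * t : ℝ) : ℂ)) * g t

/-- The function `Q₃` on `[1, ∞)`. -/
def Q3 (x : ℝ) : ℝ :=
  Real.sqrt (1 - 1 / x ^ 2) * (1 - 1 / (2 * x ^ 2)) -
    1 / (2 * x ^ 4) * Real.log (x + Real.sqrt (x ^ 2 - 1))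

/-- `Q₃(u/m)`, to be read for `m = 0` as the limit `1` of `Q₃` at infinity. -/
def Q3ratio (m u : ℝ) : ℝ := if m = 0 then 1 else Q3 (u / m)

end QEI

end

/-! The inequality is a consequence of positivity of the state. Since ω(Φ(f)*Φ(f)) ≥ 0, the normal
ordered function satisfies W(f̄ ⊗ f) ≥ -ω₂ᵛᵃᶜ(f̄ ⊗ f), and the vacuum term is an explicit integral
of |f̂|² over the mass shell. Using f = ∂_μ q, together with m² times the case f = q, and adding
with weight 1/2, the momentum factors combine to (ω² + ‖k‖² + m²)/2 = ω². This bounds the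
point-split energy density F smeared with q̄ ⊗ q (`splitEnergy_positivity`). For q(t, x) = a(t)
b(x), with b a normalised bump shrinking to a point, the bound descends to a worldline because |b̂|
≤ 1 (`worldline_bound`).

For real g put a(t) = exp(iαt) g(t). The smeared quantity becomes the Fourier transform of the real
function g(t) g(t') F(t, t') in the variable t' - t at frequency α. Integrated over α > 0, its real
part gives π times the integral over the diagonal, which is π ∫ ⟨T₀₀⟩ g² (`pi_mul_integral_diag`).
On the vacuum side |ĝ(ω + α)|² appears with weight ω/(16π³); in the variable u = ω + α, the integral
of ω over the momentum ball ω < u is π u⁴ Q₃(u/m) (`integral_integral_energy`,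
`integral_ball_energy`). Complex g splits into real and imaginary parts, and Q₃ ≤ 1 with
Plancherel's theorem for g'' gives the mass-independent bound.

The longer half shows that W exists as a smooth real function. The difference T of the two two-point
functions has no singular direction. The spectrum condition and the decay of the vacuum
(`vacuumFunctional_decaysOn`) cover every covector whose first time component is ≤ 0 or whose second
is ≥ 0. The remaining covectors are reached by exchanging the arguments: T is symmetric, since both
two-point functions have the same antisymmetric part. A functional of locally finite order without
singular directions is a smooth density (`exists_smooth_density`), by absolutely convergent Fourier
series on boxes.

Symmetry requires the commutation relation for all pairs of test functions, hence actual retarded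
and advanced solutions. Their kernel is the Heaviside function of t times the spatial Fourier
integral of sin(ωt)/ω, made absolutely convergent by a factor (1 + ‖k‖²)⁻² which (1 - Δ)² on the
source undoes. Past compactness follows from an energy estimate (`eq_zero_of_kleinGordon`), time
reversal gives the advanced solution, and the difference matches the vacuum commutator mode by mode
(`vacuumTwoPoint_sub_swap`). -/

noncomputable section

namespace QEI

/-! ### Test functions, functionals of locally finite order, and decay of Fourier transforms -/

section Tools

variable {E : Type} [NormedAddCommGroup E] [NormedSpace ℝ E]

/-- The product of two test functions. -/
def mulTest (χ φ : Test E) : Test E :=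
  ⟨fun z => χ z * φ z, χ.contDiff.mul φ.contDiff, χ.hasCompactSupport.mul_right,
    fun _ _ => trivial⟩

/-- The directional derivative of a test function. -/
def pdTest (v : E) (φ : Test E) : Test E :=
  ⟨pd v φ, contDiff_pd v φ.contDiff, hasCompactSupport_pd v φ.hasCompactSupport,
    fun _ _ => trivial⟩

/-- The pullback of a test function along a linear isomorphism. -/
def compTest {E' : Type} [NormedAddCommGroup E'] [NormedSpace ℝ E'] (A : E ≃L[ℝ] E')
    (φ : Test E') : Test E :=
  ⟨fun z => φ (A z), φ.contDiff.comp A.contDiff,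
    φ.hasCompactSupport.comp_homeomorph A.toHomeomorph, fun _ _ => trivial⟩

/-- The plane wave `z ↦ exp (i ξ·z)`. -/
def planeWave (ξ : E →L[ℝ] ℝ) (z : E) : ℂ := Complex.exp (Complex.I * (ξ z : ℂ))

@[simp] theorem mulTest_apply (χ φ : Test E) (z : E) : mulTest χ φ z = χ z * φ z := rfl

@[simp] theorem pdTest_apply (v : E) (φ : Test E) (z : E) : pdTest v φ z = pd v φ z := rfl

@[simp] theorem modulate_apply (χ : Test E) (ξ : E →L[ℝ] ℝ) (z : E) :
    modulate χ ξ z = planeWave ξ z * χ z := rfl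

theorem norm_planeWave (ξ : E →L[ℝ] ℝ) (z : E) : ‖planeWave ξ z‖ = 1 := by
  rw [planeWave, mul_comm, Complex.norm_exp_ofReal_mul_I]

theorem planeWave_add (ξ η : E →L[ℝ] ℝ) (z : E) :
    planeWave (ξ + η) z = planeWave ξ z * planeWave η z := by
  simp [planeWave, ← Complex.exp_add, mul_add]

theorem contDiff_planeWave (ξ : E →L[ℝ] ℝ) {n : WithTop ℕ∞} : ContDiff ℝ n (planeWave ξ) :=
  (Complex.contDiff_exp.comp (contDiff_const.mul
      (Complex.ofRealCLM.contDiff.comp ξ.contDiff)))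

theorem hasFDerivAt_planeWave (ξ : E →L[ℝ] ℝ) (z : E) :
    HasFDerivAt (planeWave ξ)
      ((planeWave ξ z) • (Complex.I • (Complex.ofRealCLM.comp ξ))) z :=
  ((Complex.ofRealCLM.hasFDerivAt.comp z ξ.hasFDerivAt).const_mul Complex.I).cexp

theorem pd_planeWave (ξ : E →L[ℝ] ℝ) (v z : E) :
    pd v (planeWave ξ) z = Complex.I * ξ v * planeWave ξ z := by
  rw [pd, (hasFDerivAt_planeWave ξ z).fderiv]
  simp
  ring

/-- A plane wave is t ↦ exp(it) precomposed with ξ, so each derivative costs one factor ‖ξ‖. -/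
theorem norm_iteratedFDeriv_planeWave_le (ξ : E →L[ℝ] ℝ) (i : ℕ) (z : E) :
    ‖iteratedFDeriv ℝ i (planeWave ξ) z‖ ≤ ‖ξ‖ ^ i := by
  let g : ℝ → ℂ := fun t => Complex.exp (t * Complex.I)
  have hg : ContDiff ℝ ∞ g := Complex.contDiff_exp.comp
    (Complex.ofRealCLM.contDiff.mul contDiff_const)
  have h : planeWave ξ = g ∘ ξ := by
    funext z; simp [g, planeWave, mul_comm]
  have hd : ∀ j : ℕ, iteratedDeriv j g = fun t => Complex.I ^ j * g t := by
    intro j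
    induction j with
    | zero => simp
    | succ j ih =>
      rw [iteratedDeriv_succ, ih]
      funext t
      have : HasDerivAt g (g t * (1 * Complex.I)) t :=
        ((Complex.ofRealCLM.hasDerivAt (x := t)).mul_const Complex.I).cexp
      rw [deriv_const_mul _ this.differentiableAt, this.deriv]
      ring
  rw [h, ξ.iteratedFDeriv_comp_right hg z (i := i) (mod_cast le_top)]
  refine (ContinuousMultilinearMap.norm_compContinuousLinearMap_le _ _).trans ?_
  rw [norm_iteratedFDeriv_eq_norm_iteratedDeriv, hd]
  simp [g, Complex.norm_exp_ofReal_mul_I]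

theorem exists_norm_iteratedFDeriv_le (χ : Test E) (N : ℕ) :
    ∃ M : ℝ, 0 ≤ M ∧ ∀ i ≤ N, ∀ x, ‖iteratedFDeriv ℝ i χ x‖ ≤ M := by
  have h : ∀ i : ℕ, ∃ M : ℝ, ∀ x, ‖iteratedFDeriv ℝ i χ x‖ ≤ M := fun i =>
    (χ.contDiff.continuous_iteratedFDeriv (mod_cast le_top)).bounded_above_of_compact_support
      (χ.hasCompactSupport.iteratedFDeriv i)
  choose M hM using h
  have h0 : ∀ i, 0 ≤ M i := fun i => (norm_nonneg _).trans (hM i 0)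
  refine ⟨∑ i ∈ Finset.range (N + 1), M i, Finset.sum_nonneg fun i _ => h0 i, fun i hi x =>
    (hM i x).trans (Finset.single_le_sum (fun i _ => h0 i) (by simp; omega))⟩

/-- By the Leibniz rule. Uniformity in ξ is the point: a functional of finite order then grows at
most polynomially on modulated cut-offs. -/
theorem exists_norm_iteratedFDeriv_modulate_le (χ : Test E) (N : ℕ) :
    ∃ M : ℝ, 0 ≤ M ∧ ∀ ξ : E →L[ℝ] ℝ, ∀ i ≤ N, ∀ x,
      ‖iteratedFDeriv ℝ i (modulate χ ξ) x‖ ≤ M * (1 + ‖ξ‖) ^ N := by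
  obtain ⟨M, hM0, hM⟩ := exists_norm_iteratedFDeriv_le χ N
  refine ⟨2 ^ N * M, by positivity, fun ξ i hi x => ?_⟩
  have h1 := norm_iteratedFDeriv_mul_le (n := i) (N := ∞) (contDiff_planeWave ξ (n := ∞))
    χ.contDiff x (mod_cast le_top)
  refine h1.trans ?_
  have h2 : ∀ j ∈ Finset.range (i + 1), (i.choose j : ℝ) * ‖iteratedFDeriv ℝ j (planeWave ξ) x‖ *
      ‖iteratedFDeriv ℝ (i - j) χ x‖ ≤ (i.choose j : ℝ) * ((1 + ‖ξ‖) ^ N * M) := by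
    intro j hj
    rw [mul_assoc]
    have hj' : j ≤ N := by simp at hj; omega
    gcongr
    · calc _ ≤ ‖ξ‖ ^ j := norm_iteratedFDeriv_planeWave_le ξ j x
        _ ≤ (1 + ‖ξ‖) ^ j := by gcongr; linarith
        _ ≤ (1 + ‖ξ‖) ^ N := by gcongr; linarith [norm_nonneg ξ]
    · exact hM _ (by omega) _
  refine (Finset.sum_le_sum h2).trans ?_
  rw [← Finset.sum_mul]
  have h3 : (∑ j ∈ Finset.range (i + 1), (i.choose j : ℝ)) = 2 ^ i := by
    exact_mod_cast Nat.sum_range_choose i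
  rw [h3]
  calc (2 : ℝ) ^ i * ((1 + ‖ξ‖) ^ N * M) ≤ 2 ^ N * ((1 + ‖ξ‖) ^ N * M) := by
        gcongr; norm_num
    _ = _ := by ring

/-- A linear functional on test functions is of finite order on each compact set. -/
def HasLocalOrder (T : Test E →ₗ[ℂ] ℂ) : Prop :=
  ∀ K : Set E, IsCompact K → ∃ (N : ℕ) (C : ℝ), 0 ≤ C ∧ ∀ φ : Test E, (∀ x ∉ K, φ x = 0) →
    ∀ B : ℝ, (∀ i ≤ N, ∀ x, ‖iteratedFDeriv ℝ i φ x‖ ≤ B) → ‖T φ‖ ≤ C * B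

/-- On test functions supported in a fixed compact set, a continuous seminorm is dominated by
finitely many derivative seminorms. Local order is the only continuity used below, since it can be
checked by hand for the vacuum. -/
theorem hasLocalOrder_of_continuous (u : Test E →L[ℂ] ℂ) : HasLocalOrder u.toLinearMap := by
  intro K hK
  let K' : Compacts E := ⟨K, hK⟩
  let L : 𝓓^{⊤}_{K'}(E, ℂ) →L[ℂ] ℂ :=
    u.comp (TestFunction.ofSupportedInCLM ℂ (K := K') (Ω := ⊤) (fun _ _ => trivial))
  have hq : Continuous ((normSeminorm ℂ ℂ).comp L.toLinearMap) := by
    exact continuous_norm.comp L.continuous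
  obtain ⟨s, C, -, h⟩ := Seminorm.bound_of_continuous
    (ContDiffMapSupportedIn.withSeminorms ℂ E ℂ ⊤ K') _ hq
  refine ⟨s.sup id, C, C.2, fun φ hφ B hB => ?_⟩
  have hB0 : 0 ≤ B := (norm_nonneg _).trans (hB 0 (Nat.zero_le _) 0)
  let φ' : 𝓓^{⊤}_{K'}(E, ℂ) := ContDiffMapSupportedIn.of_support_subset φ.contDiff
    (fun x hx => by by_contra hx'; exact hx (hφ x hx'))
  have h1 := h φ'
  have h2 : L φ' = u φ := rfl
  have h3 : (s.sup (ContDiffMapSupportedIn.seminorm ℂ E ℂ ⊤ K')) φ' ≤ B := by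
    refine Seminorm.finset_sup_apply_le hB0 fun i hi => ?_
    rw [ContDiffMapSupportedIn.seminorm_top_le_iff ℂ hB0]
    intro x _
    exact hB i (Finset.le_sup (f := id) hi) x
  calc ‖u φ‖ ≤ C * (s.sup (ContDiffMapSupportedIn.seminorm ℂ E ℂ ⊤ K')) φ' := by
        simpa [h2] using! h1
    _ ≤ C * B := by gcongr

theorem HasLocalOrder.sub {T S : Test E →ₗ[ℂ] ℂ} (hT : HasLocalOrder T) (hS : HasLocalOrder S) :
    HasLocalOrder (T - S) := by
  intro K hK
  obtain ⟨N, C, hC, h⟩ := hT K hK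
  obtain ⟨N', C', hC', h'⟩ := hS K hK
  refine ⟨max N N', C + C', by positivity, fun φ hφ B hB => ?_⟩
  have h1 := h φ hφ B fun i hi => hB i (hi.trans (le_max_left _ _))
  have h2 := h' φ hφ B fun i hi => hB i (hi.trans (le_max_right _ _))
  calc _ ≤ ‖T φ‖ + ‖S φ‖ := norm_sub_le _ _
    _ ≤ _ := by linarith

theorem HasLocalOrder.exists_norm_modulate_le {T : Test E →ₗ[ℂ] ℂ} (hT : HasLocalOrder T)
    (χ : Test E) : ∃ (N : ℕ) (M : ℝ), 0 ≤ M ∧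
      ∀ ξ : E →L[ℝ] ℝ, ‖T (modulate χ ξ)‖ ≤ M * (1 + ‖ξ‖) ^ N := by
  obtain ⟨N, C, hC, h⟩ := hT _ χ.hasCompactSupport
  obtain ⟨M, hM, h'⟩ := exists_norm_iteratedFDeriv_modulate_le χ N
  refine ⟨N, C * M, by positivity, fun ξ => ?_⟩
  rw [mul_assoc]
  refine h _ (fun x hx => ?_) _ (h' ξ)
  simp [image_eq_zero_of_notMem_tsupport hx]

theorem norm_pd_iterate_le {φ : E → ℂ} (hφ : ContDiff ℝ ∞ φ) (v : E) (n : ℕ) (x : E) :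
    ‖(pd v)^[n] φ x‖ ≤ ‖iteratedFDeriv ℝ n φ x‖ * ‖v‖ ^ n := by
  have h : ∀ n : ℕ, ∀ x, (pd v)^[n] φ x = iteratedFDeriv ℝ n φ x fun _ => v := by
    intro n
    induction n with
    | zero => intro x; simp
    | succ n ih =>
      intro x
      rw [Function.iterate_succ_apply', iteratedFDeriv_succ_apply_left]
      have h1 : (pd v)^[n] φ = fun x => iteratedFDeriv ℝ n φ x fun _ => v := funext ih
      rw [h1, pd]
      have h2 : DifferentiableAt ℝ (iteratedFDeriv ℝ n φ) x :=
        (hφ.differentiable_iteratedFDeriv (mod_cast WithTop.coe_lt_top _)) x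
      have h3 := ((ContinuousMultilinearMap.apply ℝ (fun _ : Fin n => E) ℂ
        (fun _ => v)).hasFDerivAt.comp x h2.hasFDerivAt)
      have h4 := h3.fderiv
      simp only [Function.comp_def, ContinuousMultilinearMap.apply_apply] at h4
      rw [h4]
      rfl
  rw [h]
  refine (ContinuousMultilinearMap.le_opNorm _ _).trans ?_
  simp

variable [MeasurableSpace E] [BorelSpace E] [FiniteDimensional ℝ E]

theorem integral_pd_mul {μ : Measure E} [μ.IsAddHaarMeasure] (v : E) {φ g : E → ℂ}
    (hφ : ContDiff ℝ ∞ φ) (hφc : HasCompactSupport φ) (hg : ContDiff ℝ ∞ g) :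
    ∫ x, pd v φ x * g x ∂μ = - ∫ x, φ x * pd v g x ∂μ := by
  have h1 : Integrable (fun x => pd v φ x * g x) μ :=
    ((contDiff_pd v hφ).continuous.mul hg.continuous).integrable_of_hasCompactSupport
      (hasCompactSupport_pd v hφc).mul_right
  have h2 : Integrable (fun x => φ x * pd v g x) μ :=
    (hφ.continuous.mul (contDiff_pd v hg).continuous).integrable_of_hasCompactSupport
      hφc.mul_right
  have h3 : Integrable (fun x => φ x * g x) μ :=
    (hφ.continuous.mul hg.continuous).integrable_of_hasCompactSupport hφc.mul_right
  have := integral_mul_fderiv_eq_neg_fderiv_mul_of_integrable (μ := μ) (f := φ) (g := g) (v := v)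
    h1 h2 h3 (fun x _ => hφ.differentiable (by simp) x)
    (fun x _ => hg.differentiable (by simp) x)
  unfold pd
  rw [this, neg_neg]

/-- The Fourier transform of a test function, as a function of the covector. -/
def ftTest (μ : Measure E) (φ : Test E) (ξ : E →L[ℝ] ℝ) : ℂ :=
  ∫ z, planeWave ξ z * φ z ∂μ

theorem integrable_test (μ : Measure E) [IsFiniteMeasureOnCompacts μ] (φ : Test E) :
    Integrable φ μ :=
  φ.continuous.integrable_of_hasCompactSupport φ.hasCompactSupport

theorem integrable_planeWave_mul (μ : Measure E) [IsFiniteMeasureOnCompacts μ] (φ : Test E)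
    (ξ : E →L[ℝ] ℝ) : Integrable (fun z => planeWave ξ z * φ z) μ :=
  integrable_test μ (modulate φ ξ)

theorem ftTest_pdTest (μ : Measure E) [μ.IsAddHaarMeasure] (v : E) (φ : Test E)
    (ξ : E →L[ℝ] ℝ) : ftTest μ (pdTest v φ) ξ = -(Complex.I * ξ v) * ftTest μ φ ξ := by
  have := integral_pd_mul (μ := μ) v φ.contDiff φ.hasCompactSupport (contDiff_planeWave ξ (n := ∞))
  simp only [ftTest, pdTest_apply]
  calc _ = ∫ x, pd v φ x * planeWave ξ x ∂μ := by simp_rw [mul_comm]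
    _ = _ := by
      rw [this, ← integral_const_mul, ← integral_neg]
      congr 1; funext x; rw [pd_planeWave]; ring

theorem norm_ftTest_le (μ : Measure E) (φ : Test E) (ξ : E →L[ℝ] ℝ) :
    ‖ftTest μ φ ξ‖ ≤ ∫ z, ‖φ z‖ ∂μ := by
  refine (norm_integral_le_integral_norm _).trans (le_of_eq ?_)
  simp [norm_planeWave]

theorem pow_mul_norm_ftTest (μ : Measure E) [μ.IsAddHaarMeasure] (v : E) (n : ℕ) (φ : Test E)
    (ξ : E →L[ℝ] ℝ) : |ξ v| ^ n * ‖ftTest μ φ ξ‖ = ‖ftTest μ ((pdTest v)^[n] φ) ξ‖ := by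
  induction n with
  | zero => simp
  | succ n ih =>
    rw [Function.iterate_succ_apply', ftTest_pdTest, norm_mul, ← ih]
    simp
    ring

theorem coe_pdTest_iterate (v : E) (n : ℕ) (φ : Test E) :
    ⇑((pdTest v)^[n] φ) = (pd v)^[n] φ := by
  induction n with
  | zero => rfl
  | succ n ih => rw [Function.iterate_succ_apply', Function.iterate_succ_apply', ← ih]; rfl

/-- The Fourier transform of a test function decays rapidly. -/
theorem exists_norm_ftTest_le (μ : Measure E) [μ.IsAddHaarMeasure] (φ : Test E) (N : ℕ) :
    ∃ C : ℝ, 0 ≤ C ∧ ∀ ξ : E →L[ℝ] ℝ, (1 + ‖ξ‖) ^ N * ‖ftTest μ φ ξ‖ ≤ C := by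
  let b := Module.finBasis ℝ E
  obtain ⟨D, hD0, hD⟩ : ∃ D : ℝ, 0 ≤ D ∧ ∀ ξ : E →L[ℝ] ℝ, ‖ξ‖ ≤ D * ∑ i, |ξ (b i)| := by
    obtain ⟨C, hC, h⟩ := b.exists_opNorm_le (F := ℝ)
    refine ⟨C, hC.le, fun ξ => h (Finset.sum_nonneg fun i _ => abs_nonneg _) fun i => ?_⟩
    exact Finset.single_le_sum (f := fun i => |ξ (b i)|) (fun i _ => abs_nonneg _)
      (Finset.mem_univ i)
  obtain ⟨d, hd⟩ : ∃ d : ℕ, d = Module.finrank ℝ E := ⟨_, rfl⟩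
  let C0 := ∫ z, ‖φ z‖ ∂μ
  let Ci := fun i => ∫ z, ‖((pdTest (b i))^[N] φ) z‖ ∂μ
  have hC0 : 0 ≤ C0 := integral_nonneg fun _ => norm_nonneg _
  have hCi : ∀ i, 0 ≤ Ci i := fun i => integral_nonneg fun _ => norm_nonneg _
  have hcard : (0 : ℝ) ≤ Fintype.card (Fin (Module.finrank ℝ E)) := by positivity
  refine ⟨2 ^ N * (C0 + D ^ N * ((Fintype.card (Fin (Module.finrank ℝ E)) : ℝ) ^ N *
    ∑ i, Ci i)), by have := Finset.sum_nonneg fun i (_ : i ∈ Finset.univ) => hCi i; positivity,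
    fun ξ => ?_⟩
  have key : ‖ξ‖ ^ N * ‖ftTest μ φ ξ‖ ≤
      D ^ N * ((Fintype.card (Fin (Module.finrank ℝ E)) : ℝ) ^ N * ∑ i, Ci i) + C0 := by
    rcases isEmpty_or_nonempty (Fin (Module.finrank ℝ E)) with he | hne
    · have : ξ = 0 := by
        have := hD ξ
        simp at this
        exact this
      rcases Nat.eq_zero_or_pos N with rfl | hN
      · simpa using (norm_ftTest_le μ φ ξ)
      · subst this; simp [hN.ne']; exact hC0
    -- Only the largest coordinate of ξ matters: it bounds ‖ξ‖ up to a constant, and N derivatives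
    -- in that single direction absorb ‖ξ‖ ^ N.
    · obtain ⟨j, hj⟩ := Finite.exists_max fun i => |ξ (b i)|
      have h1 : ‖ξ‖ ≤ D * (Fintype.card (Fin (Module.finrank ℝ E)) * |ξ (b j)|) := by
        refine (hD ξ).trans ?_
        gcongr
        refine (Finset.sum_le_card_nsmul _ _ _ fun i _ => hj i).trans ?_
        simp
      calc ‖ξ‖ ^ N * ‖ftTest μ φ ξ‖
          ≤ (D * (Fintype.card (Fin (Module.finrank ℝ E)) * |ξ (b j)|)) ^ N * ‖ftTest μ φ ξ‖ := by
            gcongr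
        _ = D ^ N * ((Fintype.card (Fin (Module.finrank ℝ E)) : ℝ) ^ N *
            (|ξ (b j)| ^ N * ‖ftTest μ φ ξ‖)) := by ring
        _ ≤ D ^ N * ((Fintype.card (Fin (Module.finrank ℝ E)) : ℝ) ^ N * ∑ i, Ci i) := by
            gcongr
            rw [pow_mul_norm_ftTest]
            exact (norm_ftTest_le _ _ _).trans
              (Finset.single_le_sum (f := Ci) (fun i _ => hCi i) (Finset.mem_univ j))
        _ ≤ _ := le_add_of_nonneg_right hC0
  have h2 : (1 + ‖ξ‖) ^ N ≤ 2 ^ (N - 1) * (1 ^ N + ‖ξ‖ ^ N) :=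
    add_pow_le zero_le_one (norm_nonneg ξ) N
  have hN2 : (2 : ℝ) ^ (N - 1) ≤ 2 ^ N := pow_le_pow_right₀ (by norm_num) (by omega)
  rcases Nat.eq_zero_or_pos N with rfl | hN
  · simp only [pow_zero, one_mul]
    have := norm_ftTest_le μ φ ξ
    have h3 := Finset.sum_nonneg fun i (_ : i ∈ Finset.univ) => hCi i
    linarith
  have h22 : (2 : ℝ) ^ N = 2 * 2 ^ (N - 1) := by
    rw [← pow_succ', Nat.sub_add_cancel hN]
  calc (1 + ‖ξ‖) ^ N * ‖ftTest μ φ ξ‖ ≤ 2 ^ (N - 1) * (1 ^ N + ‖ξ‖ ^ N) * ‖ftTest μ φ ξ‖ := by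
        gcongr
    _ = 2 ^ (N - 1) * (‖ftTest μ φ ξ‖ + ‖ξ‖ ^ N * ‖ftTest μ φ ξ‖) := by ring
    _ ≤ 2 ^ (N - 1) * (C0 + (D ^ N * ((Fintype.card (Fin (Module.finrank ℝ E)) : ℝ) ^ N *
          ∑ i, Ci i) + C0)) := by
        gcongr
        exact norm_ftTest_le μ φ ξ
    _ ≤ _ := by
        rw [h22]
        have h3 := Finset.sum_nonneg fun i (_ : i ∈ Finset.univ) => hCi i
        have : 0 ≤ D ^ N * ((Fintype.card (Fin (Module.finrank ℝ E)) : ℝ) ^ N * ∑ i, Ci i) := by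
          positivity
        nlinarith [pow_pos (show (0:ℝ) < 2 by norm_num) (N-1)]

end Tools

end QEI

end

noncomputable section

namespace QEI

/-! ### Fourier series on a box -/

section FourierSeries

variable {E : Type} [NormedAddCommGroup E] [NormedSpace ℝ E] {ι : Type} [Fintype ι]

/-- Every finite set of multi-indices lies in the product of its coordinate projections, over which
the sum of products factorises. -/
theorem summable_prod_pi (a : ℤ → ℝ) (h0 : ∀ k, 0 ≤ a k) (ha : Summable a) :
    Summable fun n : ι → ℤ => ∏ i, a (n i) := by
  classical
  refine summable_of_sum_le (c := ∏ _i : ι, ∑' k, a k)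
    (fun n => Finset.prod_nonneg fun i _ => h0 _) fun s => ?_
  have hs : s ⊆ Fintype.piFinset fun i => s.image fun n => n i := by
    intro n hn
    simp only [Fintype.mem_piFinset, Finset.mem_image]
    exact fun i => ⟨n, hn, rfl⟩
  refine (Finset.sum_le_sum_of_subset_of_nonneg hs
    fun n _ _ => Finset.prod_nonneg fun i _ => h0 _).trans ?_
  rw [← Finset.prod_univ_sum]
  exact Finset.prod_le_prod (fun i _ => Finset.sum_nonneg fun k _ => h0 k)
    fun i _ => ha.sum_le_tsum _ fun k _ => h0 k

/-- The frequencies of functions which are periodic with respect to a box. -/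
def latticeCovector (A : E ≃L[ℝ] (ι → ℝ)) (n : ι → ℤ) : E →L[ℝ] ℝ :=
  (∑ i, (2 * Real.pi * n i) • ContinuousLinearMap.proj (R := ℝ) (φ := fun _ : ι => ℝ) i).comp
    (A : E →L[ℝ] (ι → ℝ))

theorem latticeCovector_apply (A : E ≃L[ℝ] (ι → ℝ)) (n : ι → ℤ) (z : E) :
    latticeCovector A n z = ∑ i, 2 * Real.pi * n i * A z i := by
  simp [latticeCovector]

theorem latticeCovector_neg (A : E ≃L[ℝ] (ι → ℝ)) (n : ι → ℤ) :
    latticeCovector A (-n) = -latticeCovector A n := by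
  ext z
  simp [latticeCovector_apply]

/-- Evaluation on the vectors `A.symm (Pi.single i 1)` shows that the norm of the covector controls
every |n i|. The exponent `2 * card` leaves a summable factor (1 + |n i|)⁻² for each coordinate. -/
theorem summable_latticeCovector (A : E ≃L[ℝ] (ι → ℝ)) :
    Summable fun n => ((1 + ‖latticeCovector A n‖) ^ (2 * Fintype.card ι))⁻¹ := by
  classical
  obtain ⟨C, hC1, hC⟩ : ∃ C : ℝ, 1 ≤ C ∧ ∀ n i,
      (1 + |(n i : ℝ)|) ≤ C * (1 + ‖latticeCovector A n‖) := by
    let S := ∑ i, ‖A.symm (Pi.single i 1)‖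
    have hS : 0 ≤ S := Finset.sum_nonneg fun i _ => norm_nonneg _
    refine ⟨1 + S, by linarith, fun n i => ?_⟩
    have h1 : latticeCovector A n (A.symm (Pi.single i 1)) = 2 * Real.pi * n i := by
      rw [latticeCovector_apply]
      simp [Pi.single_apply]
    have h2 := (latticeCovector A n).le_opNorm (A.symm (Pi.single i 1))
    rw [h1, Real.norm_eq_abs, abs_mul, abs_of_pos Real.two_pi_pos] at h2
    have h3 : ‖A.symm (Pi.single i (1 : ℝ))‖ ≤ S :=
      Finset.single_le_sum (f := fun i => ‖A.symm (Pi.single i (1 : ℝ))‖)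
        (fun i _ => norm_nonneg _) (Finset.mem_univ i)
    have h4 : |(n i : ℝ)| ≤ 2 * Real.pi * |(n i : ℝ)| := by
      have := abs_nonneg (n i : ℝ)
      nlinarith [Real.pi_gt_three]
    have h5 : ‖latticeCovector A n‖ * ‖A.symm (Pi.single i (1 : ℝ))‖ ≤
      ‖latticeCovector A n‖ * S := by gcongr
    nlinarith [norm_nonneg (latticeCovector A n)]
  have hsum : Summable fun k : ℤ => ((1 + |(k : ℝ)|) ^ 2)⁻¹ := by
    have h1 : Summable fun k : ℕ => ((1 + |((k : ℤ) : ℝ)|) ^ 2)⁻¹ := by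
      have := (summable_nat_add_iff 1).2 (Real.summable_nat_pow_inv (p := 2) |>.2 (by norm_num))
      refine this.congr fun k => ?_
      simp [add_comm]
    refine Summable.of_nat_of_neg h1 ?_
    simpa using h1
  have h := (summable_prod_pi (ι := ι) _ (fun k => by positivity) hsum).mul_left
    ((C ^ (2 * Fintype.card ι)))
  refine Summable.of_nonneg_of_le (fun n => by positivity) (fun n => ?_) h
  rw [Finset.prod_inv_distrib, ← div_eq_mul_inv, inv_eq_one_div,
    div_le_div_iff₀ (by positivity) (Finset.prod_pos fun i _ => by positivity), one_mul,
    ← mul_pow]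
  calc ∏ i, (1 + |(n i : ℝ)|) ^ 2 ≤ ∏ _i : ι, (C * (1 + ‖latticeCovector A n‖)) ^ 2 := by
        refine Finset.prod_le_prod (fun i _ => by positivity) fun i _ => ?_
        have := hC n i
        gcongr
    _ = _ := by simp [pow_mul]

theorem mFourier_coe (A : E ≃L[ℝ] (ι → ℝ)) (n : ι → ℤ) (z : E) :
    UnitAddTorus.mFourier n (fun i => ((A z i : ℝ) : UnitAddCircle)) =
      planeWave (latticeCovector A n) z := by
  simp only [UnitAddTorus.mFourier, ContinuousMap.coe_mk, fourier_coe_apply, planeWave,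
    latticeCovector_apply]
  rw [← Complex.exp_sum]
  congr 1
  push_cast
  rw [Finset.mul_sum]
  exact Finset.sum_congr rfl fun i _ => by ring

/-- Periodic extension of a function supported in the unit box. -/
theorem exists_torus_lift {f : (ι → ℝ) → ℂ} (hf : Continuous f)
    (h0 : ∀ x, f x ≠ 0 → ∀ i, |x i| < 1 / 2) :
    ∃ F : C(UnitAddTorus ι, ℂ), ∀ x : ι → ℝ, (∀ i, |x i| ≤ 1 / 2) →
      F (fun i => (x i : UnitAddCircle)) = f x := by
  let K : Set (ι → ℝ) := Set.pi univ fun _ => Icc (-(1 / 2) : ℝ) (1 / 2)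
  have hK : IsCompact K := isCompact_univ_pi fun _ => isCompact_Icc
  have : CompactSpace K := isCompact_iff_compactSpace.1 hK
  let lift : UnitAddTorus ι → ι → ℝ := fun y i =>
    (AddCircle.equivIoc (1 : ℝ) (-(1 / 2)) (y i)).1
  have hlift : ∀ y, (fun i => (lift y i : UnitAddCircle)) = y := by
    intro y; funext i
    exact (AddCircle.equivIoc (1 : ℝ) (-(1 / 2))).symm_apply_apply (y i)
  have hmem : ∀ y i, lift y i ∈ Ioc (-(1 / 2) : ℝ) (-(1 / 2) + 1) := fun y i =>
    (AddCircle.equivIoc (1 : ℝ) (-(1 / 2)) (y i)).2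
  -- The representative in the half-open box differs from x only if some coordinate of x is -1/2.
  -- Then x and its representative both have a coordinate of modulus 1/2, and f vanishes at both.
  have key : ∀ x : ι → ℝ, (∀ i, |x i| ≤ 1 / 2) →
      f (lift (fun i => (x i : UnitAddCircle))) = f x := by
    intro x hx
    have hcase : ∀ i, x i ∈ Ioc (-(1 / 2) : ℝ) (-(1 / 2) + 1) →
        lift (fun i => (x i : UnitAddCircle)) i = x i := fun i hi => by
      simp only [lift]
      rw [AddCircle.equivIoc_coe_eq hi]
    by_cases h : ∀ i, x i ∈ Ioc (-(1 / 2) : ℝ) (-(1 / 2) + 1)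
    · congr 1; funext i; exact hcase i (h i)
    · push Not at h
      obtain ⟨i, hi⟩ := h
      have hxi : x i = -(1 / 2) := by
        have := abs_le.1 (hx i)
        by_contra hne
        exact hi ⟨lt_of_le_of_ne this.1 (Ne.symm hne), by linarith [this.2]⟩
      have h1 : f x = 0 := by
        by_contra hne
        have := h0 x hne i
        rw [hxi] at this; norm_num at this
      have h2 : lift (fun i => (x i : UnitAddCircle)) i = 1 / 2 := by
        have e : (x i : UnitAddCircle) = ((1 / 2 : ℝ) : UnitAddCircle) := by
          rw [hxi, ← AddCircle.coe_add_period (1 : ℝ) (-(1 / 2))]; norm_num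
        simp only [lift]
        rw [e, AddCircle.equivIoc_coe_eq (by norm_num)]
      rw [h1]
      by_contra hne
      have := h0 _ hne i
      rw [h2] at this; norm_num at this
  let p : K → UnitAddTorus ι := fun x i => (x.1 i : UnitAddCircle)
  have hp : Continuous p := by
    refine continuous_pi fun i => ?_
    exact (AddCircle.continuous_mk' (1 : ℝ)).comp ((continuous_apply i).comp continuous_subtype_val)
  have hsurj : Function.Surjective p := fun y =>
    ⟨⟨lift y, fun i _ => ⟨(hmem y i).1.le, by have := (hmem y i).2; linarith⟩⟩, hlift y⟩
  -- The closed cube is compact, so its projection to the torus is a closed surjection, and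
  -- continuity of the periodic extension can be tested on the cube.
  have hq : IsQuotientMap p := hp.isClosedMap.isQuotientMap hp hsurj
  refine ⟨⟨fun y => f (lift y), ?_⟩, key⟩
  rw [hq.continuous_iff]
  refine (hf.comp continuous_subtype_val).congr fun x => ?_
  exact (key x.1 fun i => abs_le.2 (x.2 i trivial)).symm

variable [MeasurableSpace E] [BorelSpace E] [FiniteDimensional ℝ E]

/-- The Haar measure on `E` for which the unit box of `A` has measure `1`. -/
def boxMeasure (A : E ≃L[ℝ] (ι → ℝ)) : Measure E := Measure.map A.symm volume

instance (A : E ≃L[ℝ] (ι → ℝ)) : (boxMeasure A).IsAddHaarMeasure :=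
  A.symm.isAddHaarMeasure_map volume

theorem summable_ftTest_latticeCovector (A : E ≃L[ℝ] (ι → ℝ)) (φ : Test E) (N : ℕ) :
    Summable fun n : ι → ℤ => ‖ftTest (boxMeasure A) φ (-latticeCovector A n)‖ *
      (1 + ‖latticeCovector A n‖) ^ N := by
  obtain ⟨C, hC0, hC⟩ := exists_norm_ftTest_le (boxMeasure A) φ (N + 2 * Fintype.card ι)
  refine Summable.of_nonneg_of_le (fun n => by positivity) (fun n => ?_)
    ((summable_latticeCovector A).mul_left C)
  have := hC (-latticeCovector A n)
  rw [norm_neg] at this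
  rw [← div_eq_mul_inv, le_div_iff₀ (by positivity)]
  calc _ = _ := by rw [pow_add]; ring
    _ ≤ C := this

/-- The Fourier coefficients of the periodic extension of φ are values of its Fourier transform on
the lattice, with the sign reversed. They decay rapidly, so the series is absolutely summable and
converges pointwise to the function. -/
theorem hasSum_fourier_box (A : E ≃L[ℝ] (ι → ℝ)) (φ : Test E)
    (hφ : ∀ z, φ z ≠ 0 → ∀ i, |A z i| < 1 / 2) {z : E} (hz : ∀ i, |A z i| < 1 / 2) :
    HasSum (fun n : ι → ℤ => ftTest (boxMeasure A) φ (-latticeCovector A n) *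
      planeWave (latticeCovector A n) z) (φ z) := by
  obtain ⟨F, hF⟩ := exists_torus_lift (f := fun x => φ (A.symm x))
    (φ.continuous.comp A.symm.continuous) (fun x hx i => by simpa using hφ _ hx i)
  have hcoef : ∀ n, UnitAddTorus.mFourierCoeff F n =
      ftTest (boxMeasure A) φ (-latticeCovector A n) := by
    intro n
    have hmap : ∀ g : E → ℂ, ∫ z, g z ∂(Measure.map A.symm volume) = ∫ x, g (A.symm x) :=
      fun g => (A.symm.toHomeomorph.measurableEmbedding).integral_map g
    rw [UnitAddTorus.mFourierCoeff_eq_integral _ _ (fun _ => -(1 / 2)), ftTest, boxMeasure, hmap]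
    have hmeas : MeasurableSet {x : ι → ℝ | ∀ i, x i ∈ Ioc (-(1 / 2) : ℝ) (-(1 / 2) + 1)} :=
      MeasurableSet.univ_pi' fun i => measurableSet_Ioc
    rw [← integral_indicator hmeas]
    congr 1
    funext x
    have hmf := mFourier_coe A (-n) (A.symm x)
    simp only [ContinuousLinearEquiv.apply_symm_apply] at hmf
    by_cases hx : x ∈ {x : ι → ℝ | ∀ i, x i ∈ Ioc (-(1 / 2) : ℝ) (-(1 / 2) + 1)}
    · rw [indicator_of_mem hx]
      have h1 := hF x fun i => abs_le.2 ⟨(hx i).1.le, by have := (hx i).2; linarith⟩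
      rw [h1, hmf, latticeCovector_neg]
      rfl
    · rw [indicator_of_notMem hx]
      have : φ (A.symm x) = 0 := by
        by_contra hne
        refine hx fun i => ?_
        have := hφ _ hne i
        simp only [ContinuousLinearEquiv.apply_symm_apply] at this
        have := abs_lt.1 this
        exact ⟨this.1, by linarith [this.2]⟩
      exact (mul_eq_zero_of_right _ this).symm
  have hsum : Summable (UnitAddTorus.mFourierCoeff F) := by
    refine Summable.of_norm ?_
    simp_rw [hcoef]
    simpa using summable_ftTest_latticeCovector A φ 0
  have h := UnitAddTorus.hasSum_mFourier_series_apply_of_summable hsum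
    (fun i => ((A z i : ℝ) : UnitAddCircle))
  rw [hF _ fun i => (hz i).le] at h
  simpa [hcoef, mFourier_coe] using h

theorem exists_box (K : Set E) (hK : IsCompact K) :
    ∃ A : E ≃L[ℝ] (Fin (Module.finrank ℝ E) → ℝ), ∀ z ∈ K, ∀ i, |A z i| < 1 / 2 := by
  let A₀ : E ≃L[ℝ] (Fin (Module.finrank ℝ E) → ℝ) :=
    (Module.finBasis ℝ E).equivFun.toContinuousLinearEquiv
  obtain ⟨R, hR⟩ := (hK.image A₀.continuous).isBounded.exists_norm_le
  have hc : (2 * (|R| + 1))⁻¹ ≠ 0 := by positivity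
  refine ⟨A₀.trans (LinearEquiv.smulOfNeZero ℝ _ _ hc).toContinuousLinearEquiv, fun z hz i => ?_⟩
  have h1 : |A₀ z i| ≤ |R| :=
    (norm_le_pi_norm (A₀ z) i).trans ((hR _ ⟨z, hz, rfl⟩).trans (le_abs_self R))
  have h2 : |(2 * (|R| + 1))⁻¹ * A₀ z i| < 1 / 2 := by
    rw [abs_mul, abs_of_pos (by positivity : 0 < (2 * (|R| + 1))⁻¹), inv_mul_lt_iff₀ (by positivity)]
    linarith
  exact h2

end FourierSeries

/-! ### Applying a functional term by term to a plane wave expansion -/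

section Expansion

variable {E : Type} [NormedAddCommGroup E] [NormedSpace ℝ E]

/-- The remainder after a finite partial sum is a test function supported in the support of χ. Its
derivatives up to the order of T on that set are bounded by the tail of one summable series, so T of
the remainder tends to zero. -/
theorem HasLocalOrder.hasSum_of_expansion {I : Type} {T : Test E →ₗ[ℂ] ℂ} (hT : HasLocalOrder T)
    (χ f : Test E) (c : I → ℂ) (ξ : I → E →L[ℝ] ℝ)
    (hc : ∀ N : ℕ, Summable fun n => ‖c n‖ * (1 + ‖ξ n‖) ^ N)
    (hf : ∀ x, HasSum (fun n => χ x * (c n * planeWave (ξ n) x)) (f x)) :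
    HasSum (fun n => c n * T (modulate χ (ξ n))) (T f) := by
  classical
  obtain ⟨N, C, hC0, hC⟩ := hT _ χ.hasCompactSupport
  have hM : ∀ N : ℕ, ∃ M : ℝ, 0 ≤ M ∧ ∀ ξ : E →L[ℝ] ℝ, ∀ i ≤ N, ∀ x,
      ‖iteratedFDeriv ℝ i (modulate χ ξ) x‖ ≤ M * (1 + ‖ξ‖) ^ N :=
    exists_norm_iteratedFDeriv_modulate_le χ
  choose M hM0 hM using hM
  let v : ℕ → I → ℝ := fun k n => M k * (‖c n‖ * (1 + ‖ξ n‖) ^ k)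
  have hv : ∀ k, Summable (v k) := fun k => (hc k).mul_left _
  have hv0 : ∀ k n, 0 ≤ v k n := fun k n => mul_nonneg (hM0 k) (by positivity)
  have hbound : ∀ (k : ℕ) (n : I) (x : E),
      ‖iteratedFDeriv ℝ k (⇑(c n • modulate χ (ξ n))) x‖ ≤ v k n := by
    intro k n x
    have h1 : ⇑(c n • modulate χ (ξ n)) = c n • ⇑(modulate χ (ξ n)) := rfl
    rw [h1, iteratedFDeriv_const_smul_apply
      ((modulate χ (ξ n)).contDiff.of_le (mod_cast le_top)).contDiffAt, norm_smul]
    calc _ ≤ ‖c n‖ * (M k * (1 + ‖ξ n‖) ^ k) := by gcongr; exact hM k (ξ n) k le_rfl x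
      _ = _ := by simp only [v]; ring
  let w : I → ℝ := fun n => ∑ k ∈ Finset.range (N + 1), v k n
  have hw : Summable w := summable_sum fun k _ => hv k
  have hkey : ∀ s : Finset I, ‖T f - ∑ n ∈ s, c n * T (modulate χ (ξ n))‖ ≤
      C * ∑' n : {n // n ∉ s}, w n := by
    intro s
    let R : Test E := f - ∑ n ∈ s, c n • modulate χ (ξ n)
    have hTR : T R = T f - ∑ n ∈ s, c n * T (modulate χ (ξ n)) := by
      simp [R, map_sub, map_sum]
    have hR : ⇑R = fun x => ∑' n : {n // n ∉ s}, (c n • modulate χ (ξ n)) x := by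
      funext x
      have h1 := ((hasSum_subtype_iff_indicator (f := fun n => χ x * (c n * planeWave (ξ n) x))
        (s := {n | n ∉ s})).2
        (by
          have h2 := (hf x).sub ((hasSum_sum_of_ne_finset_zero (s := s)
            (f := fun n => if n ∈ s then χ x * (c n * planeWave (ξ n) x) else 0)
            (fun n hn => by simp [hn])))
          refine (h2.congr_fun fun n => ?_)
          by_cases hn : n ∈ s <;> simp [hn, indicator])).tsum_eq
      have h3 : R x = f x - ∑ n ∈ s, χ x * (c n * planeWave (ξ n) x) := by
        change f x - (∑ n ∈ s, c n • modulate χ (ξ n) : Test E) x = _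
        rw [sum_apply]
        congr 1
        refine Finset.sum_congr rfl fun n _ => ?_
        change c n * (planeWave (ξ n) x * χ x) = _
        ring
      rw [h3]
      have h5 : ∑ n ∈ s, (if n ∈ s then χ x * (c n * planeWave (ξ n) x) else 0) =
          ∑ n ∈ s, χ x * (c n * planeWave (ξ n) x) :=
        Finset.sum_congr rfl fun n hn => by simp [hn]
      rw [← h5, ← h1]
      refine tsum_congr fun n => ?_
      change χ x * (c n * planeWave (ξ n) x) = c n * (planeWave (ξ n) x * χ x)
      ring
    rw [← hTR]
    have hw0 : ∀ n, 0 ≤ w n := fun n => Finset.sum_nonneg fun k _ => hv0 k n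
    refine hC R (fun x hx => ?_) _ fun k hk x => ?_
    · rw [hR]
      simp only
      have : χ x = 0 := image_eq_zero_of_notMem_tsupport hx
      convert tsum_zero with n
      change c n * (planeWave (ξ n) x * χ x) = 0
      simp [this]
    · rw [hR, iteratedFDeriv_tsum_apply (𝕜 := ℝ) (N := ⊤) (v := fun k (n : {n // n ∉ s}) => v k n)
        (fun n => (c n • modulate χ (ξ n)).contDiff)
        (fun k _ => (hv k).subtype _) (fun k n x _ => hbound k n x) le_top]
      have hs : Summable fun n : {n // n ∉ s} => v k n := (hv k).subtype _
      refine (tsum_of_norm_bounded hs.hasSum fun n => hbound k n x).trans ?_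
      refine hs.tsum_le_tsum (fun n => ?_) (hw.subtype _)
      exact Finset.single_le_sum (f := fun k => v k n) (fun k _ => hv0 k n) (by simp; omega)
  rw [HasSum, tendsto_iff_norm_sub_tendsto_zero]
  have htail : Filter.Tendsto (fun s : Finset I => C * ∑' n : {n // n ∉ s}, w n) Filter.atTop
      (𝓝 0) := by
    simpa using (_root_.tendsto_tsum_compl_atTop_zero w).const_mul C
  refine squeeze_zero (fun s => norm_nonneg _) (fun s => ?_) htail
  rw [norm_sub_rev]
  exact hkey s

end Expansion

end QEI

end

noncomputable section

namespace QEI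

/-! ### Rapid decay in all directions implies smoothness -/

section Microlocal

variable {E : Type} [NormedAddCommGroup E] [NormedSpace ℝ E]

/-- The localized Fourier transform of `T` decays rapidly, uniformly along the rays through `S`. -/
def DecaysOn (T : Test E →ₗ[ℂ] ℂ) (χ : Test E) (S : Set (E →L[ℝ] ℝ)) : Prop :=
  ∀ N : ℕ, ∃ C : ℝ, ∀ η ∈ S, ∀ r : ℝ, 0 < r → r ^ N * ‖T (modulate χ (r • η))‖ ≤ C

theorem DecaysOn.mono {T : Test E →ₗ[ℂ] ℂ} {χ : Test E} {S S' : Set (E →L[ℝ] ℝ)}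
    (h : DecaysOn T χ S) (hS : S' ⊆ S) : DecaysOn T χ S' := fun N =>
  let ⟨C, hC⟩ := h N
  ⟨C, fun η hη => hC η (hS hη)⟩

theorem DecaysOn.union {T : Test E →ₗ[ℂ] ℂ} {χ : Test E} {S S' : Set (E →L[ℝ] ℝ)}
    (h : DecaysOn T χ S) (h' : DecaysOn T χ S') : DecaysOn T χ (S ∪ S') := fun N => by
  obtain ⟨C, hC⟩ := h N
  obtain ⟨C', hC'⟩ := h' N
  refine ⟨max C C', fun η hη r hr => ?_⟩
  rcases hη with hη | hη
  · exact (hC η hη r hr).trans (le_max_left _ _)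
  · exact (hC' η hη r hr).trans (le_max_right _ _)

theorem modulate_modulate (χ : Test E) (ξ η : E →L[ℝ] ℝ) :
    modulate (modulate χ ξ) η = modulate χ (ξ + η) := by
  ext z
  simp only [modulate_apply, planeWave_add]
  ring

/-- A ball around ξ inside the cone, of radius at most ‖ξ‖/2, keeps ‖η‖ ≥ ‖ξ‖/2. Decay in ‖r • η‖ is
then decay in r, uniformly over the ball. -/
theorem IsRegularDirection.exists_decaysOn {u : Test E →L[ℂ] ℂ} {z : E} {ξ : E →L[ℝ] ℝ}
    (hξ : ξ ≠ 0) (h : IsRegularDirection u z ξ) :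
    ∃ χ : Test E, χ z ≠ 0 ∧ ∃ δ > 0, DecaysOn u.toLinearMap χ (Metric.ball ξ δ) := by
  obtain ⟨χ, hχ, V, hV, hξV, hcone, hdec⟩ := h
  obtain ⟨δ, hδ, hball⟩ := Metric.isOpen_iff.1 hV ξ hξV
  have hn : 0 < ‖ξ‖ := norm_pos_iff.2 hξ
  refine ⟨χ, hχ, min δ (‖ξ‖ / 2), by positivity, fun N => ?_⟩
  obtain ⟨C, hC⟩ := hdec N
  refine ⟨(2 / ‖ξ‖) ^ N * C, fun η hη r hr => ?_⟩
  have h1 : ‖η - ξ‖ < ‖ξ‖ / 2 := by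
    have := lt_of_lt_of_le (Metric.mem_ball.1 hη) (min_le_right _ _)
    rwa [dist_eq_norm] at this
  have h2 : ‖ξ‖ / 2 ≤ ‖η‖ := by
    have := norm_sub_norm_le ξ η
    rw [norm_sub_rev] at this
    linarith
  have h3 := hC (r • η) (hcone η (hball (Metric.ball_subset_ball (min_le_left _ _) hη)) r hr)
  rw [lt_div_iff₀ (by positivity)] at h3
  have h4 : ‖r • η‖ = r * ‖η‖ := by rw [norm_smul, Real.norm_of_nonneg hr.le]
  rw [h4] at h3
  have h5 : r ≤ 2 / ‖ξ‖ * (r * ‖η‖) := by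
    rw [div_mul_eq_mul_div, le_div_iff₀ hn]
    nlinarith
  have h0 := norm_nonneg (u (modulate χ (r • η)))
  calc r ^ N * ‖u (modulate χ (r • η))‖
      ≤ (2 / ‖ξ‖ * (r * ‖η‖)) ^ N * ‖u (modulate χ (r • η))‖ := by gcongr
    _ = (2 / ‖ξ‖) ^ N * ((r * ‖η‖) ^ N * ‖u (modulate χ (r • η))‖) := by ring
    _ ≤ (2 / ‖ξ‖) ^ N * C := by
        gcongr
        nlinarith

/-- A complex test function which equals `1` on a given ball. -/
theorem exists_test_eq_one [FiniteDimensional ℝ E] (R : ℝ) :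
    ∃ ψ : Test E, ∀ x, ‖x‖ ≤ R → ψ x = 1 := by
  let f : ContDiffBump (0 : E) := ⟨|R| + 1, |R| + 2, by positivity, by linarith⟩
  refine ⟨⟨fun x => (f x : ℂ), Complex.ofRealCLM.contDiff.comp f.contDiff,
    f.hasCompactSupport.comp_left (g := fun r : ℝ => (r : ℂ)) (by simp), fun _ _ => trivial⟩,
    fun x hx => ?_⟩
  have : f x = 1 := f.one_of_mem_closedBall (by
    simp only [mem_closedBall_zero_iff, f]; linarith [le_abs_self R])
  change (f x : ℂ) = 1
  rw [this]; simp

variable [MeasurableSpace E] [BorelSpace E] [FiniteDimensional ℝ E]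

theorem HasLocalOrder.hasSum_mulTest {T : Test E →ₗ[ℂ] ℂ} (hT : HasLocalOrder T)
    {ι : Type} [Fintype ι] (A : E ≃L[ℝ] (ι → ℝ)) (χ φ : Test E)
    (hχ : ∀ z, χ z ≠ 0 → ∀ i, |A z i| < 1 / 2) (hφ : ∀ z, φ z ≠ 0 → ∀ i, |A z i| < 1 / 2) :
    HasSum (fun n : ι → ℤ => ftTest (boxMeasure A) φ (-latticeCovector A n) *
      T (modulate χ (latticeCovector A n))) (T (mulTest χ φ)) := by
  refine hT.hasSum_of_expansion χ (mulTest χ φ) _ _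
    (fun N => summable_ftTest_latticeCovector A φ N) fun x => ?_
  by_cases hx : χ x = 0
  · simp [hx]
  · exact (hasSum_fourier_box A φ hφ (hχ x hx)).mul_left _

theorem exists_box_test (χ φ : Test E) :
    ∃ A : E ≃L[ℝ] (Fin (Module.finrank ℝ E) → ℝ), (∀ z, χ z ≠ 0 → ∀ i, |A z i| < 1 / 2) ∧
      (∀ z, φ z ≠ 0 → ∀ i, |A z i| < 1 / 2) := by
  obtain ⟨A, hA⟩ := exists_box (tsupport χ ∪ tsupport φ)
    (IsCompact.union χ.hasCompactSupport φ.hasCompactSupport)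
  exact ⟨A, fun z hz => hA z (Or.inl (subset_tsupport _ hz)),
    fun z hz => hA z (Or.inr (subset_tsupport _ hz))⟩

/-- Multiplication by a further test function preserves rapid decay in a smaller cone. -/
theorem DecaysOn.mulTest {T : Test E →ₗ[ℂ] ℂ} (hT : HasLocalOrder T) {χ : Test E}
    {ξ : E →L[ℝ] ℝ} {δ : ℝ} (hδ : 0 < δ) (h : DecaysOn T χ (Metric.ball ξ δ)) (φ : Test E) :
    DecaysOn T (mulTest χ φ) (Metric.ball ξ (δ / 2)) := by
  obtain ⟨A, hAχ, hAφ⟩ := exists_box_test χ φ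
  intro N
  obtain ⟨C, hC⟩ := h N
  obtain ⟨N₀, M, hM0, hM⟩ := hT.exists_norm_modulate_le χ
  let L := latticeCovector A
  let c := fun n => ftTest (boxMeasure A) φ (-L n)
  let D := 1 + 2 / δ * (‖ξ‖ + δ)
  have hD : 0 ≤ D := by positivity
  let M' := |C| + (2 / δ) ^ N * (M * D ^ N₀)
  have hM' : 0 ≤ M' := by positivity
  have hsum := (summable_ftTest_latticeCovector A φ (N₀ + N)).mul_left M'
  refine ⟨∑' n, M' * (‖c n‖ * (1 + ‖L n‖) ^ (N₀ + N)), fun η hη r hr => ?_⟩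
  have hη1 : ‖η - ξ‖ < δ / 2 := by rwa [← dist_eq_norm]
  have hterm : ∀ n, r ^ N * ‖T (modulate χ (r • η + L n))‖ ≤ M' * (1 + ‖L n‖) ^ (N₀ + N) := by
    intro n
    have hL := norm_nonneg (L n)
    -- Multiplication by φ shifts the frequency r • η by L n. A small shift stays on a ray through
    -- the larger ball, where decay is assumed. For a large shift r is at most (2/δ)‖L n‖, so the
    -- rapidly decreasing coefficients of φ pay both for r ^ N and for the polynomial growth of T.
    by_cases hn : ‖L n‖ < r * (δ / 2)
    · have h1 : r • η + L n = r • (η + r⁻¹ • L n) := by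
        rw [smul_add, smul_inv_smul₀ hr.ne']
      have h2 : η + r⁻¹ • L n ∈ Metric.ball ξ δ := by
        rw [Metric.mem_ball, dist_eq_norm]
        have h3 : ‖r⁻¹ • L n‖ < δ / 2 := by
          rw [norm_smul, norm_inv, Real.norm_of_nonneg hr.le, inv_mul_lt_iff₀ hr]
          exact hn
        calc ‖η + r⁻¹ • L n - ξ‖ = ‖(η - ξ) + r⁻¹ • L n‖ := by congr 1; abel
          _ ≤ ‖η - ξ‖ + ‖r⁻¹ • L n‖ := norm_add_le _ _
          _ < δ := by linarith
      rw [h1]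
      have h5 : (1 : ℝ) ≤ (1 + ‖L n‖) ^ (N₀ + N) := one_le_pow₀ (by linarith)
      calc _ ≤ C := hC _ h2 r hr
        _ ≤ |C| := le_abs_self C
        _ ≤ M' := le_add_of_nonneg_right (by positivity)
        _ ≤ _ := le_mul_of_one_le_right hM' h5
    · push Not at hn
      have h1 : r ≤ 2 / δ * ‖L n‖ := by
        rw [div_mul_eq_mul_div, le_div_iff₀ hδ]; linarith
      have h2 : ‖η‖ ≤ ‖ξ‖ + δ := by
        have := norm_sub_norm_le η ξ
        linarith
      have h3 : ‖r • η + L n‖ ≤ 2 / δ * ‖L n‖ * (‖ξ‖ + δ) + ‖L n‖ := by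
        refine (norm_add_le _ _).trans ?_
        rw [norm_smul, Real.norm_of_nonneg hr.le]
        gcongr
      have h4 : 1 + ‖r • η + L n‖ ≤ D * (1 + ‖L n‖) := by
        have : 0 ≤ 2 / δ * (‖ξ‖ + δ) := by positivity
        simp only [D]
        nlinarith
      calc r ^ N * ‖T (modulate χ (r • η + L n))‖
          ≤ (2 / δ * (1 + ‖L n‖)) ^ N * (M * (D * (1 + ‖L n‖)) ^ N₀) := by
            have h5 : r ≤ 2 / δ * (1 + ‖L n‖) := by
              have : 0 ≤ 2 / δ := by positivity
              nlinarith
            have h6 : ‖T (modulate χ (r • η + L n))‖ ≤ M * (D * (1 + ‖L n‖)) ^ N₀ := by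
              refine (hM _).trans ?_
              gcongr
            gcongr
        _ = (2 / δ) ^ N * (M * D ^ N₀) * (1 + ‖L n‖) ^ (N₀ + N) := by
            rw [pow_add, mul_pow, mul_pow]; ring
        _ ≤ _ := by
            gcongr
            exact le_add_of_nonneg_left (abs_nonneg C)
  have h1 : HasSum (fun n => c n * T (modulate χ (r • η + L n)))
      (T (modulate (QEI.mulTest χ φ) (r • η))) := by
    have h2 := hT.hasSum_mulTest A (modulate χ (r • η)) φ
      (fun z hz => hAχ z (right_ne_zero_of_mul hz)) hAφ
    have h3 : QEI.mulTest (modulate χ (r • η)) φ = modulate (QEI.mulTest χ φ) (r • η) := by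
      ext z; simp [mul_assoc]
    rw [h3] at h2
    simpa only [modulate_modulate] using h2
  have h2 := h1.mul_left ((r : ℂ) ^ N)
  have h3 : ‖(r : ℂ) ^ N * T (modulate (QEI.mulTest χ φ) (r • η))‖ ≤
      ∑' n, M' * (‖c n‖ * (1 + ‖L n‖) ^ (N₀ + N)) := by
    rw [← h2.tsum_eq]
    refine tsum_of_norm_bounded hsum.hasSum fun n => ?_
    rw [norm_mul, norm_mul, norm_pow, Complex.norm_real, Real.norm_of_nonneg hr.le]
    calc _ = ‖c n‖ * (r ^ N * ‖T (modulate χ (r • η + L n))‖) := by ring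
      _ ≤ ‖c n‖ * (M' * (1 + ‖L n‖) ^ (N₀ + N)) :=
          mul_le_mul_of_nonneg_left (hterm n) (norm_nonneg _)
      _ = _ := by ring
  rwa [norm_mul, norm_pow, Complex.norm_real, Real.norm_of_nonneg hr.le] at h3

/-- Compactness of the unit sphere reduces to finitely many directions, whose cut-offs are
multiplied together. The property carried through the induction therefore demands decay after
multiplication by every further φ. -/
theorem exists_decaysOn_sphere {T : Test E →ₗ[ℂ] ℂ} (hT : HasLocalOrder T) (z : E)
    (h : ∀ ξ : E →L[ℝ] ℝ, ξ ≠ 0 →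
      ∃ χ : Test E, χ z ≠ 0 ∧ ∃ δ > 0, DecaysOn T χ (Metric.ball ξ δ)) :
    ∃ χ : Test E, χ z ≠ 0 ∧ DecaysOn T χ (Metric.sphere 0 1) := by
  have : ProperSpace (E →L[ℝ] ℝ) := FiniteDimensional.proper_real _
  have hc : IsCompact (Metric.sphere (0 : E →L[ℝ] ℝ) 1) := isCompact_sphere _ _
  obtain ⟨χ, hχ, hdec⟩ := hc.induction_on
    (p := fun S => ∃ χ : Test E, χ z ≠ 0 ∧ ∀ φ, DecaysOn T (mulTest χ φ) S)
    (by
      obtain ⟨ψ, hψ⟩ := exists_test_eq_one (E := E) ‖z‖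
      exact ⟨ψ, by simp [hψ z le_rfl], fun φ N => ⟨0, by simp⟩⟩)
    (fun S S' hS ⟨χ, h1, h2⟩ => ⟨χ, h1, fun φ => (h2 φ).mono hS⟩)
    (fun S S' ⟨χ, h1, h2⟩ ⟨χ', h1', h2'⟩ => ⟨mulTest χ χ', mul_ne_zero h1 h1', fun φ => by
      have e1 : mulTest (mulTest χ χ') φ = mulTest χ (mulTest χ' φ) := by
        ext z; simp [mul_assoc]
      have e2 : mulTest (mulTest χ χ') φ = mulTest χ' (mulTest χ φ) := by
        ext z; simp; ring
      exact DecaysOn.union (e1 ▸ h2 _) (e2 ▸ h2' _)⟩)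
    (fun ξ hξ => by
      have hξ0 : ξ ≠ 0 := by
        rintro rfl
        simp at hξ
      obtain ⟨χ, h1, δ, hδ, h2⟩ := h ξ hξ0
      exact ⟨Metric.ball ξ (δ / 2), mem_nhdsWithin_of_mem_nhds (Metric.ball_mem_nhds _ (by positivity)),
        χ, h1, fun φ => h2.mulTest hT hδ φ⟩)
  -- The induction gives decay only for products χφ; the choice φ = χ keeps the cut-off nonzero at
  -- z.
  exact ⟨mulTest χ χ, mul_ne_zero hχ hχ, hdec χ⟩

theorem DecaysOn.exists_rapid {T : Test E →ₗ[ℂ] ℂ} (hT : HasLocalOrder T) {χ : Test E}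
    (h : DecaysOn T χ (Metric.sphere 0 1)) (N : ℕ) :
    ∃ C : ℝ, 0 ≤ C ∧ ∀ ζ : E →L[ℝ] ℝ, (1 + ‖ζ‖) ^ N * ‖T (modulate χ ζ)‖ ≤ C := by
  obtain ⟨N₀, M, hM0, hM⟩ := hT.exists_norm_modulate_le χ
  obtain ⟨C, hC⟩ := h N
  refine ⟨2 ^ N * |C| + 2 ^ N * (M * 2 ^ N₀), by positivity, fun ζ => ?_⟩
  have h0 := norm_nonneg ζ
  by_cases hζ : ‖ζ‖ ≤ 1
  · have h1 : 1 + ‖ζ‖ ≤ 2 := by linarith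
    calc _ ≤ 2 ^ N * (M * 2 ^ N₀) := by
          have h2 : ‖T (modulate χ ζ)‖ ≤ M * 2 ^ N₀ := (hM ζ).trans (by gcongr)
          gcongr
      _ ≤ _ := le_add_of_nonneg_left (by positivity)
  · push Not at hζ
    have hpos : 0 < ‖ζ‖ := by linarith
    have h1 := hC (‖ζ‖⁻¹ • ζ) (by simp [norm_smul, hpos.ne']) ‖ζ‖ hpos
    rw [smul_inv_smul₀ hpos.ne'] at h1
    calc (1 + ‖ζ‖) ^ N * ‖T (modulate χ ζ)‖ ≤ (2 * ‖ζ‖) ^ N * ‖T (modulate χ ζ)‖ := by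
          gcongr; linarith
      _ = 2 ^ N * (‖ζ‖ ^ N * ‖T (modulate χ ζ)‖) := by rw [mul_pow]; ring
      _ ≤ 2 ^ N * |C| := by gcongr; exact h1.trans (le_abs_self C)
      _ ≤ _ := le_add_of_nonneg_right (by positivity)

/-- Expanding f in a Fourier series gives T(χf) = ∑ f̂(-L n) T(χ e_{L n}). Exchanging sum and
integral exhibits the density ∑ T(χ e_{L n}) exp(-i L n · x), smooth since its coefficients decay
rapidly. As f may leave the box, it is replaced by ψf with ψ = 1 on the support of χ; κ converts the
box measure to μ. -/
theorem exists_local_density (μ : Measure E) [μ.IsAddHaarMeasure] {T : Test E →ₗ[ℂ] ℂ}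
    (hT : HasLocalOrder T) {χ : Test E} (h : DecaysOn T χ (Metric.sphere 0 1)) :
    ∃ w : E → ℂ, ContDiff ℝ ∞ w ∧ ∀ f : Test E, T (mulTest χ f) = ∫ x, f x * w x ∂μ := by
  obtain ⟨R, hR⟩ := χ.hasCompactSupport.isCompact.isBounded.exists_norm_le
  obtain ⟨ψ, hψ⟩ := exists_test_eq_one (E := E) R
  obtain ⟨A, hAχ, hAψ⟩ := exists_box_test χ ψ
  let L := latticeCovector A
  let a := fun n => T (modulate χ (L n))
  have hrapid := h.exists_rapid hT
  have ha : ∀ N : ℕ, Summable fun n => ‖a n‖ * (1 + ‖L n‖) ^ N := by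
    intro N
    obtain ⟨C, hC0, hC⟩ := hrapid (N + 2 * Fintype.card (Fin (Module.finrank ℝ E)))
    refine Summable.of_nonneg_of_le (fun n => by positivity) (fun n => ?_)
      ((summable_latticeCovector A).mul_left C)
    have := hC (L n)
    rw [← div_eq_mul_inv, le_div_iff₀ (by positivity)]
    calc _ = _ := by rw [pow_add]; ring
      _ ≤ C := this
  have ha0 : Summable fun n => ‖a n‖ := by simpa using ha 0
  let w₀ : E → ℂ := fun x => ∑' n, a n * planeWave (-L n) x
  have hw₀ : ContDiff ℝ ∞ w₀ := by
    refine contDiff_tsum (v := fun k n => ‖a n‖ * (1 + ‖L n‖) ^ k)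
      (fun n => contDiff_const.mul (contDiff_planeWave _)) (fun k _ => ha k) fun k n x _ => ?_
    have h1 : (fun x => a n * planeWave (-L n) x) = a n • planeWave (-L n) := rfl
    rw [h1, iteratedFDeriv_const_smul_apply (contDiff_planeWave _).contDiffAt, norm_smul]
    gcongr
    refine (norm_iteratedFDeriv_planeWave_le _ _ _).trans ?_
    rw [norm_neg]
    gcongr
    linarith
  obtain ⟨κ, hκ⟩ : ∃ κ : ℝ, ∀ g : E → ℂ, ∫ x, g x ∂(boxMeasure A) = κ * ∫ x, g x ∂μ := by
    refine ⟨(Measure.addHaarScalarFactor (boxMeasure A) μ : ℝ), fun g => ?_⟩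
    refine (congrArg (fun ν => ∫ x, g x ∂ν)
      (Measure.isAddLeftInvariant_eq_smul (boxMeasure A) μ)).trans ?_
    simp only [integral_smul_nnreal_measure, NNReal.smul_def, Complex.real_smul]
  refine ⟨fun x => κ * (ψ x * w₀ x), contDiff_const.mul (ψ.contDiff.mul hw₀), fun f => ?_⟩
  have h1 : mulTest χ f = mulTest χ (mulTest ψ f) := by
    ext x
    by_cases hx : χ x = 0
    · simp [hx]
    · simp [hψ x (hR x (subset_tsupport _ hx))]
  have h2 := hT.hasSum_mulTest A χ (mulTest ψ f) hAχ fun z hz => hAψ z (left_ne_zero_of_mul hz)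
  rw [h1, ← h2.tsum_eq]
  have h3 : ∀ x, f x * (κ * (ψ x * w₀ x)) = κ * (mulTest ψ f x * w₀ x) := fun x => by
    simp; ring
  simp_rw [h3]
  rw [integral_const_mul, ← hκ]
  have h4 : ∀ x, mulTest ψ f x * w₀ x = ∑' n, mulTest ψ f x * (a n * planeWave (-L n) x) :=
    fun x => tsum_mul_left.symm
  simp_rw [h4]
  have h5 : ∀ n, Integrable (fun x => mulTest ψ f x * (a n * planeWave (-L n) x))
      (boxMeasure A) := fun n => by
    refine ((integrable_planeWave_mul (boxMeasure A) (mulTest ψ f) (-L n)).const_mul (a n)).congr ?_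
    exact Filter.Eventually.of_forall fun x => by simp only; ring
  rw [← integral_tsum_of_summable_integral_norm h5]
  · refine tsum_congr fun n => ?_
    simp only [ftTest]
    rw [mul_comm, ← integral_const_mul]
    congr 1; funext x; ring
  · have h6 : ∀ n, ∫ x, ‖mulTest ψ f x * (a n * planeWave (-L n) x)‖ ∂(boxMeasure A) =
        ‖a n‖ * ∫ x, ‖mulTest ψ f x‖ ∂(boxMeasure A) := fun n => by
      rw [← integral_const_mul]
      congr 1; funext x
      rw [norm_mul, norm_mul, norm_planeWave]; ring
    simp_rw [h6]
    exact ha0.mul_right _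

theorem eq_of_integral_test_mul_eq (μ : Measure E) [μ.IsAddHaarMeasure] {w w' : E → ℂ}
    (hw : Continuous w) (hw' : Continuous w')
    (h : ∀ f : Test E, ∫ x, f x * w x ∂μ = ∫ x, f x * w' x ∂μ) : w = w' := by
  have h1 : ∀ᵐ x ∂μ, (w - w') x = 0 := by
    refine ae_eq_zero_of_integral_contDiff_smul_eq_zero (E := E) ((hw.sub hw').locallyIntegrable)
      fun g hg hgc => ?_
    let f : Test E := ⟨fun x => (g x : ℂ), Complex.ofRealCLM.contDiff.comp hg,
      hgc.comp_left (g := fun r : ℝ => (r : ℂ)) (by simp), fun _ _ => trivial⟩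
    have hint : ∀ v : E → ℂ, Continuous v → Integrable (fun x => f x * v x) μ := fun v hv =>
      (f.continuous.mul hv).integrable_of_hasCompactSupport f.hasCompactSupport.mul_right
    have h2 := integral_sub (hint w hw) (hint w' hw')
    rw [h f, sub_self] at h2
    rw [← h2]
    congr 1; funext x
    change (g x) • (w x - w' x) = (g x : ℂ) * w x - (g x : ℂ) * w' x
    rw [Complex.real_smul]; ring
  have h2 : w =ᵐ[μ] w' := h1.mono fun x hx => sub_eq_zero.1 hx
  exact (Continuous.ae_eq_iff_eq μ hw hw').1 h2

theorem integrable_test_mul (μ : Measure E) [IsFiniteMeasureOnCompacts μ] (f : Test E)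
    {w : E → ℂ} (hw : Continuous w) : Integrable (fun x => f x * w x) μ :=
  (f.continuous.mul hw).integrable_of_hasCompactSupport f.hasCompactSupport.mul_right

/-- A functional which is locally given by smooth densities is given by a smooth density. -/
theorem exists_density_of_local (μ : Measure E) [μ.IsAddHaarMeasure] {T : Test E →ₗ[ℂ] ℂ}
    (h : ∀ z, ∃ χ : Test E, χ z ≠ 0 ∧ ∃ w : E → ℂ, ContDiff ℝ ∞ w ∧
      ∀ f : Test E, T (mulTest χ f) = ∫ x, f x * w x ∂μ) :
    ∃ w : E → ℂ, ContDiff ℝ ∞ w ∧ ∀ f : Test E, T f = ∫ x, f x * w x ∂μ := by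
  choose χ hχ w hw hT using h
  -- Both sides are densities of f ↦ T(χ_z χ_z' f), so the quotients w_z / χ_z agree wherever two
  -- cut-offs are nonzero and glue to a global W.
  have hcomp : ∀ z z', (fun x => χ z' x * w z x) = fun x => χ z x * w z' x := by
    intro z z'
    refine eq_of_integral_test_mul_eq μ ((χ z').continuous.mul (hw z).continuous)
      ((χ z).continuous.mul (hw z').continuous) fun f => ?_
    have h1 := hT z (mulTest (χ z') f)
    have h2 := hT z' (mulTest (χ z) f)
    have h3 : mulTest (χ z) (mulTest (χ z') f) = mulTest (χ z') (mulTest (χ z) f) := by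
      ext x; simp; ring
    rw [h3, h2] at h1
    simp only [mulTest_apply] at h1
    calc _ = ∫ x, χ z' x * f x * w z x ∂μ := by congr 1; funext x; ring
      _ = _ := h1.symm
      _ = _ := by congr 1; funext x; ring
  let W : E → ℂ := fun z => w z z / χ z z
  have hW : ∀ z x, w z x = χ z x * W x := by
    intro z x
    have h1 : χ x x * w z x = χ z x * w x x := congr_fun (hcomp z x) x
    change w z x = χ z x * (w x x / χ x x)
    rw [mul_div_assoc', ← h1, mul_div_cancel_left₀ _ (hχ x)]
  have hWs : ContDiff ℝ ∞ W := by
    refine contDiff_iff_contDiffAt.2 fun z => ?_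
    have h1 : ContDiffAt ℝ ∞ (fun x => w z x / χ z x) z := by
      simp only [div_eq_mul_inv]
      exact (hw z).contDiffAt.mul ((χ z).contDiff.contDiffAt.inv (hχ z))
    refine h1.congr_of_eventuallyEq ?_
    filter_upwards [(χ z).continuous.continuousAt.eventually_ne (hχ z)] with x hx
    rw [hW z x]; field_simp
  refine ⟨W, hWs, fun f => ?_⟩
  obtain ⟨t, ht⟩ := f.hasCompactSupport.isCompact.elim_finite_subcover
    (fun z => {x | χ z x ≠ 0}) (fun z => isOpen_ne_fun (χ z).continuous continuous_const)
    (fun x _ => mem_iUnion.2 ⟨x, hχ x⟩)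
  -- The sum of |χ_z|² is nonzero on the support of f. Dividing f by it writes f as a finite sum of
  -- multiples of the χ_z, in place of a partition of unity.
  let s : E → ℂ := fun x => ∑ z ∈ t, (starRingEnd ℂ) (χ z x) * χ z x
  have hs : ∀ x ∈ tsupport f, s x ≠ 0 := by
    intro x hx
    obtain ⟨z, hz, hzx⟩ := mem_iUnion₂.1 (ht hx)
    have h1 : s x = ((∑ z ∈ t, Complex.normSq (χ z x) : ℝ) : ℂ) := by
      simp only [s]
      push_cast
      exact Finset.sum_congr rfl fun z _ => by rw [Complex.normSq_eq_conj_mul_self]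
    rw [h1]
    have h2 : 0 < ∑ z ∈ t, Complex.normSq (χ z x) :=
      Finset.sum_pos' (fun z _ => Complex.normSq_nonneg _) ⟨z, hz, Complex.normSq_pos.2 hzx⟩
    exact_mod_cast h2.ne'
  have hsc : ContDiff ℝ ∞ s := ContDiff.sum fun z _ =>
    (Complex.conjCLE.contDiff.comp (χ z).contDiff).mul (χ z).contDiff
  let k : Test E := ⟨fun x => f x / s x, by
    refine contDiff_iff_contDiffAt.2 fun x => ?_
    by_cases hx : x ∈ tsupport f
    · simp only [div_eq_mul_inv]
      exact f.contDiff.contDiffAt.mul (hsc.contDiffAt.inv (hs x hx))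
    · refine (contDiffAt_const (c := (0 : ℂ))).congr_of_eventuallyEq ?_
      have := (isClosed_tsupport f).isOpen_compl.mem_nhds hx
      filter_upwards [this] with y hy
      rw [image_eq_zero_of_notMem_tsupport hy, zero_div],
    f.hasCompactSupport.mono fun x hx => by
      intro h0; simp [h0] at hx,
    fun _ _ => trivial⟩
  have hf : f = ∑ z ∈ t, mulTest (χ z) (mulTest (conjTest (χ z)) k) := by
    ext x
    rw [sum_apply]
    have h1 : ∀ z, mulTest (χ z) (mulTest (conjTest (χ z)) k) x =
        (starRingEnd ℂ) (χ z x) * χ z x * (f x / s x) := fun z => by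
      change χ z x * ((starRingEnd ℂ) (χ z x) * (f x / s x)) = _
      ring
    simp_rw [h1]
    rw [← Finset.sum_mul]
    change f x = s x * (f x / s x)
    by_cases hx : x ∈ tsupport f
    · field_simp [hs x hx]
    · simp [image_eq_zero_of_notMem_tsupport hx]
  have hfx : ∀ x, f x * W x = ∑ z ∈ t, mulTest (conjTest (χ z)) k x * w z x := by
    intro x
    conv_lhs => rw [hf]
    rw [sum_apply, Finset.sum_mul]
    refine Finset.sum_congr rfl fun z _ => ?_
    rw [hW z x, mulTest_apply]; ring
  simp_rw [hfx]
  rw [integral_finsetSum _ fun z _ => integrable_test_mul μ _ (hw z).continuous]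
  conv_lhs => rw [hf]
  rw [map_sum]
  exact Finset.sum_congr rfl fun z _ => hT z _

/-- A functional of locally finite order without singular directions is a smooth function. -/
theorem exists_smooth_density (μ : Measure E) [μ.IsAddHaarMeasure] {T : Test E →ₗ[ℂ] ℂ}
    (hT : HasLocalOrder T) (h : ∀ z, ∀ ξ : E →L[ℝ] ℝ, ξ ≠ 0 →
      ∃ χ : Test E, χ z ≠ 0 ∧ ∃ δ > 0, DecaysOn T χ (Metric.ball ξ δ)) :
    ∃ w : E → ℂ, ContDiff ℝ ∞ w ∧ ∀ f : Test E, T f = ∫ x, f x * w x ∂μ :=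
  exists_density_of_local μ fun z => by
    obtain ⟨χ, hχ, hdec⟩ := exists_decaysOn_sphere hT z (h z)
    exact ⟨χ, hχ, exists_local_density μ hT hdec⟩

end Microlocal

/-! ### Determination by tensor products -/

section Tensor

theorem modulate_tensorTest (f h : Test Spacetime) (ξ : Spacetime × Spacetime →L[ℝ] ℝ) :
    modulate (tensorTest f h) ξ =
      tensorTest (modulate f (ξ.comp (ContinuousLinearMap.inl ℝ Spacetime Spacetime)))
        (modulate h (ξ.comp (ContinuousLinearMap.inr ℝ Spacetime Spacetime))) := by
  ext z
  have h1 : planeWave ξ z = planeWave (ξ.comp (ContinuousLinearMap.inl ℝ _ _)) z.1 *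
      planeWave (ξ.comp (ContinuousLinearMap.inr ℝ _ _)) z.2 := by
    rw [planeWave, planeWave, planeWave, ← Complex.exp_add, ← mul_add, ← Complex.ofReal_add]
    congr 3
    simp [← map_add]
  change planeWave ξ z * (f z.1 * h z.2) = (planeWave _ z.1 * f z.1) * (planeWave _ z.2 * h z.2)
  rw [h1]; ring

/-- Functionals of locally finite order are determined by their values on tensor products. -/
theorem HasLocalOrder.ext_tensorTest {T S : Test (Spacetime × Spacetime) →ₗ[ℂ] ℂ}
    (hT : HasLocalOrder T) (hS : HasLocalOrder S)
    (h : ∀ f g, T (tensorTest f g) = S (tensorTest f g)) : T = S := by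
  ext f
  obtain ⟨R, hR⟩ := f.hasCompactSupport.isCompact.isBounded.exists_norm_le
  obtain ⟨ψ, hψ⟩ := exists_test_eq_one (E := Spacetime) R
  have h1 : f = mulTest (tensorTest ψ ψ) f := by
    ext z
    by_cases hz : f z = 0
    · simp [hz]
    · have h2 := hR z (subset_tsupport _ hz)
      change f z = (ψ z.1 * ψ z.2) * f z
      rw [hψ _ ((norm_fst_le z).trans h2), hψ _ ((norm_snd_le z).trans h2)]; ring
  obtain ⟨A, hA1, hA2⟩ := exists_box_test (tensorTest ψ ψ) f
  have hT' := hT.hasSum_mulTest A _ f hA1 hA2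
  have hS' := hS.hasSum_mulTest A _ f hA1 hA2
  -- A plane wave on the product splits, so every term of the Fourier expansion of f is a tensor
  -- product, on which T and S agree.
  simp only [modulate_tensorTest, h] at hT' hS'
  rw [h1]
  exact hT'.unique hS'

end Tensor

end QEI

end

noncomputable section

namespace QEI

instance : (volume : Measure Spacetime).IsAddHaarMeasure :=
  inferInstanceAs (((volume : Measure ℝ).prod
    (volume : Measure (EuclideanSpace ℝ (Fin 3)))).IsAddHaarMeasure)

instance : (volume : Measure (Spacetime × Spacetime)).IsAddHaarMeasure :=
  Measure.prod.instIsAddHaarMeasure (volume : Measure Spacetime) (volume : Measure Spacetime)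

/-! ### The vacuum two-point function: finite order and singular directions -/

section Vacuum

theorem energy_nonneg (m : ℝ) (k : EuclideanSpace ℝ (Fin 3)) : 0 ≤ energy m k :=
  Real.sqrt_nonneg _

theorem norm_le_energy (m : ℝ) (k : EuclideanSpace ℝ (Fin 3)) : ‖k‖ ≤ energy m k :=
  Real.le_sqrt_of_sq_le (by nlinarith [sq_nonneg m])

theorem energy_sq (m : ℝ) (k : EuclideanSpace ℝ (Fin 3)) :
    energy m k ^ 2 = ‖k‖ ^ 2 + m ^ 2 := Real.sq_sqrt (by positivity)

theorem continuous_energy (m : ℝ) : Continuous (energy m) := by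
  unfold energy; fun_prop

theorem energy_neg (m : ℝ) (k : EuclideanSpace ℝ (Fin 3)) : energy m (-k) = energy m k := by
  simp [energy]

theorem integrable_one_add_norm_inv : Integrable fun k : EuclideanSpace ℝ (Fin 3) =>
    ((1 + ‖k‖) ^ 4)⁻¹ := by
  have h := integrable_one_add_norm (E := EuclideanSpace ℝ (Fin 3)) (μ := volume) (r := 4)
    (by simp; norm_num)
  refine h.congr (Filter.Eventually.of_forall fun k => ?_)
  simp only
  rw [Real.rpow_neg (by positivity)]
  norm_cast

/-- For m = 0 the weight is singular like 1/‖k‖ at the origin; the radial factor r² of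
three-dimensional polar coordinates compensates it. -/
theorem integrable_energy_inv (m : ℝ) : Integrable fun k : EuclideanSpace ℝ (Fin 3) =>
    (energy m k)⁻¹ * ((1 + ‖k‖) ^ 4)⁻¹ := by
  have h := integrable_fun_norm_addHaar (volume : Measure (EuclideanSpace ℝ (Fin 3)))
    (f := fun y : ℝ => (Real.sqrt (y ^ 2 + m ^ 2))⁻¹ * ((1 + y) ^ 4)⁻¹)
  refine h.2 ?_
  have h1 : IntegrableOn (fun y : ℝ => (1 + ‖y‖) ^ (-(2 : ℝ))) (Ioi 0) :=
    (integrable_one_add_norm (E := ℝ) (μ := volume) (r := 2) (by simp)).integrableOn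
  refine h1.mono' ?_ ?_
  · refine Measurable.aestronglyMeasurable ?_
    fun_prop
  · refine (ae_restrict_iff' measurableSet_Ioi).2 (Filter.Eventually.of_forall fun y hy => ?_)
    have hy : 0 < y := hy
    have h2 : y ≤ Real.sqrt (y ^ 2 + m ^ 2) := Real.le_sqrt_of_sq_le (by nlinarith [sq_nonneg m])
    have h3 : 0 < Real.sqrt (y ^ 2 + m ^ 2) := by linarith
    rw [Real.rpow_neg (by positivity), Real.norm_of_nonneg (by positivity),
      Real.norm_of_nonneg hy.le]
    simp only [finrank_euclideanSpace, Fintype.card_fin, smul_eq_mul]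
    norm_cast
    rw [← mul_assoc, ← div_eq_mul_inv, ← div_eq_mul_inv, div_div, inv_eq_one_div,
      div_le_div_iff₀ (by positivity) (by positivity)]
    have h4 : y * (1 + y) ^ 4 ≤ Real.sqrt (y ^ 2 + m ^ 2) * (1 + y) ^ 4 := by gcongr
    have h5 : y ^ 2 * (1 + y) ^ 2 ≤ y * (1 + y) ^ 4 := by
      have : y * (1 + y) ^ 4 - y ^ 2 * (1 + y) ^ 2 = y * (1 + y) ^ 2 * (1 + y + y ^ 2) := by ring
      nlinarith [mul_pos (mul_pos hy (pow_pos (by linarith : 0 < 1 + y) 2))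
        (by positivity : 0 < 1 + y + y ^ 2)]
    norm_num
    linarith

/-- The covector `x ↦ p₀ t - 𝐩·𝐱`. -/
def minkowskiCovector (p : Spacetime) : Spacetime →L[ℝ] ℝ :=
  p.1 • ContinuousLinearMap.fst ℝ ℝ _ -
    (innerSL ℝ p.2).comp (ContinuousLinearMap.snd ℝ ℝ (EuclideanSpace ℝ (Fin 3)))

theorem minkowskiCovector_apply (p x : Spacetime) :
    minkowskiCovector p x = p.1 * x.1 - inner ℝ p.2 x.2 := by
  simp [minkowskiCovector]

theorem minkowskiFourier_eq (f : Test Spacetime) (p : Spacetime) :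
    minkowskiFourier f p = ftTest volume f (minkowskiCovector p) := by
  simp only [minkowskiFourier, ftTest, planeWave, minkowskiCovector_apply]

theorem minkowskiCovector_neg (p : Spacetime) :
    minkowskiCovector (-p) = -minkowskiCovector p := by
  ext x
  · simp [minkowskiCovector]
  · simp [minkowskiCovector]

theorem continuous_minkowskiCovector : Continuous minkowskiCovector := by
  unfold minkowskiCovector
  have : Continuous fun p : Spacetime => (innerSL ℝ p.2) := (innerSL ℝ).continuous.comp continuous_snd
  exact (continuous_fst.smul continuous_const).sub (this.clm_comp continuous_const)

/-- The covector `(-k, k)` on `M × M` at the point `k = (ω(𝐤), 𝐤)` of the mass shell. -/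
def shellCovector (m : ℝ) (k : EuclideanSpace ℝ (Fin 3)) : Spacetime × Spacetime →L[ℝ] ℝ :=
  (minkowskiCovector (-(energy m k, k))).comp (ContinuousLinearMap.fst ℝ Spacetime Spacetime) +
    (minkowskiCovector (energy m k, k)).comp (ContinuousLinearMap.snd ℝ Spacetime Spacetime)

theorem shellCovector_time_left (m : ℝ) (k : EuclideanSpace ℝ (Fin 3)) :
    shellCovector m k (eTime, 0) = -energy m k := by
  simp [shellCovector, minkowskiCovector, eTime]

theorem shellCovector_time_right (m : ℝ) (k : EuclideanSpace ℝ (Fin 3)) :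
    shellCovector m k (0, eTime) = energy m k := by
  simp [shellCovector, minkowskiCovector, eTime]

theorem continuous_shellCovector (m : ℝ) : Continuous (shellCovector m) := by
  have h : Continuous fun k : EuclideanSpace ℝ (Fin 3) => ((energy m k, k) : Spacetime) :=
    (continuous_energy m).prodMk continuous_id
  exact ((continuous_minkowskiCovector.comp h.neg).clm_comp continuous_const).add
    ((continuous_minkowskiCovector.comp h).clm_comp continuous_const)

theorem norm_eTime : ‖eTime‖ = 1 := by simp [eTime, Prod.norm_def]

theorem norm_eTime_left : ‖((eTime, 0) : Spacetime × Spacetime)‖ = 1 := by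
  rw [Prod.norm_def]; simp [norm_eTime]

theorem norm_eTime_right : ‖((0, eTime) : Spacetime × Spacetime)‖ = 1 := by
  rw [Prod.norm_def]; simp [norm_eTime]

theorem energy_le_norm_shellCovector (m : ℝ) (k : EuclideanSpace ℝ (Fin 3)) :
    energy m k ≤ ‖shellCovector m k‖ := by
  have := (shellCovector m k).le_opNorm (0, eTime)
  rw [shellCovector_time_right, norm_eTime_right, mul_one] at this
  exact (le_abs_self _).trans this

theorem norm_shellCovector_le (m : ℝ) (k : EuclideanSpace ℝ (Fin 3)) :
    ‖shellCovector m k‖ ≤ 4 * energy m k := by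
  have h0 := energy_nonneg m k
  have h1 := norm_le_energy m k
  have h2 : ∀ x : Spacetime, |minkowskiCovector (energy m k, k) x| ≤ 2 * energy m k * ‖x‖ := by
    intro x
    rw [minkowskiCovector_apply]
    have h3 := abs_real_inner_le_norm k x.2
    have h4 := norm_fst_le x
    have h5 := norm_snd_le x
    calc |energy m k * x.1 - inner ℝ k x.2| ≤ |energy m k * x.1| + |inner ℝ k x.2| := abs_sub _ _
      _ ≤ energy m k * ‖x‖ + energy m k * ‖x‖ := by
          rw [abs_mul, abs_of_nonneg h0]
          have h6 : ‖k‖ * ‖x.2‖ ≤ energy m k * ‖x‖ := by gcongr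
          have h7 : energy m k * |x.1| ≤ energy m k * ‖x‖ := by gcongr; exact h4
          linarith
      _ = _ := by ring
  refine ContinuousLinearMap.opNorm_le_bound _ (by positivity) fun z => ?_
  have h3 : shellCovector m k z = -minkowskiCovector (energy m k, k) z.1 +
      minkowskiCovector (energy m k, k) z.2 := by
    simp only [shellCovector, minkowskiCovector_neg]
    rfl
  rw [h3]
  have h4 := h2 z.1
  have h5 := h2 z.2
  have h6 : 2 * energy m k * ‖z.1‖ ≤ 2 * energy m k * ‖z‖ := by gcongr; exact norm_fst_le z
  have h7 : 2 * energy m k * ‖z.2‖ ≤ 2 * energy m k * ‖z‖ := by gcongr; exact norm_snd_le z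
  calc _ ≤ ‖-minkowskiCovector (energy m k, k) z.1‖ + ‖minkowskiCovector (energy m k, k) z.2‖ :=
        norm_add_le _ _
    _ ≤ 4 * energy m k * ‖z‖ := by
        rw [norm_neg, Real.norm_eq_abs, Real.norm_eq_abs]; linarith

theorem continuous_ftTest {E : Type} [NormedAddCommGroup E] [NormedSpace ℝ E]
    [MeasurableSpace E] [BorelSpace E] [FiniteDimensional ℝ E] (μ : Measure E)
    [IsFiniteMeasureOnCompacts μ] (φ : Test E) : Continuous (ftTest μ φ) := by
  refine continuous_of_dominated (bound := fun z => ‖φ z‖)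
    (fun ξ => (integrable_planeWave_mul μ φ ξ).aestronglyMeasurable)
    (fun ξ => Filter.Eventually.of_forall fun z => ?_) (integrable_test μ φ).norm
    (Filter.Eventually.of_forall fun z => ?_)
  · rw [norm_mul, norm_planeWave, one_mul]
  · unfold planeWave
    fun_prop

/-- The weight of the invariant measure on the mass shell. -/
def shellWeight (m : ℝ) (k : EuclideanSpace ℝ (Fin 3)) : ℝ :=
  1 / ((2 * Real.pi) ^ 3 * (2 * energy m k))

theorem shellWeight_nonneg (m : ℝ) (k : EuclideanSpace ℝ (Fin 3)) : 0 ≤ shellWeight m k := by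
  have := energy_nonneg m k
  unfold shellWeight; positivity

theorem shellWeight_le (m : ℝ) (k : EuclideanSpace ℝ (Fin 3)) :
    shellWeight m k ≤ (energy m k)⁻¹ := by
  have h0 := energy_nonneg m k
  rw [shellWeight, ← mul_assoc, one_div, mul_inv]
  refine mul_le_of_le_one_left (by positivity) (inv_le_one_of_one_le₀ ?_)
  have h1 : (1 : ℝ) ≤ (2 * Real.pi) ^ 3 := one_le_pow₀ (by linarith [Real.pi_gt_three])
  linarith

theorem measurable_shellWeight (m : ℝ) : Measurable (shellWeight m) := by
  have := (continuous_energy m).measurable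
  unfold shellWeight; fun_prop

/-- Fourth-order decay makes the momentum integral converge. The bound is linear in C, which turns
derivative bounds on a test function into local order of the vacuum functional. -/
theorem integrable_shellWeight_mul (m : ℝ) {F : EuclideanSpace ℝ (Fin 3) → ℂ}
    (hF : Continuous F) {C : ℝ} (hC : ∀ k, (1 + ‖k‖) ^ 4 * ‖F k‖ ≤ C) :
    Integrable (fun k => (shellWeight m k : ℂ) * F k) ∧
      ‖∫ k, (shellWeight m k : ℂ) * F k‖ ≤
        C * ∫ k, (energy m k)⁻¹ * ((1 + ‖k‖) ^ 4)⁻¹ := by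
  have h1 : ∀ k, ‖(shellWeight m k : ℂ) * F k‖ ≤ C * ((energy m k)⁻¹ * ((1 + ‖k‖) ^ 4)⁻¹) := by
    intro k
    have h0 := energy_nonneg m k
    have h2 : ‖F k‖ ≤ C * ((1 + ‖k‖) ^ 4)⁻¹ := by
      rw [← div_eq_mul_inv, le_div_iff₀ (by positivity), mul_comm]; exact hC k
    rw [norm_mul, Complex.norm_real, Real.norm_of_nonneg (shellWeight_nonneg m k)]
    calc _ ≤ (energy m k)⁻¹ * (C * ((1 + ‖k‖) ^ 4)⁻¹) :=
          mul_le_mul (shellWeight_le m k) h2 (norm_nonneg _) (by positivity)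
      _ = _ := by ring
  have h2 := (integrable_energy_inv m).const_mul C
  refine ⟨h2.mono' ?_ (Filter.Eventually.of_forall h1), ?_⟩
  · exact ((Complex.measurable_ofReal.comp (measurable_shellWeight m)).mul
      hF.measurable).aestronglyMeasurable
  · refine (norm_integral_le_of_norm_le h2 (Filter.Eventually.of_forall h1)).trans (le_of_eq ?_)
    rw [integral_const_mul]

theorem continuous_ftTest_shellCovector (m : ℝ) (φ : Test (Spacetime × Spacetime))
    (ξ : Spacetime × Spacetime →L[ℝ] ℝ) :
    Continuous fun k => ftTest volume φ (ξ + shellCovector m k) :=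
  (continuous_ftTest volume φ).comp (continuous_const.add (continuous_shellCovector m))

theorem exists_ftTest_shellCovector_le (m : ℝ) (φ : Test (Spacetime × Spacetime)) :
    ∃ C : ℝ, ∀ k, (1 + ‖k‖) ^ 4 * ‖ftTest volume φ (shellCovector m k)‖ ≤ C := by
  obtain ⟨C, -, hC⟩ := exists_norm_ftTest_le (volume : Measure (Spacetime × Spacetime)) φ 4
  refine ⟨C, fun k => le_trans ?_ (hC (shellCovector m k))⟩
  have := (norm_le_energy m k).trans (energy_le_norm_shellCovector m k)
  gcongr

theorem integrable_vacuum (m : ℝ) (φ : Test (Spacetime × Spacetime)) :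
    Integrable fun k => (shellWeight m k : ℂ) * ftTest volume φ (shellCovector m k) := by
  obtain ⟨C, hC⟩ := exists_ftTest_shellCovector_le m φ
  have h := continuous_ftTest_shellCovector m φ 0
  simp only [zero_add] at h
  exact (integrable_shellWeight_mul m h hC).1

theorem ftTest_add {E : Type} [NormedAddCommGroup E] [NormedSpace ℝ E]
    [MeasurableSpace E] [BorelSpace E] [FiniteDimensional ℝ E] (μ : Measure E)
    [IsFiniteMeasureOnCompacts μ] (φ ψ : Test E) (ξ : E →L[ℝ] ℝ) :
    ftTest μ (φ + ψ) ξ = ftTest μ φ ξ + ftTest μ ψ ξ := by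
  rw [ftTest, ftTest, ftTest, ← integral_add (integrable_planeWave_mul μ φ ξ)
    (integrable_planeWave_mul μ ψ ξ)]
  congr 1; funext z
  rw [← mul_add]; rfl

theorem ftTest_smul {E : Type} [NormedAddCommGroup E] [NormedSpace ℝ E]
    [MeasurableSpace E] (μ : Measure E) (c : ℂ) (φ : Test E) (ξ : E →L[ℝ] ℝ) :
    ftTest μ (c • φ) ξ = c * ftTest μ φ ξ := by
  rw [ftTest, ftTest, ← integral_const_mul]
  congr 1; funext z
  change planeWave ξ z * (c * φ z) = _
  ring

/-- The two-point function of the vacuum as a functional on test functions on `M × M`. -/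
def vacuumFunctional (m : ℝ) : Test (Spacetime × Spacetime) →ₗ[ℂ] ℂ where
  toFun φ := ∫ k, (shellWeight m k : ℂ) * ftTest volume φ (shellCovector m k)
  map_add' φ ψ := by
    rw [← integral_add (integrable_vacuum m φ) (integrable_vacuum m ψ)]
    congr 1; funext k; rw [ftTest_add]; ring
  map_smul' c φ := by
    rw [RingHom.id_apply, smul_eq_mul, ← integral_const_mul]
    congr 1; funext k; rw [ftTest_smul]; ring

theorem vacuumFunctional_apply (m : ℝ) (φ : Test (Spacetime × Spacetime)) :
    vacuumFunctional m φ = ∫ k, (shellWeight m k : ℂ) * ftTest volume φ (shellCovector m k) := rfl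

theorem ftTest_tensorTest (f h : Test Spacetime) (ξ η : Spacetime →L[ℝ] ℝ) :
    ftTest volume (tensorTest f h) (ξ.comp (ContinuousLinearMap.fst ℝ Spacetime Spacetime) +
      η.comp (ContinuousLinearMap.snd ℝ Spacetime Spacetime)) =
      ftTest volume f ξ * ftTest volume h η := by
  rw [ftTest, ftTest, ftTest, ← integral_prod_mul, Measure.volume_eq_prod]
  congr 1; funext z
  rw [planeWave_add]
  change planeWave ξ z.1 * planeWave η z.2 * (f z.1 * h z.2) = _
  ring

theorem vacuumFunctional_tensorTest (m : ℝ) (f h : Test Spacetime) :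
    vacuumFunctional m (tensorTest f h) = vacuumTwoPoint m f h := by
  rw [vacuumFunctional_apply, vacuumTwoPoint]
  congr 1; funext k
  rw [shellCovector, ftTest_tensorTest, minkowskiFourier_eq, minkowskiFourier_eq]
  rfl

/-- On the shell, the second time component of the covector is the energy, which dominates ‖k‖. Four
time derivatives in the second argument therefore supply the decay (1 + ‖k‖)⁻⁴. -/
theorem hasLocalOrder_vacuumFunctional (m : ℝ) : HasLocalOrder (vacuumFunctional m) := by
  intro K hK
  let V := (volume : Measure (Spacetime × Spacetime)).real K
  let J := ∫ k, (energy m k)⁻¹ * ((1 + ‖k‖) ^ 4)⁻¹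
  have hJ : 0 ≤ J := integral_nonneg fun k => by have := energy_nonneg m k; positivity
  have hV : 0 ≤ V := measureReal_nonneg
  refine ⟨4, 16 * V * J, by positivity, fun φ hφ B hB => ?_⟩
  have hsupp : tsupport φ ⊆ K := closure_minimal
    (fun x hx => by by_contra h; exact hx (hφ x h)) hK.isClosed
  let e : Spacetime × Spacetime := (0, eTime)
  have h1 : ∀ n ≤ 4, ∀ ξ, ‖ftTest volume ((pdTest e)^[n] φ) ξ‖ ≤ B * V := by
    intro n hn ξ
    refine (norm_ftTest_le _ _ _).trans ?_
    rw [← setIntegral_eq_integral_of_forall_compl_eq_zero (s := K)]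
    · refine (le_abs_self _).trans ?_
      rw [← Real.norm_eq_abs]
      refine norm_setIntegral_le_of_norm_le_const hK.measure_lt_top fun x _ => ?_
      rw [norm_norm, coe_pdTest_iterate]
      refine (norm_pd_iterate_le φ.contDiff e n x).trans ?_
      rw [norm_eTime_right, one_pow, mul_one]
      exact hB n hn x
    · intro x hx
      rw [coe_pdTest_iterate]
      have h2 := norm_pd_iterate_le φ.contDiff e n x
      have h3 : iteratedFDeriv ℝ n φ x = 0 := by
        by_contra hne
        exact hx (hsupp (support_iteratedFDeriv_subset n hne))
      rw [h3, norm_zero, zero_mul] at h2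
      exact le_antisymm h2 (norm_nonneg _)
  have h2 : ∀ k, (1 + ‖k‖) ^ 4 * ‖ftTest volume φ (shellCovector m k)‖ ≤ 16 * V * B := by
    intro k
    have h0 := energy_nonneg m k
    have h3 := pow_mul_norm_ftTest volume e 4 φ (shellCovector m k)
    rw [shellCovector_time_right, abs_of_nonneg h0] at h3
    have h4 := h1 4 le_rfl (shellCovector m k)
    rw [← h3] at h4
    have h5 := h1 0 (by norm_num) (shellCovector m k)
    simp only [Function.iterate_zero, id] at h5
    have h6 : (1 + ‖k‖) ^ 4 ≤ 8 * (1 + energy m k ^ 4) := by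
      calc (1 + ‖k‖) ^ 4 ≤ (1 + energy m k) ^ 4 := by gcongr; exact norm_le_energy m k
        _ ≤ 2 ^ (4 - 1) * (1 ^ 4 + energy m k ^ 4) := add_pow_le zero_le_one h0 4
        _ = _ := by norm_num
    calc _ ≤ 8 * (1 + energy m k ^ 4) * ‖ftTest volume φ (shellCovector m k)‖ := by gcongr
      _ = 8 * (‖ftTest volume φ (shellCovector m k)‖ +
          energy m k ^ 4 * ‖ftTest volume φ (shellCovector m k)‖) := by ring
      _ ≤ 8 * (B * V + B * V) := by gcongr
      _ = _ := by ring
  have h := continuous_ftTest_shellCovector m φ 0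
  simp only [zero_add] at h
  refine (integrable_shellWeight_mul m h h2).2.trans (le_of_eq ?_)
  simp only [J]; ring

theorem ftTest_modulate {E : Type} [NormedAddCommGroup E] [NormedSpace ℝ E] [MeasurableSpace E]
    (μ : Measure E) (χ : Test E) (ξ η : E →L[ℝ] ℝ) :
    ftTest μ (modulate χ ξ) η = ftTest μ χ (ξ + η) := by
  rw [ftTest, ftTest]
  congr 1; funext z
  rw [modulate_apply, planeWave_add]; ring

/-- The singular directions of the vacuum two-point function are future directed in the first and
past directed in the second argument. -/
theorem vacuumFunctional_decaysOn (m : ℝ) {ξ : Spacetime × Spacetime →L[ℝ] ℝ} (hξ : ξ ≠ 0)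
    (h : ξ (eTime, 0) ≤ 0 ∨ 0 ≤ ξ (0, eTime)) (χ : Test (Spacetime × Spacetime)) :
    DecaysOn (vacuumFunctional m) χ (Metric.ball ξ (‖ξ‖ / 32)) := by
  have hn : 0 < ‖ξ‖ := norm_pos_iff.2 hξ
  intro N
  obtain ⟨C, hC0, hC⟩ := exists_norm_ftTest_le (volume : Measure (Spacetime × Spacetime)) χ (N + 4)
  let D := (10 / ‖ξ‖) ^ N * 2 ^ 4
  refine ⟨D * C * ∫ k, (energy m k)⁻¹ * ((1 + ‖k‖) ^ 4)⁻¹, fun η hη r hr => ?_⟩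
  have hη1 : ‖η - ξ‖ < ‖ξ‖ / 32 := by rwa [← dist_eq_norm]
  have key : ∀ k, (1 + ‖k‖) ^ 4 *
      ‖(r : ℂ) ^ N * ftTest volume χ (r • η + shellCovector m k)‖ ≤ D * C := by
    intro k
    set ζ := r • η + shellCovector m k with hζ
    have h0 := energy_nonneg m k
    -- The sign condition on ξ excludes cancellation in one time component: there r • η has the sign
    -- of the shell covector, up to the error r‖ξ‖/32 from η ≠ ξ.
    have h1 : energy m k - r * (‖ξ‖ / 32) ≤ ‖ζ‖ := by
      rcases h with h | h
      · have h2 := ζ.le_opNorm (eTime, 0)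
        have h3 := (η - ξ).le_opNorm (eTime, 0)
        rw [norm_eTime_left, mul_one] at h2 h3
        have h4 : ζ (eTime, 0) = r * η (eTime, 0) - energy m k := by
          simp [hζ, shellCovector_time_left]; ring
        have h5 : η (eTime, 0) ≤ ‖ξ‖ / 32 := by
          have h6 : (η - ξ) (eTime, 0) = η (eTime, 0) - ξ (eTime, 0) := rfl
          have h7 := (le_abs_self _).trans h3
          linarith
        have h6 := neg_le_of_abs_le h2
        rw [h4] at h6
        nlinarith
      · have h2 := ζ.le_opNorm (0, eTime)
        have h3 := (η - ξ).le_opNorm (0, eTime)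
        rw [norm_eTime_right, mul_one] at h2 h3
        have h4 : ζ (0, eTime) = r * η (0, eTime) + energy m k := by
          simp [hζ, shellCovector_time_right]
        have h5 : -(‖ξ‖ / 32) ≤ η (0, eTime) := by
          have h6 : (η - ξ) (0, eTime) = η (0, eTime) - ξ (0, eTime) := rfl
          have h7 := neg_le_of_abs_le h3
          linarith
        have h6 := (le_abs_self _).trans h2
        rw [h4] at h6
        nlinarith
    have h2 : r * (‖ξ‖ - ‖ξ‖ / 32) - 4 * energy m k ≤ ‖ζ‖ := by
      have h3 : r * ‖η‖ = ‖r • η‖ := by rw [norm_smul, Real.norm_of_nonneg hr.le]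
      have h4 : ‖r • η‖ ≤ ‖ζ‖ + ‖shellCovector m k‖ := by
        have := norm_sub_le ζ (shellCovector m k)
        rwa [hζ, add_sub_cancel_right] at this
      have h5 := norm_shellCovector_le m k
      have h6 : ‖ξ‖ - ‖ξ‖ / 32 ≤ ‖η‖ := by
        have := norm_sub_norm_le ξ η
        rw [norm_sub_rev] at this
        linarith
      nlinarith
    -- Four times `h1` plus `h2` eliminates the energy and gives (27/32) r‖ξ‖ ≤ 5‖ζ‖. Thus ‖ζ‖
    -- controls r, and through `h1` also ‖k‖.
    have hr1 : r ≤ 10 / ‖ξ‖ * (1 + ‖ζ‖) := by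
      rw [div_mul_eq_mul_div, le_div_iff₀ hn]; nlinarith
    have hk1 : 1 + ‖k‖ ≤ 2 * (1 + ‖ζ‖) := by
      have := norm_le_energy m k
      nlinarith
    rw [norm_mul, norm_pow, Complex.norm_real, Real.norm_of_nonneg hr.le]
    calc (1 + ‖k‖) ^ 4 * (r ^ N * ‖ftTest volume χ ζ‖)
        ≤ (2 * (1 + ‖ζ‖)) ^ 4 * ((10 / ‖ξ‖ * (1 + ‖ζ‖)) ^ N * ‖ftTest volume χ ζ‖) := by gcongr
      _ = D * ((1 + ‖ζ‖) ^ (N + 4) * ‖ftTest volume χ ζ‖) := by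
          simp only [D, mul_pow, pow_add]; ring
      _ ≤ D * C := by gcongr; exact hC ζ
  have hcont : Continuous fun k => (r : ℂ) ^ N * ftTest volume χ (r • η + shellCovector m k) :=
    continuous_const.mul (continuous_ftTest_shellCovector m χ (r • η))
  have h1 := (integrable_shellWeight_mul m hcont key).2
  have h2 : (r : ℂ) ^ N * vacuumFunctional m (modulate χ (r • η)) =
      ∫ k, (shellWeight m k : ℂ) * ((r : ℂ) ^ N *
        ftTest volume χ (r • η + shellCovector m k)) := by
    rw [vacuumFunctional_apply, ← integral_const_mul]
    congr 1; funext k; rw [ftTest_modulate]; ring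
  rw [← h2, norm_mul, norm_pow, Complex.norm_real, Real.norm_of_nonneg hr.le] at h1
  exact h1

end Vacuum

end QEI

end

noncomputable section

namespace QEI

/-! ### The regularised propagator and Duhamel's formula -/

section Propagator

/-- The solution `sin (w τ) / w` of `f'' + w² f = 0` with `f 0 = 0` and `f' 0 = 1`. -/
def sinProp (w τ : ℝ) : ℝ := τ * Real.sinc (w * τ)

theorem mul_sinProp (w τ : ℝ) : w * sinProp w τ = Real.sin (w * τ) := by
  by_cases h : w * τ = 0
  · rw [h, Real.sin_zero, sinProp, ← mul_assoc, h, zero_mul]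
  · rw [sinProp, Real.sinc_of_ne_zero h, ← mul_assoc, mul_div_cancel₀ _ h]

theorem hasDerivAt_sinProp (w τ : ℝ) : HasDerivAt (sinProp w) (Real.cos (w * τ)) τ := by
  by_cases hw : w = 0
  · subst hw
    have : sinProp 0 = id := by funext τ; simp [sinProp]
    rw [this]
    simpa using hasDerivAt_id τ
  · have h1 : sinProp w = fun τ => Real.sin (w * τ) / w := by
      funext τ; rw [← mul_sinProp, mul_div_cancel_left₀ _ hw]
    rw [h1]
    have h2 : HasDerivAt (fun τ => Real.sin (w * τ) / w) (Real.cos (w * τ) * (w * 1) / w) τ :=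
      (((hasDerivAt_id τ).const_mul w).sin).div_const w
    convert h2 using 1
    field_simp

theorem abs_sinProp_le (w τ : ℝ) : |sinProp w τ| ≤ |τ| := by
  rw [sinProp, abs_mul]
  exact mul_le_of_le_one_right (abs_nonneg _) (Real.abs_sinc_le_one _)

theorem sinProp_neg (w τ : ℝ) : sinProp w (-τ) = -sinProp w τ := by
  simp [sinProp]

theorem sinProp_zero (w : ℝ) : sinProp w 0 = 0 := by simp [sinProp]

theorem continuous_sinProp : Continuous fun p : ℝ × ℝ => sinProp p.1 p.2 := by
  unfold sinProp
  exact continuous_snd.mul (Real.continuous_sinc.comp (continuous_fst.mul continuous_snd))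

/-- The reflected translate `z' ↦ q (z - z')` of a test function. -/
def reflTest (z : Spacetime) (q : Test Spacetime) : Test Spacetime :=
  ⟨fun z' => q (z - z'), q.contDiff.comp (contDiff_const.sub contDiff_id),
    q.hasCompactSupport.comp_homeomorph (Homeomorph.subLeft z), fun _ _ => trivial⟩

theorem pdTest_reflTest (z v : Spacetime) (q : Test Spacetime) :
    pdTest v (reflTest z q) = -reflTest z (pdTest v q) := by
  ext z'
  change pd v (fun z' => q (z - z')) z' = - pd v q (z - z')
  have h1 : HasFDerivAt q (fderiv ℝ q (z - z')) (z - z') :=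
    (q.contDiff.differentiable (by simp) _).hasFDerivAt
  have h2 : HasFDerivAt (fun z' => z - z') (-ContinuousLinearMap.id ℝ Spacetime) z' :=
    (hasFDerivAt_id z').const_sub z
  have h3 : fderiv ℝ (fun z' => q (z - z')) z' = _ := (h1.comp z' h2).fderiv
  rw [pd, h3]
  simp [pd]

theorem pdTest_neg (v : Spacetime) (q : Test Spacetime) : pdTest v (-q) = -pdTest v q := by
  ext z'
  change fderiv ℝ (-⇑q) z' v = -(fderiv ℝ q z' v)
  rw [fderiv_neg]; rfl

theorem pdTest_pdTest_reflTest (z v : Spacetime) (q : Test Spacetime) :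
    pdTest v (pdTest v (reflTest z q)) = reflTest z (pdTest v (pdTest v q)) := by
  rw [pdTest_reflTest, pdTest_neg, pdTest_reflTest, neg_neg]

/-- The operator `1 - Δ` on test functions. -/
def helmTest (q : Test Spacetime) : Test Spacetime :=
  q - ∑ i, pdTest (eSpace i) (pdTest (eSpace i) q)

theorem helmTest_apply (q : Test Spacetime) (z : Spacetime) :
    helmTest q z = q z - ∑ i, pdTest (eSpace i) (pdTest (eSpace i) q) z := by
  change q z - (∑ i, pdTest (eSpace i) (pdTest (eSpace i) q) : Test Spacetime) z = _
  rw [sum_apply]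

theorem kgTest_apply (m : ℝ) (q : Test Spacetime) (z : Spacetime) :
    kgTest m q z = pdTest eTime (pdTest eTime q) z -
      ∑ i, pdTest (eSpace i) (pdTest (eSpace i) q) z + (m : ℂ) ^ 2 * q z := rfl

theorem helmTest_reflTest (z : Spacetime) (q : Test Spacetime) :
    helmTest (reflTest z q) = reflTest z (helmTest q) := by
  ext z'
  change _ = helmTest q (z - z')
  rw [helmTest_apply, helmTest_apply]
  simp_rw [pdTest_pdTest_reflTest]
  rfl

/-- The plane wave of momentum `k` with amplitude `b(t) sin(ω t) / ω`. -/
def modeFn (m : ℝ) (b : ℝ → ℝ) (k : EuclideanSpace ℝ (Fin 3)) (z : Spacetime) : ℂ :=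
  ((b z.1 * sinProp (energy m k) z.1 : ℝ) : ℂ) * Complex.exp (Complex.I * (inner ℝ k z.2 : ℝ))

theorem norm_modeFn_le (m : ℝ) {b : ℝ → ℝ} (hb : ∀ τ, |b τ| ≤ 1)
    (k : EuclideanSpace ℝ (Fin 3)) (z : Spacetime) : ‖modeFn m b k z‖ ≤ |z.1| := by
  rw [modeFn, norm_mul, mul_comm Complex.I, Complex.norm_exp_ofReal_mul_I, mul_one,
    Complex.norm_real, Real.norm_eq_abs, abs_mul]
  calc _ ≤ 1 * |z.1| := mul_le_mul (hb _) (abs_sinProp_le _ _) (abs_nonneg _) zero_le_one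
    _ = _ := one_mul _

theorem measurable_modeFn (m : ℝ) {b : ℝ → ℝ} (hb : Measurable b) :
    Measurable fun p : Spacetime × EuclideanSpace ℝ (Fin 3) => modeFn m b p.2 p.1 := by
  unfold modeFn
  have h1 : Continuous fun p : Spacetime × EuclideanSpace ℝ (Fin 3) =>
      sinProp (energy m p.2) p.1.1 :=
    continuous_sinProp.comp (((continuous_energy m).comp continuous_snd).prodMk
      (continuous_fst.comp continuous_fst))
  have h2 : Continuous fun p : Spacetime × EuclideanSpace ℝ (Fin 3) =>
      Complex.exp (Complex.I * (inner ℝ p.2 p.1.2 : ℝ)) := by fun_prop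
  exact (Complex.measurable_ofReal.comp ((hb.comp (measurable_fst.comp measurable_fst)).mul
    h1.measurable)).mul h2.measurable

theorem locallyIntegrable_of_norm_le_time {f : Spacetime → ℂ} (hf : Measurable f) {C : ℝ}
    (h : ∀ z, ‖f z‖ ≤ C * |z.1|) : LocallyIntegrable f := by
  have hc : Continuous fun z : Spacetime => C * |z.1| := by fun_prop
  exact hc.locallyIntegrable.mono hf.aestronglyMeasurable
    (Filter.Eventually.of_forall fun z => (h z).trans (le_abs_self _))

theorem locallyIntegrable_modeFn (m : ℝ) {b : ℝ → ℝ} (hb : Measurable b) (hb1 : ∀ τ, |b τ| ≤ 1)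
    (k : EuclideanSpace ℝ (Fin 3)) : LocallyIntegrable (modeFn m b k) :=
  locallyIntegrable_of_norm_le_time (C := 1) ((measurable_modeFn m hb).comp
    (measurable_id.prodMk measurable_const)) fun z => by
      rw [one_mul]; exact norm_modeFn_le m hb1 k z

theorem LocallyIntegrable.integrable_mul_test {f : Spacetime → ℂ} (hf : LocallyIntegrable f)
    (q : Test Spacetime) : Integrable fun z => f z * q z := by
  have := hf.integrable_smul_right_of_hasCompactSupport q.continuous q.hasCompactSupport
  simpa using this

/-- The amplitude b may jump in time, as the Heaviside function does. Only a spatial derivative is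
moved, and along that line the mode is a smooth exponential. -/
theorem integral_modeFn_mul_pdTest (m : ℝ) {b : ℝ → ℝ} (hb : Measurable b) (hb1 : ∀ τ, |b τ| ≤ 1)
    (k : EuclideanSpace ℝ (Fin 3)) (i : Fin 3) (q : Test Spacetime) :
    ∫ z, modeFn m b k z * pdTest (eSpace i) q z =
      -(Complex.I * k i) * ∫ z, modeFn m b k z * q z := by
  have hl := locallyIntegrable_modeFn m hb hb1 k
  have hd : ∀ z, HasLineDerivAt ℝ (modeFn m b k) (Complex.I * k i * modeFn m b k z) z
      (eSpace i) := by
    intro z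
    have h1 : ∀ t : ℝ, modeFn m b k (z + t • eSpace i) =
        ((b z.1 * sinProp (energy m k) z.1 : ℝ) : ℂ) *
          Complex.exp (Complex.I * ((inner ℝ k z.2 : ℝ) + t * (k i : ℂ))) := by
      intro t
      simp [modeFn, eSpace, inner_add_right, inner_smul_right, EuclideanSpace.inner_single_right]
    unfold HasLineDerivAt
    simp_rw [h1]
    have h2 : HasDerivAt (fun t : ℝ => Complex.I * (((inner ℝ k z.2 : ℝ) : ℂ) + t * (k i : ℂ)))
        (Complex.I * (1 * (k i : ℂ))) 0 :=
      ((Complex.ofRealCLM.hasDerivAt.mul_const _).const_add _).const_mul _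
    have h3 := h2.cexp.const_mul (((b z.1 * sinProp (energy m k) z.1 : ℝ) : ℂ))
    refine h3.congr_deriv ?_
    simp [modeFn]; ring
  have hq : ∀ z, HasLineDerivAt ℝ q (pdTest (eSpace i) q z) z (eSpace i) := fun z =>
    ((q.contDiff.differentiable (by simp) z).hasFDerivAt).hasLineDerivAt _
  have h := integral_bilinear_hasLineDerivAt_right_eq_neg_left_of_integrable
    (μ := (volume : Measure Spacetime)) (B := ContinuousLinearMap.mul ℝ ℂ)
    (f := modeFn m b k) (f' := fun z => Complex.I * k i * modeFn m b k z)
    (g := q) (g' := pdTest (eSpace i) q) (v := eSpace i)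
    (by
      have := (LocallyIntegrable.integrable_mul_test hl q).const_mul (Complex.I * k i)
      simpa [mul_assoc] using this)
    (LocallyIntegrable.integrable_mul_test hl _) (LocallyIntegrable.integrable_mul_test hl _)
    (fun z _ => hd z) (fun z _ => hq z)
  have h' : ∫ z, modeFn m b k z * pdTest (eSpace i) q z =
      -∫ z, Complex.I * k i * modeFn m b k z * q z := h
  rw [h', ← integral_const_mul, ← integral_neg]
  congr 1; funext z; ring

theorem norm_sq_eq_sum (k : EuclideanSpace ℝ (Fin 3)) :
    ((‖k‖ ^ 2 : ℝ) : ℂ) = ∑ i, (k i : ℂ) ^ 2 := by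
  rw [EuclideanSpace.real_norm_sq_eq]; push_cast; rfl

theorem integral_modeFn_mul_laplace (m : ℝ) {b : ℝ → ℝ} (hb : Measurable b) (hb1 : ∀ τ, |b τ| ≤ 1)
    (k : EuclideanSpace ℝ (Fin 3)) (q : Test Spacetime) :
    ∫ z, modeFn m b k z * ∑ i, pdTest (eSpace i) (pdTest (eSpace i) q) z =
      -((‖k‖ ^ 2 : ℝ) : ℂ) * ∫ z, modeFn m b k z * q z := by
  have hl := locallyIntegrable_modeFn m hb hb1 k
  simp_rw [Finset.mul_sum]
  rw [integral_finsetSum _ fun i _ => LocallyIntegrable.integrable_mul_test hl _]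
  simp_rw [integral_modeFn_mul_pdTest m hb hb1]
  rw [norm_sq_eq_sum, ← Finset.sum_neg_distrib, Finset.sum_mul]
  refine Finset.sum_congr rfl fun i _ => ?_
  linear_combination ((k i : ℂ) ^ 2 * ∫ z, modeFn m b k z * q z) * Complex.I_sq

theorem integral_modeFn_mul_helmTest (m : ℝ) {b : ℝ → ℝ} (hb : Measurable b)
    (hb1 : ∀ τ, |b τ| ≤ 1) (k : EuclideanSpace ℝ (Fin 3)) (q : Test Spacetime) :
    ∫ z, modeFn m b k z * helmTest q z =
      ((1 + ‖k‖ ^ 2 : ℝ) : ℂ) * ∫ z, modeFn m b k z * q z := by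
  have hl := locallyIntegrable_modeFn m hb hb1 k
  simp_rw [helmTest_apply, mul_sub]
  rw [integral_sub (LocallyIntegrable.integrable_mul_test hl _), integral_modeFn_mul_laplace m hb hb1]
  · push_cast; ring
  · simp_rw [Finset.mul_sum]
    exact integrable_finsetSum _ fun i _ => LocallyIntegrable.integrable_mul_test hl _

/-- The Laplacian acts on the mode as -‖k‖², so the field equation reduces to an oscillator of
frequency `energy m k` in time. The time derivatives stay on q because b need not be differentiable.
-/
theorem integral_modeFn_mul_kgTest (m : ℝ) {b : ℝ → ℝ} (hb : Measurable b)
    (hb1 : ∀ τ, |b τ| ≤ 1) (k : EuclideanSpace ℝ (Fin 3)) (q : Test Spacetime) :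
    ∫ z, modeFn m b k z * kgTest m q z =
      ∫ z, modeFn m b k z * (pdTest eTime (pdTest eTime q) z + (energy m k : ℂ) ^ 2 * q z) := by
  have hl := locallyIntegrable_modeFn m hb hb1 k
  have hi := fun q => LocallyIntegrable.integrable_mul_test hl q
  have hs : Integrable fun z => modeFn m b k z *
      ∑ i, pdTest (eSpace i) (pdTest (eSpace i) q) z := by
    simp_rw [Finset.mul_sum]
    exact integrable_finsetSum _ fun i _ => hi _
  have e : ((energy m k : ℂ)) ^ 2 = ((‖k‖ ^ 2 : ℝ) : ℂ) + (m : ℂ) ^ 2 := by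
    rw [← Complex.ofReal_pow, energy_sq]; push_cast; ring
  have e1 : ∀ z, modeFn m b k z * kgTest m q z = (modeFn m b k z * pdTest eTime (pdTest eTime q) z -
      modeFn m b k z * ∑ i, pdTest (eSpace i) (pdTest (eSpace i) q) z) +
      (m : ℂ) ^ 2 * (modeFn m b k z * q z) := fun z => by rw [kgTest_apply]; ring
  have e2 : ∀ z, modeFn m b k z * (pdTest eTime (pdTest eTime q) z + (energy m k : ℂ) ^ 2 * q z) =
      modeFn m b k z * pdTest eTime (pdTest eTime q) z +
      (energy m k : ℂ) ^ 2 * (modeFn m b k z * q z) := fun z => by ring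
  simp_rw [e1, e2]
  have h3 : Integrable fun z => modeFn m b k z * pdTest eTime (pdTest eTime q) z -
      modeFn m b k z * ∑ i, pdTest (eSpace i) (pdTest (eSpace i) q) z := (hi _).sub hs
  rw [integral_add h3 ((hi _).const_mul _), integral_sub (hi _) hs,
    integral_add (hi _) ((hi _).const_mul _), integral_modeFn_mul_laplace m hb hb1,
    integral_const_mul, integral_const_mul, e]
  ring

/-- The Heaviside function. -/
def heaviside : ℝ → ℝ := indicator (Ioi 0) 1

theorem measurable_heaviside : Measurable heaviside :=
  measurable_one.indicator measurableSet_Ioi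

theorem abs_heaviside_le (τ : ℝ) : |heaviside τ| ≤ 1 := by
  by_cases h : τ ∈ Ioi (0 : ℝ) <;> simp [heaviside, h]

theorem hasDerivAt_time (q : Test Spacetime) (τ : ℝ) (y : EuclideanSpace ℝ (Fin 3)) :
    HasDerivAt (fun τ => q (τ, y)) (pdTest eTime q (τ, y)) τ := by
  have h1 : HasFDerivAt q (fderiv ℝ q (τ, y)) (τ, y) :=
    (q.contDiff.differentiable (by simp) _).hasFDerivAt
  have h2 : HasDerivAt (fun τ : ℝ => (τ, y)) ((1 : ℝ), (0 : EuclideanSpace ℝ (Fin 3))) τ :=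
    (hasDerivAt_id τ).prodMk (hasDerivAt_const τ y)
  exact h1.comp_hasDerivAt τ h2

/-- Duhamel's formula for a single mode. -/
theorem integral_modeFn_heaviside_mul_kgTest (m : ℝ) (k : EuclideanSpace ℝ (Fin 3))
    (q : Test Spacetime) : ∫ z, modeFn m heaviside k z * kgTest m q z =
      ∫ y, Complex.exp (Complex.I * (inner ℝ k y : ℝ)) * q (0, y) := by
  have hl := locallyIntegrable_modeFn m measurable_heaviside abs_heaviside_le k
  have hi := fun q => LocallyIntegrable.integrable_mul_test hl q
  rw [integral_modeFn_mul_kgTest m measurable_heaviside abs_heaviside_le]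
  set w := energy m k
  have hint : Integrable fun z => modeFn m heaviside k z *
      (pdTest eTime (pdTest eTime q) z + (w : ℂ) ^ 2 * q z) := by
    have := (hi (pdTest eTime (pdTest eTime q))).add ((hi q).const_mul ((w : ℂ) ^ 2))
    refine this.congr (Filter.Eventually.of_forall fun z => ?_)
    simp only [Pi.add_apply]; ring
  rw [Measure.volume_eq_prod, integral_prod_symm _ (by rwa [← Measure.volume_eq_prod])]
  congr 1; funext y
  -- F is the Wronskian of q with the oscillator solution sin(wτ)/w. Its derivative is the integrand
  -- and F 0 = -q(0, y), so integration over τ > 0 leaves the value at τ = 0.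
  let F : ℝ → ℂ := fun τ => (sinProp w τ : ℂ) * pdTest eTime q (τ, y) -
    (Real.cos (w * τ) : ℂ) * q (τ, y)
  have hF : ∀ τ, HasDerivAt F ((sinProp w τ : ℂ) *
      (pdTest eTime (pdTest eTime q) (τ, y) + (w : ℂ) ^ 2 * q (τ, y))) τ := by
    intro τ
    have h1 := ((hasDerivAt_sinProp w τ).ofReal_comp).mul (hasDerivAt_time (pdTest eTime q) τ y)
    have h2 : HasDerivAt (fun τ => Real.cos (w * τ)) (-Real.sin (w * τ) * (w * 1)) τ :=
      ((hasDerivAt_id τ).const_mul w).cos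
    have h3 := h2.ofReal_comp.mul (hasDerivAt_time q τ y)
    refine (h1.sub h3).congr_deriv ?_
    rw [← mul_sinProp]
    push_cast; ring
  have hcont : Continuous fun τ : ℝ => (τ, y) := by fun_prop
  have hsc : Continuous fun τ => sinProp w τ :=
    continuous_sinProp.comp (continuous_const.prodMk continuous_id)
  have hFd : deriv F = fun τ => (sinProp w τ : ℂ) *
      (pdTest eTime (pdTest eTime q) (τ, y) + (w : ℂ) ^ 2 * q (τ, y)) :=
    funext fun τ => (hF τ).deriv
  have hF1 : ContDiff ℝ 1 F := by
    refine contDiff_one_iff_deriv.2 ⟨fun τ => (hF τ).differentiableAt, ?_⟩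
    rw [hFd]
    exact (Complex.continuous_ofReal.comp hsc).mul
      (((pdTest eTime (pdTest eTime q)).continuous.comp hcont).add
        (continuous_const.mul (q.continuous.comp hcont)))
  have hsupp : ∀ q : Test Spacetime, HasCompactSupport fun τ => q (τ, y) := fun q => by
    refine HasCompactSupport.intro (q.hasCompactSupport.isCompact.image continuous_fst) ?_
    intro τ hτ
    by_contra hne
    exact hτ ⟨(τ, y), subset_tsupport _ hne, rfl⟩
  have hFc : HasCompactSupport F := ((hsupp _).mul_left).sub ((hsupp _).mul_left)
  have h1 := hFc.integral_Ioi_deriv_eq hF1 0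
  have h2 : F 0 = -q (0, y) := by simp [F, sinProp_zero]
  rw [h2, neg_neg, hFd, ← integral_indicator measurableSet_Ioi] at h1
  rw [← h1, ← integral_const_mul]
  congr 1; funext τ
  by_cases hτ : τ ∈ Ioi (0 : ℝ)
  · simp [modeFn, heaviside, indicator_of_mem hτ, w]; ring
  · simp [modeFn, heaviside, indicator_of_notMem hτ]

/-- The density `(2π)⁻³ (1 + ‖k‖²)⁻²`. -/
def kernelWeight (k : EuclideanSpace ℝ (Fin 3)) : ℝ :=
  ((2 * Real.pi) ^ 3 * (1 + ‖k‖ ^ 2) ^ 2)⁻¹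

theorem kernelWeight_nonneg (k : EuclideanSpace ℝ (Fin 3)) : 0 ≤ kernelWeight k := by
  have := Real.pi_pos
  unfold kernelWeight; positivity

theorem continuous_kernelWeight : Continuous kernelWeight := by
  have := Real.pi_pos
  unfold kernelWeight
  exact Continuous.inv₀ (by fun_prop) fun k => by positivity

theorem integrable_kernelWeight : Integrable kernelWeight := by
  refine (integrable_one_add_norm_inv.const_mul 4).mono'
    continuous_kernelWeight.aestronglyMeasurable (Filter.Eventually.of_forall fun k => ?_)
  rw [Real.norm_of_nonneg (kernelWeight_nonneg k), kernelWeight, ← div_eq_mul_inv, inv_eq_one_div]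
  have hpi := Real.pi_gt_three
  have hk := norm_nonneg k
  rw [div_le_div_iff₀ (by positivity) (by positivity), one_mul]
  have h1 : (1 + ‖k‖) ^ 2 ≤ 2 * (1 + ‖k‖ ^ 2) := by nlinarith [sq_nonneg (1 - ‖k‖)]
  have h2 : (1 + ‖k‖) ^ 4 ≤ 4 * (1 + ‖k‖ ^ 2) ^ 2 := by
    calc (1 + ‖k‖) ^ 4 = ((1 + ‖k‖) ^ 2) ^ 2 := by ring
      _ ≤ (2 * (1 + ‖k‖ ^ 2)) ^ 2 := by gcongr
      _ = _ := by ring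
  have h3 : (1 : ℝ) ≤ (2 * Real.pi) ^ 3 := one_le_pow₀ (by linarith)
  have h4 : (1 + ‖k‖ ^ 2) ^ 2 ≤ (2 * Real.pi) ^ 3 * (1 + ‖k‖ ^ 2) ^ 2 :=
    le_mul_of_one_le_left (by positivity) h3
  linarith

/-- The regularized propagator. -/
def propKernel (m : ℝ) (b : ℝ → ℝ) (z : Spacetime) : ℂ :=
  ∫ k, (kernelWeight k : ℂ) * modeFn m b k z

theorem norm_kernelWeight_mul_modeFn_le (m : ℝ) {b : ℝ → ℝ} (hb1 : ∀ τ, |b τ| ≤ 1)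
    (k : EuclideanSpace ℝ (Fin 3)) (z : Spacetime) :
    ‖(kernelWeight k : ℂ) * modeFn m b k z‖ ≤ kernelWeight k * |z.1| := by
  rw [norm_mul, Complex.norm_real, Real.norm_of_nonneg (kernelWeight_nonneg k)]
  exact mul_le_mul_of_nonneg_left (norm_modeFn_le m hb1 k z) (kernelWeight_nonneg k)

theorem measurable_kernelWeight_mul_modeFn (m : ℝ) {b : ℝ → ℝ} (hb : Measurable b) :
    Measurable fun p : Spacetime × EuclideanSpace ℝ (Fin 3) =>
      (kernelWeight p.2 : ℂ) * modeFn m b p.2 p.1 :=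
  (Complex.measurable_ofReal.comp (continuous_kernelWeight.measurable.comp measurable_snd)).mul
    (measurable_modeFn m hb)

theorem locallyIntegrable_propKernel (m : ℝ) {b : ℝ → ℝ} (hb : Measurable b)
    (hb1 : ∀ τ, |b τ| ≤ 1) : LocallyIntegrable (propKernel m b) := by
  refine locallyIntegrable_of_norm_le_time (C := ∫ k, kernelWeight k) ?_ fun z => ?_
  · exact ((measurable_kernelWeight_mul_modeFn m hb).stronglyMeasurable.integral_prod_right).measurable
  · rw [← integral_mul_const]
    exact norm_integral_le_of_norm_le (integrable_kernelWeight.mul_const _)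
      (Filter.Eventually.of_forall fun k => norm_kernelWeight_mul_modeFn_le m hb1 k z)

theorem integral_propKernel_mul (m : ℝ) {b : ℝ → ℝ} (hb : Measurable b) (hb1 : ∀ τ, |b τ| ≤ 1)
    (q : Test Spacetime) : ∫ z, propKernel m b z * q z =
      ∫ k, (kernelWeight k : ℂ) * ∫ z, modeFn m b k z * q z := by
  have hint : Integrable (Function.uncurry fun (z : Spacetime) (k : EuclideanSpace ℝ (Fin 3)) =>
      (kernelWeight k : ℂ) * modeFn m b k z * q z) (volume.prod volume) := by
    have h1 : Integrable fun z : Spacetime => |z.1| * ‖q z‖ := by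
      have hc : Continuous fun z : Spacetime => |z.1| * ‖q z‖ :=
        (continuous_abs.comp continuous_fst).mul q.continuous.norm
      exact hc.integrable_of_hasCompactSupport q.hasCompactSupport.norm.mul_left
    refine (h1.mul_prod integrable_kernelWeight).mono' ?_ (Filter.Eventually.of_forall fun p => ?_)
    · exact ((measurable_kernelWeight_mul_modeFn m hb).mul
        (q.continuous.measurable.comp measurable_fst)).aestronglyMeasurable
    · simp only [Function.uncurry]
      rw [norm_mul]
      have := norm_kernelWeight_mul_modeFn_le m hb1 p.2 p.1
      calc _ ≤ kernelWeight p.2 * |p.1.1| * ‖q p.1‖ := by gcongr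
        _ = _ := by ring
  have h := integral_integral_swap hint
  calc _ = ∫ z, ∫ k, (kernelWeight k : ℂ) * modeFn m b k z * q z := by
        congr 1; funext z; rw [propKernel, ← integral_mul_const]
    _ = _ := h
    _ = _ := by
        congr 1; funext k; rw [← integral_const_mul]; congr 1; funext z; ring

/-- Each factor 1 - Δ contributes 1 + ‖k‖², so two of them cancel the regularising weight. -/
theorem integral_propKernel_mul_helmTest (m : ℝ) {b : ℝ → ℝ} (hb : Measurable b)
    (hb1 : ∀ τ, |b τ| ≤ 1) (q : Test Spacetime) :
    ∫ z, propKernel m b z * helmTest (helmTest q) z =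
      ∫ k, (((2 * Real.pi) ^ 3)⁻¹ : ℝ) * ∫ z, modeFn m b k z * q z := by
  rw [integral_propKernel_mul m hb hb1]
  congr 1; funext k
  rw [integral_modeFn_mul_helmTest m hb hb1, integral_modeFn_mul_helmTest m hb hb1, ← mul_assoc,
    ← mul_assoc, ← Complex.ofReal_mul, ← Complex.ofReal_mul]
  congr 2
  rw [kernelWeight, mul_inv]
  have : (1 + ‖k‖ ^ 2) ≠ 0 := by positivity
  field_simp

/-- The restriction of a test function to the hypersurface `t = 0`. -/
def sliceTest (q : Test Spacetime) : Test (EuclideanSpace ℝ (Fin 3)) :=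
  ⟨fun y => q (0, y), q.contDiff.comp (contDiff_const.prodMk contDiff_id), by
    refine HasCompactSupport.intro (q.hasCompactSupport.isCompact.image continuous_snd) ?_
    intro y hy
    by_contra hne
    exact hy ⟨(0, y), subset_tsupport _ hne, rfl⟩, fun _ _ => trivial⟩

theorem sliceTest_pdTest (i : Fin 3) (q : Test Spacetime) :
    sliceTest (pdTest (eSpace i) q) = pdTest (EuclideanSpace.single i 1) (sliceTest q) := by
  ext y
  change fderiv ℝ q (0, y) (eSpace i) =
    fderiv ℝ (fun y => q (0, y)) y (EuclideanSpace.single i 1)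
  have h1 : HasFDerivAt q (fderiv ℝ q (0, y)) (0, y) :=
    (q.contDiff.differentiable (by simp) _).hasFDerivAt
  have h2 : HasFDerivAt (fun y : EuclideanSpace ℝ (Fin 3) => ((0 : ℝ), y))
      (ContinuousLinearMap.inr ℝ ℝ _) y :=
    hasFDerivAt_prodMk_right 0 y
  have h3 : fderiv ℝ (fun y => q (0, y)) y = _ := (h1.comp y h2).fderiv
  rw [h3]
  rfl

theorem ftTest_sliceTest_helmTest (k : EuclideanSpace ℝ (Fin 3)) (q : Test Spacetime) :
    ftTest volume (sliceTest (helmTest q)) (innerSL ℝ k) =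
      ((1 + ‖k‖ ^ 2 : ℝ) : ℂ) * ftTest volume (sliceTest q) (innerSL ℝ k) := by
  have h1 : sliceTest (helmTest q) = sliceTest q + (-1 : ℂ) • ∑ i,
      sliceTest (pdTest (eSpace i) (pdTest (eSpace i) q)) := by
    ext y
    change helmTest q (0, y) = q (0, y) + (-1 : ℂ) * (∑ i,
      sliceTest (pdTest (eSpace i) (pdTest (eSpace i) q))) y
    rw [helmTest_apply, sum_apply]
    change _ = q (0, y) + (-1 : ℂ) * (∑ i, pdTest (eSpace i) (pdTest (eSpace i) q) (0, y))
    ring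
  rw [h1, ftTest_add, ftTest_smul]
  have h2 : ∀ s : Finset (Fin 3), ftTest volume (∑ i ∈ s,
      sliceTest (pdTest (eSpace i) (pdTest (eSpace i) q))) (innerSL ℝ k) =
      ∑ i ∈ s, -((k i : ℂ) ^ 2) * ftTest volume (sliceTest q) (innerSL ℝ k) := by
    intro s
    induction s using Finset.induction_on with
    | empty =>
      have : ftTest volume ((0 : ℂ) • sliceTest q) (innerSL ℝ k) = 0 := by
        rw [ftTest_smul, zero_mul]
      simpa using this
    | insert i s hi ih =>
      rw [Finset.sum_insert hi, Finset.sum_insert hi, ftTest_add, ih]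
      congr 1
      rw [sliceTest_pdTest, sliceTest_pdTest, ftTest_pdTest, ftTest_pdTest]
      have : innerSL ℝ k (EuclideanSpace.single i 1) = k i := by
        simp [EuclideanSpace.inner_single_right]
      rw [this]
      linear_combination ((k i : ℂ) ^ 2 * ftTest volume (sliceTest q) (innerSL ℝ k)) * Complex.I_sq
  rw [h2, Complex.ofReal_add, norm_sq_eq_sum, ← Finset.sum_mul, Finset.sum_neg_distrib]
  push_cast; ring

/-- Fourier inversion at the origin. The dilation by -(2π)⁻¹ between the two conventions produces
the factor (2π)⁻³, and its sign drops out of the integral. -/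
theorem fourier_inversion_test (f : Test (EuclideanSpace ℝ (Fin 3))) :
    ∫ k, (((2 * Real.pi) ^ 3)⁻¹ : ℝ) * ftTest volume f (innerSL ℝ k) = f 0 := by
  have hpi := Real.pi_pos
  have h1 : ∀ k, ftTest volume f (innerSL ℝ k) = FourierTransform.fourier (⇑f) (-(2 * Real.pi)⁻¹ • k) := by
    intro k
    rw [Real.fourier_eq', ftTest]
    congr 1; funext y
    rw [planeWave, smul_eq_mul]
    congr 2
    rw [inner_smul_right, real_inner_comm, innerSL_apply_apply]
    push_cast
    field_simp
  let fS : SchwartzMap (EuclideanSpace ℝ (Fin 3)) ℂ := f.hasCompactSupport.toSchwartzMap f.contDiff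
  have h2 : Integrable (FourierTransform.fourier (⇑f)) := by
    have h := (FourierTransform.fourier fS).integrable (μ := volume)
    rwa [SchwartzMap.fourier_coe] at h
  have h3 := (integrable_test volume f).fourierInv_fourier_eq h2 f.continuous.continuousAt (v := 0)
  rw [Real.fourierInv_eq'] at h3
  simp only [inner_zero_right, mul_zero, Complex.ofReal_zero, zero_mul, Complex.exp_zero,
    one_smul] at h3
  simp_rw [h1]
  rw [integral_const_mul, Measure.integral_comp_smul volume (FourierTransform.fourier (⇑f)), h3,
    finrank_euclideanSpace_fin, Complex.real_smul, ← mul_assoc, ← Complex.ofReal_mul,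
    abs_of_neg]
  · rw [show ((2 * Real.pi) ^ 3)⁻¹ * -((-(2 * Real.pi)⁻¹) ^ 3)⁻¹ = (1 : ℝ) by field_simp]
    simp
  · rw [inv_lt_zero, Odd.pow_neg_iff (by decide), neg_lt_zero]
    positivity

end Propagator

end QEI

end

noncomputable section

namespace QEI

/-! ### Uniqueness in the domain of dependence -/

section EnergyEstimate

theorem pd_comm {E F : Type} [NormedAddCommGroup E] [NormedSpace ℝ E] [NormedAddCommGroup F]
    [NormedSpace ℝ F] {φ : E → F} (h : ContDiff ℝ ∞ φ) (v w : E) :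
    pd v (pd w φ) = pd w (pd v φ) := by
  funext x
  have hd : DifferentiableAt ℝ (fderiv ℝ φ) x :=
    (h.fderiv_right (m := ∞) (by simp)).differentiable (by simp) x
  have key : ∀ a b : E, pd a (pd b φ) x = fderiv ℝ (fderiv ℝ φ) x a b := by
    intro a b
    have h1 : HasFDerivAt (fun y => fderiv ℝ φ y b) ((fderiv ℝ (fderiv ℝ φ) x).flip b) x := by
      have := hd.hasFDerivAt.clm_apply (hasFDerivAt_const b x)
      simpa using this
    have h2 : fderiv ℝ (pd b φ) x = _ := h1.fderiv
    rw [pd, h2]; rfl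
  rw [key, key]
  exact (h.contDiffAt.isSymmSndFDerivAt (n := ∞) (by
    rw [minSmoothness_of_isRCLikeNormedField]
    exact WithTop.coe_le_coe.2 (le_top : (2 : ℕ∞) ≤ ⊤))) v w

theorem pd_eq_zero_of_eventually {E F : Type} [NormedAddCommGroup E] [NormedSpace ℝ E]
    [NormedAddCommGroup F] [NormedSpace ℝ F] {φ : E → F} {x : E} (v : E)
    (h : ∀ᶠ y in 𝓝 x, φ y = 0) : pd v φ x = 0 := by
  have h1 : φ =ᶠ[𝓝 x] fun _ => (0 : F) := h
  rw [pd, h1.fderiv_eq]; simp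

/-- The square of the positive part is differentiable across zero. It serves as the weight that
localises integration by parts to the regularised cone. -/
theorem hasDerivAt_max_zero_sq (s : ℝ) :
    HasDerivAt (fun s : ℝ => max s 0 ^ 2) (2 * max s 0) s := by
  rcases lt_trichotomy s 0 with h | h | h
  · have h1 : (fun s : ℝ => max s 0 ^ 2) =ᶠ[𝓝 s] fun _ => 0 := by
      filter_upwards [Iio_mem_nhds h] with t ht
      rw [max_eq_right ht.le]; simp
    rw [max_eq_right h.le, mul_zero]
    exact (hasDerivAt_const s (0 : ℝ)).congr_of_eventuallyEq h1
  · subst h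
    rw [hasDerivAt_iff_isLittleO]
    have h2 : (fun x' : ℝ => max x' 0 ^ 2 - max (0 : ℝ) 0 ^ 2 - (x' - 0) • (2 * max (0 : ℝ) 0))
        =O[𝓝 0] fun x' : ℝ => x' ^ 2 := by
      refine Asymptotics.isBigO_of_le _ fun x => ?_
      simp only [max_self, ne_eq, OfNat.ofNat_ne_zero, not_false_eq_true, zero_pow, sub_zero,
        mul_zero, smul_zero, norm_pow, Real.norm_eq_abs]
      refine pow_le_pow_left₀ (abs_nonneg _) ?_ 2
      rcases le_total x 0 with hx | hx
      · rw [max_eq_right hx, abs_zero]; exact abs_nonneg x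
      · rw [max_eq_left hx]
    have h3 := h2.trans_isLittleO (Asymptotics.isLittleO_pow_id one_lt_two)
    simpa using h3
  · have h1 : (fun s : ℝ => max s 0 ^ 2) =ᶠ[𝓝 s] fun s => s ^ 2 := by
      filter_upwards [Ioi_mem_nhds h] with t ht
      rw [max_eq_left (le_of_lt ht)]
    rw [max_eq_left h.le]
    have := (hasDerivAt_pow 2 s).congr_of_eventuallyEq h1
    simpa using this

/-- The regularized radius `√(‖𝐱 - 𝐩‖² + δ²)`. -/
def regRadius (p : Spacetime) (δ : ℝ) (z : Spacetime) : ℝ := √(‖z.2 - p.2‖ ^ 2 + δ ^ 2)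

/-- The defining function of the regularized backward light cone of `p`. -/
def coneFn (p : Spacetime) (δ r : ℝ) (z : Spacetime) : ℝ := r - (regRadius p δ z + (z.1 - p.1))

theorem regRadius_pos (p : Spacetime) {δ : ℝ} (hδ : 0 < δ) (z : Spacetime) :
    0 < regRadius p δ z := Real.sqrt_pos.2 (by positivity)

theorem continuous_regRadius (p : Spacetime) (δ : ℝ) : Continuous (regRadius p δ) := by
  unfold regRadius; fun_prop

theorem continuous_coneFn (p : Spacetime) (δ r : ℝ) : Continuous (coneFn p δ r) := by
  have := continuous_regRadius p δ
  unfold coneFn; fun_prop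

theorem norm_sub_le_regRadius (p : Spacetime) (δ : ℝ) (z : Spacetime) :
    ‖z.2 - p.2‖ ≤ regRadius p δ z :=
  Real.le_sqrt_of_sq_le (by nlinarith [sq_nonneg δ])

theorem hasLineDerivAt_coneFn_eTime (p : Spacetime) (δ r : ℝ) (z : Spacetime) :
    HasLineDerivAt ℝ (coneFn p δ r) (-1) z eTime := by
  have h1 : (fun t : ℝ => coneFn p δ r (z + t • eTime)) = fun t => coneFn p δ r z - t := by
    funext t; simp [coneFn, regRadius, eTime]; ring
  unfold HasLineDerivAt
  rw [h1]
  exact (hasDerivAt_id (0 : ℝ)).const_sub _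

theorem hasLineDerivAt_coneFn_eSpace (p : Spacetime) {δ : ℝ} (hδ : 0 < δ) (r : ℝ) (z : Spacetime)
    (i : Fin 3) : HasLineDerivAt ℝ (coneFn p δ r) (-((z.2 i - p.2 i) / regRadius p δ z)) z
      (eSpace i) := by
  have h1 : (fun t : ℝ => coneFn p δ r (z + t • eSpace i)) = fun t =>
      r - (√(‖z.2 - p.2‖ ^ 2 + δ ^ 2 + (2 * (z.2 i - p.2 i) * t + t ^ 2)) + (z.1 - p.1)) := by
    funext t
    have h2 : z.2 + t • EuclideanSpace.single i (1 : ℝ) - p.2 =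
        (z.2 - p.2) + t • EuclideanSpace.single i (1 : ℝ) := by abel
    simp only [coneFn, regRadius, eSpace, Prod.smul_mk, smul_eq_mul, mul_zero, Prod.fst_add,
      Prod.snd_add, add_zero]
    rw [h2, norm_add_sq_real, inner_smul_right, EuclideanSpace.inner_single_right, norm_smul]
    simp only [PiLp.sub_apply, PiLp.norm_single, Real.norm_eq_abs]
    simp
    congr 1
    ring
  unfold HasLineDerivAt
  rw [h1]
  have h3 : HasDerivAt (fun t : ℝ => ‖z.2 - p.2‖ ^ 2 + δ ^ 2 + (2 * (z.2 i - p.2 i) * t + t ^ 2))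
      (2 * (z.2 i - p.2 i)) 0 := by
    have := (((hasDerivAt_id (0 : ℝ)).const_mul (2 * (z.2 i - p.2 i))).add
      (hasDerivAt_pow 2 (0 : ℝ))).const_add (‖z.2 - p.2‖ ^ 2 + δ ^ 2)
    simpa using this
  have h4 := ((h3.sqrt (by simp; positivity)).add_const (z.1 - p.1)).const_sub r
  refine h4.congr_deriv ?_
  have := regRadius_pos p hδ z
  unfold regRadius at this ⊢
  simp only [mul_zero, ne_eq, OfNat.ofNat_ne_zero, not_false_eq_true, zero_pow, add_zero]
  field_simp

theorem hasLineDerivAt_pd {φ : Spacetime → ℝ} (h : ContDiff ℝ ∞ φ) (v z : Spacetime) :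
    HasLineDerivAt ℝ φ (pd v φ z) z v :=
  ((h.differentiable (by simp) z).hasFDerivAt).hasLineDerivAt v

/-- Uniqueness in the domain of dependence: a smooth solution of the Klein-Gordon equation near the
regularized backward light cone of `p` that vanishes in the distant past vanishes at `p`. -/
theorem eq_zero_of_kleinGordon (m : ℝ) {v : Spacetime → ℝ} (hv : ContDiff ℝ ∞ v) {t0 : ℝ}
    (h0 : ∀ z : Spacetime, z.1 < t0 → v z = 0) (p : Spacetime) {r : ℝ} (hr : 0 < r)
    (hkg : ∀ z : Spacetime, ‖z.2 - p.2‖ + (z.1 - p.1) < r →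
      pd eTime (pd eTime v) z - ∑ i, pd (eSpace i) (pd (eSpace i) v) z + m ^ 2 * v z = 0) :
    v p = 0 := by
  -- The regularised radius at p equals δ < r, so p and the vertical line below it lie inside the
  -- cone.
  set δ := r / 2 with hδ_def
  have hδ : 0 < δ := by positivity
  set w : Spacetime → ℝ := fun z => max (coneFn p δ r z) 0 with hw_def
  have hwc : Continuous w := (continuous_coneFn p δ r).max continuous_const
  have hw0 : ∀ z, 0 ≤ w z := fun z => le_max_right _ _
  have hvt := contDiff_pd eTime hv
  have hvi := fun i => contDiff_pd (eSpace i) hv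
  have hzero : ∀ u : Spacetime, ∀ z : Spacetime, z.1 < t0 → pd u v z = 0 := fun u z hz =>
    pd_eq_zero_of_eventually u (by
      filter_upwards [(isOpen_Iio.preimage continuous_fst).mem_nhds hz] with y hy using h0 y hy)
  -- compactness of the support of the weighted quantities
  have hsupp : ∀ F : Spacetime → ℝ, (∀ z : Spacetime, z.1 < t0 → F z = 0) →
      HasCompactSupport fun z => w z * F z := by
    intro F hF
    refine HasCompactSupport.intro (K := Icc t0 (p.1 + r) ×ˢ
      Metric.closedBall p.2 (r + p.1 - t0)) (isCompact_Icc.prod (isCompact_closedBall _ _)) ?_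
    intro z hz
    by_cases h1 : z.1 < t0
    · rw [hF z h1, mul_zero]
    · have h2 : coneFn p δ r z ≤ 0 := by
        by_contra hc
        push Not at hc h1
        refine hz ⟨⟨h1, ?_⟩, ?_⟩
        · have := regRadius_pos p hδ z
          unfold coneFn at hc; linarith
        · rw [Metric.mem_closedBall, dist_eq_norm]
          have := norm_sub_le_regRadius p δ z
          unfold coneFn at hc; linarith
      simp [hw_def, max_eq_right h2]
  have hint : ∀ F : Spacetime → ℝ, Continuous F → (∀ z : Spacetime, z.1 < t0 → F z = 0) →
      Integrable fun z => w z * F z := fun F hF hF0 =>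
    (hwc.mul hF).integrable_of_hasCompactSupport (hsupp F hF0)
  -- integration by parts
  have hibp : ∀ (u : Spacetime) (s : Spacetime → ℝ) (J : Spacetime → ℝ), Continuous s →
      (∀ z, HasLineDerivAt ℝ (coneFn p δ r) (s z) z u) → ContDiff ℝ ∞ J →
      (∀ z : Spacetime, z.1 < t0 → J z = 0) →
      ∫ z, w z * (w z * pd u J z) = - ∫ z, w z * (2 * s z * J z) := by
    intro u s J hs hsd hJ hJ0
    have hJ1 : ∀ z : Spacetime, z.1 < t0 → pd u J z = 0 := fun z hz =>
      pd_eq_zero_of_eventually u (by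
        filter_upwards [(isOpen_Iio.preimage continuous_fst).mem_nhds hz] with y hy using hJ0 y hy)
    have hl : ∀ z, HasLineDerivAt ℝ (fun z => w z ^ 2) (2 * w z * s z) z u := by
      intro z
      have h1 : HasDerivAt (fun t : ℝ => coneFn p δ r (z + t • u)) (s z) 0 := hsd z
      have h2 : HasDerivAt (fun s : ℝ => max s 0 ^ 2) (2 * w z)
          (coneFn p δ r (z + (0 : ℝ) • u)) := by
        rw [zero_smul, add_zero]; exact hasDerivAt_max_zero_sq _
      exact h2.comp (0 : ℝ) h1
    have h := integral_bilinear_hasLineDerivAt_right_eq_neg_left_of_integrable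
      (μ := (volume : Measure Spacetime)) (B := ContinuousLinearMap.mul ℝ ℝ)
      (f := fun z => w z ^ 2) (f' := fun z => 2 * w z * s z) (g := J) (g' := pd u J) (v := u)
      ((hint (fun z => 2 * s z * J z) ((continuous_const.mul hs).mul hJ.continuous)
        fun z hz => by rw [hJ0 z hz, mul_zero]).congr
        (Filter.Eventually.of_forall fun z => by simp; ring))
      ((hint (fun z => w z * pd u J z) (hwc.mul (contDiff_pd u hJ).continuous)
        fun z hz => by rw [hJ1 z hz, mul_zero]).congr
        (Filter.Eventually.of_forall fun z => by simp; ring))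
      ((hint (fun z => w z * J z) (hwc.mul hJ.continuous)
        fun z hz => by rw [hJ0 z hz, mul_zero]).congr
        (Filter.Eventually.of_forall fun z => by simp; ring))
      (fun z _ => hl z) (fun z _ => hasLineDerivAt_pd hJ u z)
    have h' : ∫ z, w z ^ 2 * pd u J z = -∫ z, 2 * w z * s z * J z := h
    calc _ = ∫ z, w z ^ 2 * pd u J z := by congr 1; funext z; ring
      _ = _ := h'
      _ = _ := by congr 2; funext z; ring
  set J0 : Spacetime → ℝ := fun z =>
    (pd eTime v z ^ 2 + ∑ i, pd (eSpace i) v z ^ 2 + m ^ 2 * v z ^ 2) / 2 with hJ0_def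
  set J : Fin 3 → Spacetime → ℝ := fun i z => -(pd eTime v z * pd (eSpace i) v z) with hJ_def
  have hJ0s : ContDiff ℝ ∞ J0 :=
    (((hvt.pow 2).add (ContDiff.sum fun i _ => (hvi i).pow 2)).add
      (contDiff_const.mul (hv.pow 2))).div_const 2
  have hJs : ∀ i, ContDiff ℝ ∞ (J i) := fun i => (hvt.mul (hvi i)).neg
  have hJ00 : ∀ z : Spacetime, z.1 < t0 → J0 z = 0 := fun z hz => by
    simp [hJ0_def, hzero _ z hz, h0 z hz]
  have hJi0 : ∀ i, ∀ z : Spacetime, z.1 < t0 → J i z = 0 := fun i z hz => by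
    simp [hJ_def, hzero _ z hz]
  have hpdJ0 : ∀ z, pd eTime J0 z = pd eTime v z * pd eTime (pd eTime v) z +
      ∑ i, pd (eSpace i) v z * pd eTime (pd (eSpace i) v) z + m ^ 2 * (v z * pd eTime v z) := by
    intro z
    refine (hasLineDerivAt_pd hJ0s eTime z).unique ?_
    have a := hasLineDerivAt_pd hvt eTime z
    have b := fun i => hasLineDerivAt_pd (hvi i) eTime z
    have c := hasLineDerivAt_pd hv eTime z
    unfold HasLineDerivAt at *
    have h1 := (((a.pow 2).add (HasDerivAt.fun_sum fun i (_ : i ∈ Finset.univ) => (b i).pow 2)).add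
      ((c.pow 2).const_mul (m ^ 2))).div_const 2
    refine h1.congr_deriv ?_
    simp [Fin.sum_univ_three]
    ring
  have hpdJ : ∀ i z, pd (eSpace i) (J i) z = -(pd (eSpace i) (pd eTime v) z * pd (eSpace i) v z +
      pd eTime v z * pd (eSpace i) (pd (eSpace i) v) z) := by
    intro i z
    refine (hasLineDerivAt_pd (hJs i) (eSpace i) z).unique ?_
    have a := hasLineDerivAt_pd hvt (eSpace i) z
    have b := hasLineDerivAt_pd (hvi i) (eSpace i) z
    unfold HasLineDerivAt at *
    refine (a.mul b).neg.congr_deriv ?_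
    simp
  set ρ := regRadius p δ with hρ_def
  have hρ0 : ∀ z, 0 < ρ z := regRadius_pos p hδ
  have hρc : Continuous ρ := continuous_regRadius p δ
  have hsc : ∀ i : Fin 3, Continuous fun z : Spacetime => -((z.2 i - p.2 i) / ρ z) := fun i =>
    (Continuous.div (by fun_prop) hρc fun z => (hρ0 z).ne').neg
  have e0 := hibp eTime (fun _ => -1) J0 continuous_const
    (hasLineDerivAt_coneFn_eTime p δ r) hJ0s hJ00
  have ei := fun i => hibp (eSpace i) _ (J i) (hsc i)
    (fun z => hasLineDerivAt_coneFn_eSpace p hδ r z i) (hJs i) (hJi0 i)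
  -- (J0, J) is the energy current: its divergence is ∂_t v times the Klein-Gordon expression of v.
  -- That expression vanishes inside the cone, and w vanishes elsewhere.
  have hdiv : ∀ z, w z * (w z * pd eTime J0 z) + ∑ i, w z * (w z * pd (eSpace i) (J i) z) = 0 := by
    intro z
    by_cases hz : coneFn p δ r z ≤ 0
    · have : w z = 0 := max_eq_right hz
      simp [this]
    · push Not at hz
      have h1 := hkg z (by
        have := norm_sub_le_regRadius p δ z
        unfold coneFn at hz; linarith)
      rw [hpdJ0]
      simp_rw [hpdJ, pd_comm hv eTime]
      simp only [Fin.sum_univ_three] at h1 ⊢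
      linear_combination (w z * w z * pd eTime v z) * h1
  -- G is minus the derivative of the cone function along the energy current. Integrating the
  -- conservation law against w² by parts leaves ∫ w G = 0.
  set G : Spacetime → ℝ := fun z => J0 z + ∑ i, (z.2 i - p.2 i) / ρ z * J i z with hG_def
  have hGc : Continuous G := hJ0s.continuous.add (continuous_finsetSum _ fun i _ =>
    (Continuous.div (by fun_prop) hρc fun z => (hρ0 z).ne').mul (hJs i).continuous)
  have hG0 : ∀ z : Spacetime, z.1 < t0 → G z = 0 := fun z hz => by
    simp [hG_def, hJ00 z hz, hJi0 _ z hz]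
  have hGint : ∫ z, w z * G z = 0 := by
    have hpd0 : ∀ u, ∀ K : Spacetime → ℝ, (∀ z : Spacetime, z.1 < t0 → K z = 0) →
        ∀ z : Spacetime, z.1 < t0 → pd u K z = 0 := fun u K hK z hz =>
      pd_eq_zero_of_eventually u (by
        filter_upwards [(isOpen_Iio.preimage continuous_fst).mem_nhds hz] with y hy using hK y hy)
    have i0 := hint (fun z => w z * pd eTime J0 z) (hwc.mul (contDiff_pd _ hJ0s).continuous)
      fun z hz => by rw [hpd0 _ _ hJ00 z hz, mul_zero]
    have ii := fun i => hint (fun z => w z * pd (eSpace i) (J i) z)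
      (hwc.mul (contDiff_pd _ (hJs i)).continuous)
      fun z hz => by rw [hpd0 _ _ (hJi0 i) z hz, mul_zero]
    have j0 := hint (fun z => 2 * (-1) * J0 z) (continuous_const.mul hJ0s.continuous)
      fun z hz => by rw [hJ00 z hz, mul_zero]
    have ji := fun i => hint (fun z => 2 * -((z.2 i - p.2 i) / ρ z) * J i z)
      ((continuous_const.mul (hsc i)).mul (hJs i).continuous)
      fun z hz => by rw [hJi0 i z hz, mul_zero]
    have s1 : ∫ z, (w z * (w z * pd eTime J0 z) + ∑ i, w z * (w z * pd (eSpace i) (J i) z)) = 0 := by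
      simp_rw [hdiv]; simp
    rw [integral_add i0 (integrable_finsetSum _ fun i _ => ii i), integral_finsetSum _ fun i _ => ii i,
      e0] at s1
    simp_rw [ei] at s1
    rw [Finset.sum_neg_distrib, ← integral_finsetSum _ fun i _ => ji i, ← neg_add,
      ← integral_add j0 (integrable_finsetSum _ fun i _ => ji i), neg_eq_zero] at s1
    have s2 : ∀ z, w z * (2 * (-1) * J0 z) + ∑ i, w z * (2 * -((z.2 i - p.2 i) / ρ z) * J i z) =
        (-2) * (w z * G z) := by
      intro z
      simp only [hG_def, Fin.sum_univ_three]; ring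
    simp_rw [s2, integral_const_mul] at s1
    linarith
  -- With n the spatial gradient of ρ, completing squares gives 2G = ∑ (∂_i v - n_i ∂_t v)² + (1 -
  -- |n|²)(∂_t v)² + m²v². The regularisation makes 1 - |n|² = δ²/ρ² strictly positive.
  have hGlow : ∀ z, pd eTime v z ^ 2 * (δ ^ 2 / ρ z ^ 2) / 2 ≤ G z := by
    intro z
    have hρz := hρ0 z
    have hsq : ρ z ^ 2 = ∑ i, (z.2 i - p.2 i) ^ 2 + δ ^ 2 := by
      rw [hρ_def, regRadius, Real.sq_sqrt (by positivity), EuclideanSpace.real_norm_sq_eq]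
      simp
    have h1 : δ ^ 2 / ρ z ^ 2 = 1 - ∑ i, ((z.2 i - p.2 i) / ρ z) ^ 2 := by
      have : (ρ z) ^ 2 ≠ 0 := by positivity
      simp_rw [div_pow]
      rw [← Finset.sum_div, eq_sub_iff_add_eq, ← add_div, add_comm, ← hsq, div_self this]
    rw [h1]
    simp only [hG_def, hJ0_def, hJ_def, Fin.sum_univ_three]
    nlinarith [sq_nonneg (pd eTime v z * ((z.2 0 - p.2 0) / ρ z) - pd (eSpace 0) v z),
      sq_nonneg (pd eTime v z * ((z.2 1 - p.2 1) / ρ z) - pd (eSpace 1) v z),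
      sq_nonneg (pd eTime v z * ((z.2 2 - p.2 2) / ρ z) - pd (eSpace 2) v z),
      sq_nonneg (m * v z)]
  have hGnn : ∀ z, 0 ≤ G z := fun z => le_trans (by positivity) (hGlow z)
  have hwG : ∀ z, w z * G z = 0 := by
    have h1 : (fun z => w z * G z) =ᵐ[volume] 0 :=
      (integral_eq_zero_iff_of_nonneg (fun z => mul_nonneg (hw0 z) (hGnn z))
        (hint G hGc hG0)).1 hGint
    have h2 := (Continuous.ae_eq_iff_eq volume (hwc.mul hGc) continuous_const).1 h1
    exact fun z => congr_fun h2 z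
  have hvt0 : ∀ z, 0 < coneFn p δ r z → pd eTime v z = 0 := by
    intro z hz
    have h1 : w z = coneFn p δ r z := max_eq_left hz.le
    have h2 : G z = 0 := by
      have := hwG z
      rw [h1] at this
      exact (mul_eq_zero.1 this).resolve_left hz.ne'
    have h3 := hGlow z
    rw [h2] at h3
    have h4 : 0 < δ ^ 2 / ρ z ^ 2 := by have := hρ0 z; positivity
    have h5 : pd eTime v z ^ 2 ≤ 0 := by nlinarith
    exact pow_eq_zero_iff (two_ne_zero) |>.1 (le_antisymm h5 (sq_nonneg _))
  -- integrate along the time direction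
  have hline : ∀ t, HasDerivAt (fun t : ℝ => v (t, p.2)) (pd eTime v (t, p.2)) t := by
    intro t
    have h1 : HasFDerivAt v (fderiv ℝ v (t, p.2)) (t, p.2) :=
      (hv.differentiable (by simp) _).hasFDerivAt
    exact h1.comp_hasDerivAt t ((hasDerivAt_id t).prodMk (hasDerivAt_const t p.2))
  set a := min t0 p.1 - 1
  have hap : a ≤ p.1 := by have := min_le_right t0 p.1; simp only [a]; linarith
  have hat : a < t0 := by have := min_le_left t0 p.1; simp only [a]; linarith
  have hconst := constant_of_has_deriv_right_zero (f := fun t : ℝ => v (t, p.2)) (a := a) (b := p.1)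
    (fun t _ => (hline t).continuousAt.continuousWithinAt) (fun t ht => by
      have h1 := (hline t).hasDerivWithinAt (s := Ici t)
      rwa [hvt0 _ (by
        have : t - p.1 ≤ 0 := by linarith [ht.2]
        simp only [coneFn, regRadius, sub_self, norm_zero]
        rw [show (0 : ℝ) ^ 2 + δ ^ 2 = δ ^ 2 by ring, Real.sqrt_sq hδ.le]
        linarith [hδ_def])] at h1)
  have := hconst p.1 ⟨hap, le_rfl⟩
  rw [h0 (a, p.2) hat] at this
  exact this

end EnergyEstimate

end QEI

end

noncomputable section

namespace QEI

/-! ### Convolution of a locally integrable kernel with a test function -/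

section Convolution

/-- The convolution of a locally integrable function with a test function. -/
def convTest (f : Spacetime → ℂ) (q : Test Spacetime) (z : Spacetime) : ℂ :=
  ∫ z', f z' * reflTest z q z'

theorem convTest_eq (f : Spacetime → ℂ) (q : Test Spacetime) :
    convTest f q = convolution f q (ContinuousLinearMap.mul ℝ ℂ) volume := rfl

theorem contDiff_convTest {f : Spacetime → ℂ} (hf : LocallyIntegrable f) (q : Test Spacetime) :
    ContDiff ℝ ∞ (convTest f q) := by
  rw [convTest_eq]
  exact q.hasCompactSupport.contDiff_convolution_right (n := ⊤) _ hf q.contDiff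

theorem pd_convTest {f : Spacetime → ℂ} (hf : LocallyIntegrable f) (q : Test Spacetime)
    (v : Spacetime) : pd v (convTest f q) = convTest f (pdTest v q) := by
  funext z
  have hq1 : ContDiff ℝ 1 q := q.contDiff.of_le (by simp)
  have h := (q.hasCompactSupport.hasFDerivAt_convolution_right (ContinuousLinearMap.mul ℝ ℂ) hf
    hq1 z).fderiv
  rw [pd, convTest_eq, h, convolution_precompR_apply _ hf (q.hasCompactSupport.fderiv ℝ)
    (hq1.continuous_fderiv one_ne_zero)]
  rfl

theorem kgOp_convTest (m : ℝ) {f : Spacetime → ℂ} (hf : LocallyIntegrable f) (q : Test Spacetime)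
    (z : Spacetime) : kgOp m (convTest f q) z = ∫ z', f z' * kgTest m (reflTest z q) z' := by
  have hi := fun q => LocallyIntegrable.integrable_mul_test hf (reflTest z q)
  simp only [kgOp, pd_convTest hf, convTest]
  have e : ∀ z', f z' * kgTest m (reflTest z q) z' =
      (f z' * reflTest z (pdTest eTime (pdTest eTime q)) z' -
      ∑ i, f z' * reflTest z (pdTest (eSpace i) (pdTest (eSpace i) q)) z') +
      (m : ℂ) ^ 2 * (f z' * reflTest z q z') := by
    intro z'
    rw [kgTest_apply]
    simp_rw [pdTest_pdTest_reflTest]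
    rw [← Finset.mul_sum]; ring
  simp_rw [e]
  have h3 : Integrable fun z' => f z' * reflTest z (pdTest eTime (pdTest eTime q)) z' -
      ∑ i, f z' * reflTest z (pdTest (eSpace i) (pdTest (eSpace i) q)) z' :=
    (hi _).sub (integrable_finsetSum _ fun i _ => hi _)
  rw [integral_add h3 ((hi _).const_mul _), integral_sub (hi _)
    (integrable_finsetSum _ fun i _ => hi _), integral_finsetSum _ fun i _ => hi _,
    integral_const_mul]

end Convolution

/-! ### The retarded solution -/

section Retarded

/-- The retarded solution of the Klein-Gordon equation with source `h`. -/
def retSol (m : ℝ) (h : Test Spacetime) : Spacetime → ℂ :=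
  convTest (propKernel m heaviside) (helmTest (helmTest h))

theorem locallyIntegrable_propKernel_heaviside (m : ℝ) :
    LocallyIntegrable (propKernel m heaviside) :=
  locallyIntegrable_propKernel m measurable_heaviside abs_heaviside_le

theorem contDiff_retSol (m : ℝ) (h : Test Spacetime) : ContDiff ℝ ∞ (retSol m h) :=
  contDiff_convTest (locallyIntegrable_propKernel_heaviside m) _

/-- The operator is moved onto the reflected source. Duhamel's formula reduces each mode to the
slice at time zero, the factors (1 + ‖k‖²)² cancel the regularisation, and Fourier inversion at the
origin returns h z. -/
theorem kgOp_retSol (m : ℝ) (h : Test Spacetime) (z : Spacetime) :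
    kgOp m (retSol m h) z = h z := by
  rw [retSol, kgOp_convTest m (locallyIntegrable_propKernel_heaviside m),
    integral_propKernel_mul m measurable_heaviside abs_heaviside_le]
  simp_rw [integral_modeFn_heaviside_mul_kgTest]
  have h1 : ∀ k : EuclideanSpace ℝ (Fin 3), ∫ y, Complex.exp (Complex.I * (inner ℝ k y : ℝ)) *
      reflTest z (helmTest (helmTest h)) (0, y) =
      ((1 + ‖k‖ ^ 2 : ℝ) : ℂ) * (((1 + ‖k‖ ^ 2 : ℝ) : ℂ) *
        ftTest volume (sliceTest (reflTest z h)) (innerSL ℝ k)) := by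
    intro k
    rw [← ftTest_sliceTest_helmTest, ← ftTest_sliceTest_helmTest, helmTest_reflTest,
      helmTest_reflTest]
    rfl
  simp_rw [h1]
  have h2 : h z = sliceTest (reflTest z h) 0 := by
    change h z = h (z - (0, 0))
    rw [← Prod.zero_eq_mk, sub_zero]
  rw [h2, ← fourier_inversion_test]
  congr 1; funext k
  rw [← mul_assoc, ← mul_assoc, ← Complex.ofReal_mul, ← Complex.ofReal_mul]
  congr 2
  rw [kernelWeight, mul_inv]
  have : (1 + ‖k‖ ^ 2) ≠ 0 := by positivity
  field_simp

theorem tsupport_helmTest_subset (q : Test Spacetime) {z : Spacetime} (hz : helmTest q z ≠ 0) :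
    z ∈ tsupport q := by
  by_contra hc
  refine hz ?_
  have h0 : ∀ᶠ y in 𝓝 z, q y = 0 := by
    have := notMem_tsupport_iff_eventuallyEq.1 hc
    exact this
  have h1 : ∀ v, ∀ᶠ y in 𝓝 z, pd v q y = 0 := fun v =>
    h0.eventually_nhds.mono fun y hy => pd_eq_zero_of_eventually v hy
  have h2 : ∀ v, pd v (pd v q) z = 0 := fun v => pd_eq_zero_of_eventually v (h1 v)
  rw [helmTest_apply]
  simp only [h0.self_of_nhds, zero_sub, neg_eq_zero]
  exact Finset.sum_eq_zero fun i _ => h2 _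

/-- The kernel lives at positive times, so the solution at z depends only on source values at times
before z.1. -/
theorem retSol_eq_zero_of_lt (m : ℝ) (h : Test Spacetime) {R : ℝ}
    (hR : ∀ z ∈ tsupport h, ‖z‖ ≤ R) {z : Spacetime} (hz : z.1 < -R) : retSol m h z = 0 := by
  refine (integral_congr_ae (Filter.Eventually.of_forall fun z' => ?_)).trans
    (integral_zero _ _)
  by_cases hz' : z'.1 ≤ 0
  · have : ∀ k, modeFn m heaviside k z' = 0 := fun k => by
      have : heaviside z'.1 = 0 := indicator_of_notMem (by simpa using hz') _
      simp [modeFn, this]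
    simp [propKernel, this]
  · have h1 : reflTest z (helmTest (helmTest h)) z' = 0 := by
      change helmTest (helmTest h) (z - z') = 0
      by_contra hc
      have h2 : z - z' ∈ tsupport h := closure_minimal
        (fun y hy => tsupport_helmTest_subset h hy) (isClosed_tsupport _)
        (tsupport_helmTest_subset _ hc)
      have h3 := (norm_fst_le _).trans (hR _ h2)
      rw [Real.norm_eq_abs, abs_le] at h3
      have h4 : (z - z').1 = z.1 - z'.1 := rfl
      rw [h4] at h3
      push Not at hz'
      linarith [h3.1]
    simp [h1]

theorem pd_re {φ : Spacetime → ℂ} (h : ContDiff ℝ ∞ φ) (v : Spacetime) :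
    pd v (fun z => (φ z).re) = fun z => (pd v φ z).re := by
  funext z
  have h1 : HasFDerivAt (fun z => (φ z).re) (Complex.reCLM.comp (fderiv ℝ φ z)) z :=
    Complex.reCLM.hasFDerivAt.comp z (h.differentiable (by simp) z).hasFDerivAt
  rw [pd, h1.fderiv]; rfl

theorem pd_im {φ : Spacetime → ℂ} (h : ContDiff ℝ ∞ φ) (v : Spacetime) :
    pd v (fun z => (φ z).im) = fun z => (pd v φ z).im := by
  funext z
  have h1 : HasFDerivAt (fun z => (φ z).im) (Complex.imCLM.comp (fderiv ℝ φ z)) z :=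
    Complex.imCLM.hasFDerivAt.comp z (h.differentiable (by simp) z).hasFDerivAt
  rw [pd, h1.fderiv]; rfl

/-- Finite propagation speed: the backward cone of p with margin ‖p.2‖ - (2R + p.1) misses the
source, one R accounting for its spatial extent and one for its earliest time. Uniqueness is stated
for real functions, hence the separate real and imaginary parts. -/
theorem retSol_eq_zero (m : ℝ) (h : Test Spacetime) {R : ℝ} (hR : ∀ z ∈ tsupport h, ‖z‖ ≤ R)
    {p : Spacetime} (hp : 2 * R + p.1 < ‖p.2‖) : retSol m h p = 0 := by
  have hs := contDiff_retSol m h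
  have hkg : ∀ z : Spacetime, ‖z.2 - p.2‖ + (z.1 - p.1) < ‖p.2‖ - (2 * R + p.1) →
      kgOp m (retSol m h) z = 0 := by
    intro z hz
    rw [kgOp_retSol]
    by_contra hc
    have h1 := hR z (subset_tsupport _ hc)
    have h2 := (norm_fst_le z).trans h1
    have h3 := (norm_snd_le z).trans h1
    rw [Real.norm_eq_abs, abs_le] at h2
    have h4 : ‖p.2‖ ≤ ‖z.2‖ + ‖z.2 - p.2‖ := by
      have := norm_sub_le z.2 (z.2 - p.2)
      simpa using this
    linarith [h2.1]
  have hr : 0 < ‖p.2‖ - (2 * R + p.1) := by linarith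
  have hre : (retSol m h p).re = 0 := by
    refine eq_zero_of_kleinGordon m (v := fun z => (retSol m h z).re)
      (Complex.reCLM.contDiff.comp hs) (t0 := -R) (fun z hz => ?_) p hr fun z hz => ?_
    · rw [retSol_eq_zero_of_lt m h hR hz]; rfl
    · have := congr_arg Complex.re (hkg z hz)
      simp only [pd_re hs, pd_re (contDiff_pd _ hs)]
      simpa [kgOp, ← Complex.ofReal_pow] using this
  have him : (retSol m h p).im = 0 := by
    refine eq_zero_of_kleinGordon m (v := fun z => (retSol m h z).im)
      (Complex.imCLM.contDiff.comp hs) (t0 := -R) (fun z hz => ?_) p hr fun z hz => ?_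
    · rw [retSol_eq_zero_of_lt m h hR hz]; rfl
    · have := congr_arg Complex.im (hkg z hz)
      simp only [pd_im hs, pd_im (contDiff_pd _ hs)]
      simpa [kgOp, ← Complex.ofReal_pow] using this
  exact Complex.ext hre him

/-- The support lies in {t ≥ -R, ‖x‖ ≤ 2R + t}; a causal past bounds t from above, and with it ‖x‖.
-/
theorem isRetarded_retSol (m : ℝ) (h : Test Spacetime) : IsRetarded m h (retSol m h) where
  smooth := contDiff_retSol m h
  solves := kgOp_retSol m h
  pastCompact p := by
    obtain ⟨R, hR⟩ := h.hasCompactSupport.isCompact.isBounded.exists_norm_le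
    set S : Set Spacetime := {z | -R ≤ z.1 ∧ ‖z.2‖ ≤ 2 * R + z.1}
    have hS : IsClosed S := (isClosed_le continuous_const continuous_fst).inter
      (isClosed_le continuous_snd.norm (continuous_const.add continuous_fst))
    have h1 : tsupport (retSol m h) ⊆ S := by
      refine closure_minimal (fun z hz => ⟨?_, ?_⟩) hS
      · by_contra hc
        exact hz (retSol_eq_zero_of_lt m h hR (not_le.1 hc))
      · by_contra hc
        exact hz (retSol_eq_zero m h hR (not_le.1 hc))
    have hP : IsClosed (causalPast p) := isClosed_le (by fun_prop) (by fun_prop)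
    refine (isCompact_Icc.prod (isCompact_closedBall (0 : EuclideanSpace ℝ (Fin 3))
      (2 * R + p.1))).of_isClosed_subset (s := Icc (-R) p.1 ×ˢ _)
      ((isClosed_tsupport _).inter hP) ?_
    rintro z ⟨hz1, hz2⟩
    have h2 := h1 hz1
    have h3 : ‖p.2 - z.2‖ ≤ p.1 - z.1 := hz2
    have h4 : z.1 ≤ p.1 := by linarith [norm_nonneg (p.2 - z.2)]
    refine ⟨⟨h2.1, h4⟩, ?_⟩
    rw [Metric.mem_closedBall, dist_zero_right]
    linarith [h2.2]

end Retarded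

/-! ### The advanced solution by time reversal, and the commutator function -/

section Advanced

/-- Time reversal `(t, 𝐱) ↦ (-t, 𝐱)`. -/
def timeReversal : Spacetime ≃L[ℝ] Spacetime :=
  (ContinuousLinearEquiv.neg ℝ).prodCongr (ContinuousLinearEquiv.refl ℝ _)

theorem timeReversal_apply (z : Spacetime) : timeReversal z = (-z.1, z.2) := rfl

theorem timeReversal_timeReversal (z : Spacetime) : timeReversal (timeReversal z) = z := by
  simp [timeReversal_apply]

theorem pd_comp_timeReversal {φ : Spacetime → ℂ} (h : ContDiff ℝ ∞ φ) (v : Spacetime) :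
    pd v (fun z => φ (timeReversal z)) = fun z => pd (timeReversal v) φ (timeReversal z) := by
  funext z
  have h1 : HasFDerivAt (fun z => φ (timeReversal z)) _ z :=
    ((h.differentiable (by simp) (timeReversal z)).hasFDerivAt).comp z timeReversal.hasFDerivAt
  rw [pd, h1.fderiv]; rfl

theorem pd_neg_left {φ : Spacetime → ℂ} (v : Spacetime) :
    pd (-v) φ = fun z => -pd v φ z := by
  funext z; simp [pd]

theorem pd_neg_right {φ : Spacetime → ℂ} (v : Spacetime) :
    pd v (fun z => -φ z) = fun z => -pd v φ z := by
  funext z; simp [pd]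

theorem pd_pd_eTime_comp_timeReversal {φ : Spacetime → ℂ} (h : ContDiff ℝ ∞ φ) :
    pd eTime (pd eTime (fun z => φ (timeReversal z))) =
      fun z => pd eTime (pd eTime φ) (timeReversal z) := by
  have e : timeReversal eTime = -eTime := by
    rw [timeReversal_apply]; simp [eTime]
  rw [pd_comp_timeReversal h, pd_comp_timeReversal (contDiff_pd _ h), e]
  funext z
  simp only [pd_neg_left, pd_neg_right, neg_neg]

theorem pd_pd_eSpace_comp_timeReversal {φ : Spacetime → ℂ} (h : ContDiff ℝ ∞ φ) (i : Fin 3) :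
    pd (eSpace i) (pd (eSpace i) (fun z => φ (timeReversal z))) =
      fun z => pd (eSpace i) (pd (eSpace i) φ) (timeReversal z) := by
  have e : timeReversal (eSpace i) = eSpace i := by
    rw [timeReversal_apply]; simp [eSpace]
  rw [pd_comp_timeReversal h, pd_comp_timeReversal (contDiff_pd _ h), e]

theorem kgOp_comp_timeReversal (m : ℝ) {φ : Spacetime → ℂ} (h : ContDiff ℝ ∞ φ) (z : Spacetime) :
    kgOp m (fun z => φ (timeReversal z)) z = kgOp m φ (timeReversal z) := by
  simp only [kgOp, pd_pd_eTime_comp_timeReversal h, pd_pd_eSpace_comp_timeReversal h]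

theorem helmTest_compTest_timeReversal (q : Test Spacetime) :
    helmTest (compTest timeReversal q) = compTest timeReversal (helmTest q) := by
  ext z
  change _ = helmTest q (timeReversal z)
  rw [helmTest_apply, helmTest_apply]
  have h1 : ∀ i, pdTest (eSpace i) (pdTest (eSpace i) (compTest timeReversal q)) z =
      pdTest (eSpace i) (pdTest (eSpace i) q) (timeReversal z) := fun i =>
    congr_fun (pd_pd_eSpace_comp_timeReversal q.contDiff i) z
  simp_rw [h1]
  rfl

theorem integral_comp_timeReversal (f : Spacetime → ℂ) :
    ∫ z, f (timeReversal z) = ∫ z, f z := by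
  have h1 : MeasurePreserving (timeReversal : Spacetime → Spacetime) :=
    (Measure.measurePreserving_neg (volume : Measure ℝ)).prod (MeasurePreserving.id volume)
  exact h1.integral_comp timeReversal.toHomeomorph.measurableEmbedding f

/-- The advanced solution of the Klein-Gordon equation with source `h`. -/
def advSol (m : ℝ) (h : Test Spacetime) (z : Spacetime) : ℂ :=
  retSol m (compTest timeReversal h) (timeReversal z)

theorem isAdvanced_advSol (m : ℝ) (h : Test Spacetime) : IsAdvanced m h (advSol m h) where
  smooth := (contDiff_retSol m _).comp timeReversal.contDiff
  solves z := by
    have := kgOp_comp_timeReversal m (contDiff_retSol m (compTest timeReversal h)) z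
    refine this.trans ?_
    rw [kgOp_retSol]
    change h (timeReversal (timeReversal z)) = h z
    rw [timeReversal_timeReversal]
  futureCompact p := by
    have h1 := (isRetarded_retSol m (compTest timeReversal h)).pastCompact (timeReversal p)
    have h2 := timeReversal.toHomeomorph.isCompact_preimage.2 h1
    convert h2 using 1
    rw [preimage_inter]
    congr 1
    · exact tsupport_comp_eq_preimage _ timeReversal.toHomeomorph
    · ext q
      change ‖q.2 - p.2‖ ≤ q.1 - p.1 ↔ ‖p.2 - q.2‖ ≤ -p.1 - -q.1
      rw [norm_sub_rev, show -p.1 - -q.1 = q.1 - p.1 by ring]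

/-- As sin(ωt)/ω is odd in t, the time-reversed retarded kernel equals the retarded kernel minus the
kernel with amplitude 1. The Heaviside functions drop out of the difference, and (1 - Δ)² removes
the regularising weight. -/
theorem advSol_sub_retSol (m : ℝ) (h : Test Spacetime) (z : Spacetime) :
    advSol m h z - retSol m h z =
      -∫ k, (((2 * Real.pi) ^ 3)⁻¹ : ℝ) * ∫ z', modeFn m 1 k z' * reflTest z h z' := by
  rw [← integral_propKernel_mul_helmTest m measurable_one (by simp), helmTest_reflTest,
    helmTest_reflTest]
  set q := reflTest z (helmTest (helmTest h)) with hq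
  have h1 : advSol m h z = ∫ z', propKernel m heaviside (timeReversal z') * q z' := by
    rw [advSol, retSol, convTest, helmTest_compTest_timeReversal, helmTest_compTest_timeReversal,
      ← integral_comp_timeReversal]
    congr 1; funext z'
    congr 1
    change helmTest (helmTest h) (timeReversal (timeReversal z - timeReversal z')) =
      helmTest (helmTest h) (z - z')
    rw [← map_sub, timeReversal_timeReversal]
  have h2 : ∀ z', propKernel m heaviside (timeReversal z') =
      propKernel m heaviside z' - propKernel m 1 z' := by
    intro z'
    have hint : ∀ b : ℝ → ℝ, Measurable b → (∀ τ, |b τ| ≤ 1) → Integrable fun k =>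
        (kernelWeight k : ℂ) * modeFn m b k z' := fun b hb hb1 =>
      (integrable_kernelWeight.mul_const |z'.1|).mono'
        ((measurable_kernelWeight_mul_modeFn m hb).comp
          (measurable_const.prodMk measurable_id)).aestronglyMeasurable
        (Filter.Eventually.of_forall fun k => norm_kernelWeight_mul_modeFn_le m hb1 k z')
    rw [propKernel, propKernel, propKernel, ← integral_sub
      (hint _ measurable_heaviside abs_heaviside_le) (hint _ measurable_one (by simp))]
    congr 1; funext k
    rw [← mul_sub]
    congr 1
    simp only [modeFn, timeReversal_apply, sinProp_neg, Pi.one_apply, ← sub_mul]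
    congr 1
    rw [← Complex.ofReal_sub]
    congr 1
    rcases lt_trichotomy z'.1 0 with h0 | h0 | h0
    · simp [heaviside, indicator, h0, not_lt.2 h0.le]
    · simp [h0, sinProp_zero]
    · simp [heaviside, indicator, h0, not_lt.2 h0.le]
  have i1 := LocallyIntegrable.integrable_mul_test (locallyIntegrable_propKernel_heaviside m) q
  have i2 := LocallyIntegrable.integrable_mul_test
    (locallyIntegrable_propKernel m (b := 1) measurable_one (by simp)) q
  have h3 : retSol m h z = ∫ z', propKernel m heaviside z' * q z' := rfl
  simp_rw [h1, h3, h2, sub_mul]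
  rw [integral_sub i1 i2]
  ring

end Advanced

end QEI

end

noncomputable section

namespace QEI

/-! ### Equality of the antisymmetric parts of the two-point functions -/

section Commutator

theorem exists_ftTest_minkowskiCovector_le (f : Test Spacetime) : ∃ C : ℝ, 0 ≤ C ∧
    ∀ p : Spacetime, (1 + |p.1|) ^ 4 * ‖ftTest volume f (minkowskiCovector p)‖ ≤ C := by
  obtain ⟨C, hC, h⟩ := exists_norm_ftTest_le (volume : Measure Spacetime) f 4
  refine ⟨C, hC, fun p => le_trans ?_ (h (minkowskiCovector p))⟩
  have h1 : |p.1| ≤ ‖minkowskiCovector p‖ := by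
    have := (minkowskiCovector p).le_opNorm eTime
    rw [norm_eTime, mul_one, minkowskiCovector_apply] at this
    simpa [eTime] using this
  gcongr

theorem norm_le_abs_energy (m : ℝ) (k : EuclideanSpace ℝ (Fin 3)) : ‖k‖ ≤ |energy m k| :=
  (norm_le_energy m k).trans (le_abs_self _)

/-- The Fourier transform of a test function decays rapidly along the mass shell. -/
theorem exists_shell_bound (m : ℝ) (f : Test Spacetime)
    {p : EuclideanSpace ℝ (Fin 3) → Spacetime} (hp : ∀ k, |(p k).1| = |energy m k|) :
    ∃ C : ℝ, 0 ≤ C ∧ ∀ k, (1 + ‖k‖) ^ 4 * ‖ftTest volume f (minkowskiCovector (p k))‖ ≤ C := by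
  obtain ⟨C, hC, h⟩ := exists_ftTest_minkowskiCovector_le f
  refine ⟨C, hC, fun k => le_trans ?_ (h (p k))⟩
  rw [hp]
  have := norm_le_abs_energy m k
  gcongr

theorem continuous_ftTest_shell (f : Test Spacetime)
    {p : EuclideanSpace ℝ (Fin 3) → Spacetime} (hp : Continuous p) :
    Continuous fun k => ftTest volume f (minkowskiCovector (p k)) :=
  (continuous_ftTest volume f).comp (continuous_minkowskiCovector.comp hp)

theorem integrable_shell_mul (m : ℝ) (f h : Test Spacetime)
    {p q : EuclideanSpace ℝ (Fin 3) → Spacetime} (hp : Continuous p) (hq : Continuous q)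
    (hq1 : ∀ k, |(q k).1| = |energy m k|) :
    Integrable fun k => (shellWeight m k : ℂ) * (ftTest volume f (minkowskiCovector (p k)) *
      ftTest volume h (minkowskiCovector (q k))) := by
  obtain ⟨C, hC, hb⟩ := exists_shell_bound m h hq1
  refine (integrable_shellWeight_mul m ((continuous_ftTest_shell f hp).mul
    (continuous_ftTest_shell h hq)) (C := (∫ x, ‖f x‖) * C) fun k => ?_).1
  rw [Pi.mul_apply, norm_mul]
  calc _ = ‖ftTest volume f (minkowskiCovector (p k))‖ *
        ((1 + ‖k‖) ^ 4 * ‖ftTest volume h (minkowskiCovector (q k))‖) := by ring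
    _ ≤ _ := mul_le_mul (norm_ftTest_le _ _ _) (hb k) (by positivity)
        (integral_nonneg fun _ => norm_nonneg _)

theorem continuous_energy_pair (m a b : ℝ) :
    Continuous fun k : EuclideanSpace ℝ (Fin 3) => ((a * energy m k, b • k) : Spacetime) :=
  (continuous_const.mul (continuous_energy m)).prodMk (continuous_const_smul b)

/-- The commutator function, mode by mode. -/
def commutatorMode (m : ℝ) (h : Test Spacetime) (z : Spacetime) (k : EuclideanSpace ℝ (Fin 3)) :
    ℂ :=
  (shellWeight m k : ℂ) *
    (planeWave (minkowskiCovector (-1 * energy m k, (-1 : ℝ) • k)) z *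
        ftTest volume h (minkowskiCovector (1 * energy m k, (1 : ℝ) • k)) -
      planeWave (minkowskiCovector (1 * energy m k, (-1 : ℝ) • k)) z *
        ftTest volume h (minkowskiCovector (-1 * energy m k, (1 : ℝ) • k)))

theorem energy_pos_of_ne_zero (m : ℝ) {k : EuclideanSpace ℝ (Fin 3)} (hk : k ≠ 0) :
    0 < energy m k :=
  lt_of_lt_of_le (norm_pos_iff.2 hk) (norm_le_energy m k)

/-- The sine splits into positive and negative frequency exponentials, which are the two orderings
in the vacuum. The condition k ≠ 0 excludes zero energy when m = 0 and costs only a null set. -/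
theorem commutatorMode_eq (m : ℝ) (h : Test Spacetime) (z : Spacetime)
    {k : EuclideanSpace ℝ (Fin 3)} (hk : k ≠ 0) :
    -Complex.I * ((((2 * Real.pi) ^ 3)⁻¹ : ℝ) * ∫ z', modeFn m 1 k z' * reflTest z h z') =
      commutatorMode m h z k := by
  have hω := energy_pos_of_ne_zero m hk
  set w := energy m k with hw
  have h1 : ∫ z', modeFn m 1 k z' * reflTest z h z' = ∫ z', modeFn m 1 k (z - z') * h z' := by
    rw [← integral_sub_left_eq_self _ volume z]
    congr 1; funext z'
    change _ * h (z - (z - z')) = _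
    rw [sub_sub_cancel]
  have h2 : ∀ z', modeFn m 1 k (z - z') * h z' = (2 * Complex.I * w)⁻¹ *
      (planeWave (minkowskiCovector (1 * w, (-1 : ℝ) • k)) z *
        (planeWave (minkowskiCovector (-1 * w, (1 : ℝ) • k)) z' * h z') -
      planeWave (minkowskiCovector (-1 * w, (-1 : ℝ) • k)) z *
        (planeWave (minkowskiCovector (1 * w, (1 : ℝ) • k)) z' * h z')) := by
    intro z'
    have hs : sinProp w (z - z').1 = Real.sin (w * (z - z').1) / w := by
      rw [← mul_sinProp, mul_div_cancel_left₀ _ hω.ne']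
    have hp : ∀ s : ℝ, planeWave (minkowskiCovector (s * w, (-1 : ℝ) • k)) z *
        planeWave (minkowskiCovector (-s * w, (1 : ℝ) • k)) z' =
        Complex.exp (s * (w * (z - z').1 : ℝ) * Complex.I) *
          Complex.exp (Complex.I * (inner ℝ k (z - z').2 : ℝ)) := by
      intro s
      rw [planeWave, planeWave, ← Complex.exp_add, ← Complex.exp_add]
      congr 1
      rw [minkowskiCovector_apply, minkowskiCovector_apply]
      simp only [Prod.fst_sub, Prod.snd_sub, inner_sub_right, inner_smul_left]
      push_cast
      simp
      ring
    have hp1 := hp 1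
    have hp2 := hp (-1)
    rw [neg_neg] at hp2
    have hsin : (Real.sin (w * (z - z').1) : ℂ) =
        (Complex.exp ((1 : ℝ) * (w * (z - z').1 : ℝ) * Complex.I) -
          Complex.exp ((-1 : ℝ) * (w * (z - z').1 : ℝ) * Complex.I)) / (2 * Complex.I) := by
      rw [Complex.ofReal_sin, Complex.sin]
      field_simp
      push_cast
      rw [Complex.I_sq]
      simp
    rw [modeFn, ← hw, hs]
    simp only [Pi.one_apply, one_mul]
    rw [Complex.ofReal_div, hsin]
    have hw0 : (w : ℂ) ≠ 0 := by exact_mod_cast hω.ne'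
    have hI := Complex.I_ne_zero
    simp only [one_mul] at hp1 hp2 ⊢
    rw [← mul_assoc, ← mul_assoc, hp1, hp2]
    field_simp
  have i1 := fun ξ => (integrable_planeWave_mul (volume : Measure Spacetime) h ξ)
  rw [h1]
  simp_rw [h2]
  rw [integral_const_mul, integral_sub ((i1 _).const_mul _) ((i1 _).const_mul _),
    integral_const_mul, integral_const_mul]
  change _ * (_ * (_ * (_ * ftTest volume h _ - _ * ftTest volume h _))) = _
  rw [commutatorMode, shellWeight, ← hw]
  have hw0 : (w : ℂ) ≠ 0 := by exact_mod_cast hω.ne'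
  have hpi : (Real.pi : ℂ) ≠ 0 := by exact_mod_cast Real.pi_pos.ne'
  have hI := Complex.I_ne_zero
  push_cast
  field_simp
  ring

theorem ae_ne_zero : ∀ᵐ k : EuclideanSpace ℝ (Fin 3), k ≠ 0 := by
  simp [ae_iff]

theorem I_mul_advSol_sub_retSol (m : ℝ) (h : Test Spacetime) (z : Spacetime) :
    Complex.I * (advSol m h z - retSol m h z) = ∫ k, commutatorMode m h z k := by
  rw [advSol_sub_retSol, ← neg_mul_comm, ← integral_const_mul]
  refine integral_congr_ae ?_
  filter_upwards [ae_ne_zero] with k hk using commutatorMode_eq m h z hk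

theorem measurable_commutatorMode (m : ℝ) (h : Test Spacetime) :
    Measurable fun p : Spacetime × EuclideanSpace ℝ (Fin 3) => commutatorMode m h p.1 p.2 := by
  have hc : ∀ a b : ℝ, Continuous fun p : Spacetime × EuclideanSpace ℝ (Fin 3) =>
      planeWave (minkowskiCovector (a * energy m p.2, b • p.2)) p.1 := fun a b => by
    have h1 : Continuous fun p : Spacetime × EuclideanSpace ℝ (Fin 3) =>
        minkowskiCovector (a * energy m p.2, b • p.2) :=
      continuous_minkowskiCovector.comp ((continuous_energy_pair m a b).comp continuous_snd)
    unfold planeWave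
    exact Complex.continuous_exp.comp (continuous_const.mul (Complex.continuous_ofReal.comp
      (h1.clm_apply continuous_fst)))
  have hf : ∀ a b : ℝ, Continuous fun p : Spacetime × EuclideanSpace ℝ (Fin 3) =>
      ftTest volume h (minkowskiCovector (a * energy m p.2, b • p.2)) := fun a b =>
    (continuous_ftTest_shell h (continuous_energy_pair m a b)).comp continuous_snd
  exact (Complex.measurable_ofReal.comp ((measurable_shellWeight m).comp measurable_snd)).mul
    (((hc _ _).mul (hf _ _)).sub ((hc _ _).mul (hf _ _))).measurable

theorem abs_one_mul_energy (m : ℝ) (k : EuclideanSpace ℝ (Fin 3)) :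
    |1 * energy m k| = |energy m k| := by rw [one_mul]

theorem abs_neg_one_mul_energy (m : ℝ) (k : EuclideanSpace ℝ (Fin 3)) :
    |-1 * energy m k| = |energy m k| := by rw [neg_one_mul, abs_neg]

theorem integrable_mul_commutatorMode (m : ℝ) (f h : Test Spacetime) :
    Integrable (Function.uncurry fun (z : Spacetime) (k : EuclideanSpace ℝ (Fin 3)) =>
      f z * commutatorMode m h z k) (volume.prod volume) := by
  obtain ⟨C, hC, hb⟩ := exists_shell_bound m h (p := fun k => (1 * energy m k, (1 : ℝ) • k))
    (abs_one_mul_energy m)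
  obtain ⟨C', hC', hb'⟩ := exists_shell_bound m h (p := fun k => (-1 * energy m k, (1 : ℝ) • k))
    (abs_neg_one_mul_energy m)
  refine ((integrable_test volume f).norm.mul_prod
    ((integrable_energy_inv m).const_mul (C + C'))).mono' ?_
    (Filter.Eventually.of_forall fun p => ?_)
  · exact ((f.continuous.measurable.comp measurable_fst).mul
      (measurable_commutatorMode m h)).aestronglyMeasurable
  · simp only [Function.uncurry]
    rw [norm_mul]
    refine mul_le_mul_of_nonneg_left ?_ (norm_nonneg _)
    rw [commutatorMode, norm_mul, Complex.norm_real, Real.norm_of_nonneg (shellWeight_nonneg _ _)]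
    have he := energy_nonneg m p.2
    have h4 : 0 < (1 + ‖p.2‖) ^ 4 := by positivity
    have h5 : ∀ ξ η : Spacetime →L[ℝ] ℝ, ∀ a b : ℂ,
        ‖planeWave ξ p.1 * a - planeWave η p.1 * b‖ ≤ ‖a‖ + ‖b‖ := by
      intro ξ η a b
      refine (norm_sub_le _ _).trans ?_
      rw [norm_mul, norm_mul, norm_planeWave, norm_planeWave, one_mul, one_mul]
    calc _ ≤ (energy m p.2)⁻¹ * ((C + C') * ((1 + ‖p.2‖) ^ 4)⁻¹) := by
          refine mul_le_mul (shellWeight_le _ _) ((h5 _ _ _ _).trans ?_) (norm_nonneg _)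
            (by positivity)
          rw [← div_eq_mul_inv, le_div_iff₀ h4]
          linarith [hb p.2, hb' p.2]
      _ = _ := by ring

/-- Both terms are written over the same spatial momentum by k ↦ -k in the exchanged one. Their
difference is then the smeared commutator mode, and Fubini exchanges the spacetime and momentum
integrals. -/
theorem vacuumTwoPoint_sub_swap (m : ℝ) (f h : Test Spacetime) :
    vacuumTwoPoint m f h - vacuumTwoPoint m h f =
      Complex.I * ∫ z, f z * (advSol m h z - retSol m h z) := by
  have h1 : Complex.I * ∫ z, f z * (advSol m h z - retSol m h z) =
      ∫ z, ∫ k, f z * commutatorMode m h z k := by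
    rw [← integral_const_mul]
    congr 1; funext z
    rw [integral_const_mul, ← I_mul_advSol_sub_retSol]; ring
  let A : EuclideanSpace ℝ (Fin 3) → ℂ := fun k => (shellWeight m k : ℂ) *
    (ftTest volume f (minkowskiCovector (1 * energy m k, (-1 : ℝ) • k)) *
      ftTest volume h (minkowskiCovector (-1 * energy m k, (1 : ℝ) • k)))
  let B : EuclideanSpace ℝ (Fin 3) → ℂ := fun k => (shellWeight m k : ℂ) *
    (ftTest volume f (minkowskiCovector (-1 * energy m k, (-1 : ℝ) • k)) *
      ftTest volume h (minkowskiCovector (1 * energy m k, (1 : ℝ) • k)))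
  have h2 : ∀ k, ∫ z, f z * commutatorMode m h z k = B k - A k := by
    intro k
    have i1 := fun ξ => integrable_planeWave_mul (volume : Measure Spacetime) f ξ
    have e : ∀ z, f z * commutatorMode m h z k = (shellWeight m k : ℂ) *
        (ftTest volume h (minkowskiCovector (1 * energy m k, (1 : ℝ) • k)) *
          (planeWave (minkowskiCovector (-1 * energy m k, (-1 : ℝ) • k)) z * f z) -
        ftTest volume h (minkowskiCovector (-1 * energy m k, (1 : ℝ) • k)) *
          (planeWave (minkowskiCovector (1 * energy m k, (-1 : ℝ) • k)) z * f z)) := by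
      intro z; rw [commutatorMode]; ring
    simp_rw [e]
    rw [integral_const_mul, integral_sub ((i1 _).const_mul _) ((i1 _).const_mul _),
      integral_const_mul, integral_const_mul]
    change _ * (_ * ftTest volume f _ - _ * ftTest volume f _) = _
    simp only [A, B]; ring
  have hA : Integrable A := integrable_shell_mul m f h (continuous_energy_pair m _ _)
    (continuous_energy_pair m _ _) (abs_neg_one_mul_energy m)
  have hB : Integrable B := integrable_shell_mul m f h (continuous_energy_pair m _ _)
    (continuous_energy_pair m _ _) (abs_one_mul_energy m)
  have h3 : vacuumTwoPoint m f h = ∫ k, B k := by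
    rw [vacuumTwoPoint]
    congr 1; funext k
    rw [minkowskiFourier_eq, minkowskiFourier_eq]
    simp [B, shellWeight]
  have h4 : vacuumTwoPoint m h f = ∫ k, A k := by
    rw [vacuumTwoPoint, ← integral_neg_eq_self]
    congr 1; funext k
    rw [minkowskiFourier_eq, minkowskiFourier_eq, energy_neg]
    simp only [A, shellWeight, one_mul, neg_one_mul, one_smul, neg_one_smul, Prod.neg_mk, neg_neg]
    ring
  rw [h1, integral_integral_swap (integrable_mul_commutatorMode m f h)]
  simp_rw [h2]
  rw [integral_sub hB hA, h3, h4]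

/-- The commutation relation is available only for given retarded and advanced solutions; the
constructed ones make it apply to every pair. -/
theorem FieldState.twoPoint_sub_swap {m : ℝ} (σ : FieldState m) (f h : Test Spacetime) :
    σ.twoPoint f h - σ.twoPoint h f = Complex.I * ∫ z, f z * (advSol m h z - retSol m h z) := by
  rw [twoPoint, twoPoint, ← map_sub, field_commutator m f h _ _ (isRetarded_retSol m h)
    (isAdvanced_advSol m h), Algebra.algebraMap_eq_smul_one, map_smul, σ.normalized, smul_eq_mul,
    mul_one]

/-- Polarisation: the value on (1 + ca)*(1 + ca) is real, and comparing c = 1 with c = i determines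
the real and imaginary parts. -/
theorem FieldState.ev_star {m : ℝ} (σ : FieldState m) (a : FieldAlgebra m) :
    σ.ev (star a) = (starRingEnd ℂ) (σ.ev a) := by
  have key : ∀ c : ℂ, (c * σ.ev a + (starRingEnd ℂ) c * σ.ev (star a)).im = 0 := by
    intro c
    have h1 := σ.positive_im (1 + c • a)
    have h2 := σ.positive_im (c • a)
    have h3 : star (1 + c • a) * (1 + c • a) =
        1 + (c • a + (starRingEnd ℂ) c • star a) + star (c • a) * (c • a) := by
      have : star (c • a) = (starRingEnd ℂ) c • star a := star_smul c a
      rw [star_add, star_one, add_mul, mul_add, mul_add, one_mul, one_mul, mul_one, this]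
      abel
    rw [h3, map_add, map_add, map_add, map_smul, map_smul, σ.normalized, Complex.add_im,
      Complex.add_im, h2] at h1
    simpa using h1
  have h1 := key 1
  have h2 := key Complex.I
  simp at h1 h2
  apply Complex.ext
  · rw [Complex.conj_re]; linarith
  · rw [Complex.conj_im]; linarith

theorem FieldState.twoPoint_conj {m : ℝ} (σ : FieldState m) (f h : Test Spacetime) :
    σ.twoPoint (conjTest f) (conjTest h) = (starRingEnd ℂ) (σ.twoPoint h f) := by
  rw [twoPoint, twoPoint, ← σ.ev_star, star_mul, star_field, star_field]

theorem ftTest_conjTest {E : Type} [NormedAddCommGroup E] [NormedSpace ℝ E]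
    [MeasurableSpace E] (μ : Measure E) (f : Test E) (ξ : E →L[ℝ] ℝ) :
    ftTest μ (conjTest f) ξ = (starRingEnd ℂ) (ftTest μ f (-ξ)) := by
  rw [ftTest, ftTest, ← integral_conj]
  congr 1; funext z
  change _ * (starRingEnd ℂ) (f z) = _
  rw [map_mul, planeWave, planeWave, ← Complex.exp_conj]
  simp

theorem vacuumTwoPoint_conj (m : ℝ) (f h : Test Spacetime) :
    vacuumTwoPoint m (conjTest f) (conjTest h) = (starRingEnd ℂ) (vacuumTwoPoint m h f) := by
  rw [vacuumTwoPoint, vacuumTwoPoint, ← integral_conj]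
  congr 1; funext k
  simp only [minkowskiFourier_eq, ftTest_conjTest, map_mul, Complex.conj_ofReal,
    ← minkowskiCovector_neg, neg_neg]
  ring

end Commutator

/-! ### Existence of the smooth normal ordered two-point function -/

section NormalOrdering

/-- The pullback along the exchange of the two arguments. -/
def swapTest (φ : Test (Spacetime × Spacetime)) : Test (Spacetime × Spacetime) :=
  compTest (ContinuousLinearEquiv.prodComm ℝ Spacetime Spacetime) φ

theorem swapTest_apply (φ : Test (Spacetime × Spacetime)) (z : Spacetime × Spacetime) :
    swapTest φ z = φ z.swap := rfl

/-- The functional `φ ↦ T (φ ∘ swap)`. -/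
def swapFunctional (T : Test (Spacetime × Spacetime) →ₗ[ℂ] ℂ) :
    Test (Spacetime × Spacetime) →ₗ[ℂ] ℂ where
  toFun φ := T (swapTest φ)
  map_add' φ ψ := by rw [← map_add]; rfl
  map_smul' c φ := by rw [← map_smul]; rfl

/-- The functional `φ ↦ conj (T (conj φ))`. -/
def conjFunctional (T : Test (Spacetime × Spacetime) →ₗ[ℂ] ℂ) :
    Test (Spacetime × Spacetime) →ₗ[ℂ] ℂ where
  toFun φ := (starRingEnd ℂ) (T (conjTest φ))
  map_add' φ ψ := by
    have : conjTest (φ + ψ) = conjTest φ + conjTest ψ := by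
      ext z; exact map_add (starRingEnd ℂ) (φ z) (ψ z)
    rw [this, map_add, map_add]
  map_smul' c φ := by
    have : conjTest (c • φ) = (starRingEnd ℂ) c • conjTest φ := by
      ext z; exact map_mul (starRingEnd ℂ) c (φ z)
    rw [this, map_smul, smul_eq_mul, map_mul, Complex.conj_conj]; rfl

theorem HasLocalOrder.swapFunctional {T : Test (Spacetime × Spacetime) →ₗ[ℂ] ℂ}
    (hT : HasLocalOrder T) : HasLocalOrder (swapFunctional T) := by
  intro K hK
  obtain ⟨N, C, hC, h⟩ := hT (Prod.swap '' K) (hK.image continuous_swap)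
  refine ⟨N, C, hC, fun φ hφ B hB => h _ (fun x hx => ?_) B fun i hi x => ?_⟩
  · rw [swapTest_apply]
    exact hφ _ fun hc => hx ⟨_, hc, Prod.swap_swap x⟩
  · have h1 := (LinearIsometryEquiv.prodComm ℝ Spacetime Spacetime).norm_iteratedFDeriv_comp_right
      (𝕜 := ℝ) φ x i
    exact h1.le.trans (hB i hi _)

theorem HasLocalOrder.conjFunctional {T : Test (Spacetime × Spacetime) →ₗ[ℂ] ℂ}
    (hT : HasLocalOrder T) : HasLocalOrder (conjFunctional T) := by
  intro K hK
  obtain ⟨N, C, hC, h⟩ := hT K hK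
  refine ⟨N, C, hC, fun φ hφ B hB => ?_⟩
  have h2 : ‖QEI.conjFunctional T φ‖ = ‖T (conjTest φ)‖ := RCLike.norm_conj _
  rw [h2]
  refine h _ (fun x hx => ?_) B fun i hi x => ?_
  · change (starRingEnd ℂ) (φ x) = 0
    rw [hφ x hx, map_zero]
  · have h1 := Complex.conjLIE.norm_iteratedFDeriv_comp_left (𝕜 := ℝ) φ x i
    exact h1.le.trans (hB i hi _)

theorem DecaysOn.sub {E : Type} [NormedAddCommGroup E] [NormedSpace ℝ E]
    {T S : Test E →ₗ[ℂ] ℂ} {χ : Test E} {V : Set (E →L[ℝ] ℝ)}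
    (hT : DecaysOn T χ V) (hS : DecaysOn S χ V) : DecaysOn (T - S) χ V := by
  intro N
  obtain ⟨C, hC⟩ := hT N
  obtain ⟨C', hC'⟩ := hS N
  refine ⟨C + C', fun η hη r hr => ?_⟩
  calc _ ≤ r ^ N * (‖T (modulate χ (r • η))‖ + ‖S (modulate χ (r • η))‖) := by
        gcongr; exact norm_sub_le _ _
    _ ≤ _ := by rw [mul_add]; exact add_le_add (hC η hη r hr) (hC' η hη r hr)

/-- The difference T is symmetric because both commutators agree, and real because both two-point
functions are hermitian. Symmetry also transports decay from one half of the covectors to the other,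
so no singular direction survives. -/
theorem FieldState.IsHadamard.exists_normalOrdered {m : ℝ} {σ : FieldState m}
    (hσ : σ.IsHadamard) : ∃ W : Spacetime × Spacetime → ℝ, IsNormalOrderedTwoPoint σ W := by
  obtain ⟨u, hu, hWF⟩ := hσ
  set T := u.toLinearMap - vacuumFunctional m with hTdef
  have hT : HasLocalOrder T := (hasLocalOrder_of_continuous u).sub (hasLocalOrder_vacuumFunctional m)
  have hTt : ∀ f h, T (tensorTest f h) = σ.twoPoint f h - vacuumTwoPoint m f h := by
    intro f h
    rw [hTdef, LinearMap.sub_apply, vacuumFunctional_tensorTest, ← hu]; rfl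
  have hsymm0 : ∀ f h, T (tensorTest h f) = T (tensorTest f h) := by
    intro f h
    rw [hTt, hTt]
    linear_combination vacuumTwoPoint_sub_swap m f h - σ.twoPoint_sub_swap f h
  have hsymm : swapFunctional T = T := by
    refine hT.swapFunctional.ext_tensorTest hT fun f h => ?_
    rw [← hsymm0]
    change T _ = T _
    congr 1
    ext z
    exact mul_comm _ _
  have hconj : conjFunctional T = T := by
    refine hT.conjFunctional.ext_tensorTest hT fun f h => ?_
    have h1 : conjTest (tensorTest f h) = tensorTest (conjTest f) (conjTest h) := by
      ext z; exact map_mul (starRingEnd ℂ) (f z.1) (h z.2)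
    change (starRingEnd ℂ) (T (conjTest (tensorTest f h))) = _
    rw [h1, ← hsymm0, hTt, hTt, σ.twoPoint_conj, vacuumTwoPoint_conj, map_sub, Complex.conj_conj,
      Complex.conj_conj]
  -- These covectors lie outside 𝒩⁺ × 𝒩⁻, so ω₂ is regular there. The vacuum decays there as well,
  -- for any cut-off, so the cut-off supplied by ω₂ serves both.
  have hA : ∀ z, ∀ ξ : Spacetime × Spacetime →L[ℝ] ℝ, ξ ≠ 0 →
      (ξ (eTime, 0) ≤ 0 ∨ 0 ≤ ξ (0, eTime)) →
      ∃ χ : Test (Spacetime × Spacetime), χ z ≠ 0 ∧ ∃ δ > 0, DecaysOn T χ (Metric.ball ξ δ) := by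
    intro z ξ hξ h
    have hreg : IsRegularDirection u z ξ := by
      by_contra hc
      obtain ⟨h1, h2⟩ := hWF (z, ξ) ⟨hξ, hc⟩
      have h1 : 0 < ξ (eTime, 0) := h1.2
      have h2 : ξ (0, eTime) < 0 := h2.2
      rcases h with h | h <;> linarith
    obtain ⟨χ, hχ, δ, hδ, hdec⟩ := hreg.exists_decaysOn hξ
    have hn := norm_pos_iff.2 hξ
    refine ⟨χ, hχ, min δ (‖ξ‖ / 32), by positivity, DecaysOn.sub
      (hdec.mono (Metric.ball_subset_ball (min_le_left _ _)))
      ((vacuumFunctional_decaysOn m hξ h χ).mono (Metric.ball_subset_ball (min_le_right _ _)))⟩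
  let sw : Spacetime × Spacetime →L[ℝ] Spacetime × Spacetime :=
    (ContinuousLinearEquiv.prodComm ℝ Spacetime Spacetime : _ →L[ℝ] _)
  have hsw : ‖sw‖ ≤ 1 := by
    refine ContinuousLinearMap.opNorm_le_bound _ zero_le_one fun x => ?_
    rw [one_mul]
    exact ((LinearIsometryEquiv.prodComm ℝ Spacetime Spacetime).norm_map x).le
  have hloc : ∀ z, ∀ ξ : Spacetime × Spacetime →L[ℝ] ℝ, ξ ≠ 0 →
      ∃ χ : Test (Spacetime × Spacetime), χ z ≠ 0 ∧ ∃ δ > 0, DecaysOn T χ (Metric.ball ξ δ) := by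
    intro z ξ hξ
    by_cases h : ξ (eTime, 0) ≤ 0 ∨ 0 ≤ ξ (0, eTime)
    · exact hA z ξ hξ h
    -- Here the first time component is positive and the second negative. Exchanging the arguments
    -- makes the first one negative, where `hA` applies, and T is invariant under the exchange.
    · push Not at h
      have hξ' : ξ.comp sw ≠ 0 := by
        intro hc
        have : ξ.comp sw (0, eTime) = ξ (eTime, 0) := rfl
        rw [hc] at this
        simp at this
        linarith [h.1]
      obtain ⟨χ, hχ, δ, hδ, hdec⟩ := hA z.swap (ξ.comp sw) hξ' (Or.inl h.2.le)
      refine ⟨swapTest χ, hχ, δ, hδ, fun N => ?_⟩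
      obtain ⟨C, hC⟩ := hdec N
      refine ⟨C, fun η hη r hr => ?_⟩
      have h1 : T (modulate (swapTest χ) (r • η)) = T (modulate χ (r • η.comp sw)) := by
        conv_rhs => rw [← hsymm]
        rfl
      rw [h1]
      refine hC _ ?_ r hr
      rw [Metric.mem_ball, dist_eq_norm] at hη ⊢
      rw [← ContinuousLinearMap.sub_comp]
      calc _ ≤ ‖η - ξ‖ * ‖sw‖ := ContinuousLinearMap.opNorm_comp_le _ _
        _ ≤ ‖η - ξ‖ * 1 := by gcongr
        _ < δ := by rwa [mul_one]
  obtain ⟨w, hw, hTw⟩ := exists_smooth_density volume hT hloc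
  -- By `hconj` the conjugate of w is a density of the same functional, and continuous densities are
  -- unique.
  have hreal : (fun z => (starRingEnd ℂ) (w z)) = w := by
    refine eq_of_integral_test_mul_eq volume (Complex.continuous_conj.comp hw.continuous)
      hw.continuous fun f => ?_
    rw [← hTw, ← hconj]
    change _ = (starRingEnd ℂ) (T (conjTest f))
    rw [hTw, ← integral_conj]
    congr 1; funext z
    change _ = (starRingEnd ℂ) ((starRingEnd ℂ) (f z) * w z)
    rw [map_mul, Complex.conj_conj]
  refine ⟨fun z => (w z).re, Complex.reCLM.contDiff.comp hw, fun f h => ?_⟩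
  rw [← hTt, hTw]
  congr 1; funext z
  rw [Complex.conj_eq_iff_re.1 (congr_fun hreal z)]
  rfl

end NormalOrdering

end QEI

end

noncomputable section

namespace QEI

/-! ### Positivity of the state and the smeared point-split energy density -/

section Positivity

/-- The four-momentum `(ω(𝐤), 𝐤)` as a covector. -/
def shellMomentum (m : ℝ) (k : EuclideanSpace ℝ (Fin 3)) : Spacetime →L[ℝ] ℝ :=
  minkowskiCovector (energy m k, k)

theorem vacuumTwoPoint_conj_self_integrand (m : ℝ) (f : Test Spacetime)
    (k : EuclideanSpace ℝ (Fin 3)) :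
    (shellWeight m k : ℂ) * (ftTest volume (conjTest f) (minkowskiCovector (-(energy m k, k))) *
      ftTest volume f (minkowskiCovector (energy m k, k))) =
      ((shellWeight m k * ‖ftTest volume f (shellMomentum m k)‖ ^ 2 : ℝ) : ℂ) := by
  rw [ftTest_conjTest, ← minkowskiCovector_neg, neg_neg, ← Complex.normSq_eq_conj_mul_self,
    Complex.normSq_eq_norm_sq, ← Complex.ofReal_mul]
  rfl

theorem integrable_shellWeight_norm_sq (m : ℝ) (f : Test Spacetime) :
    Integrable fun k => shellWeight m k * ‖ftTest volume f (shellMomentum m k)‖ ^ 2 := by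
  have hc : Continuous fun k : EuclideanSpace ℝ (Fin 3) => ((energy m k, k) : Spacetime) :=
    (continuous_energy m).prodMk continuous_id
  have h := (integrable_shell_mul m (conjTest f) f hc.neg hc fun k => rfl).re
  refine h.congr (Filter.Eventually.of_forall fun k => ?_)
  have := vacuumTwoPoint_conj_self_integrand m f k
  simp only [Pi.neg_apply] at this ⊢
  change RCLike.re (K := ℂ) (_ * _) = _
  rw [this]; rfl

theorem vacuumTwoPoint_conj_self (m : ℝ) (f : Test Spacetime) :
    vacuumTwoPoint m (conjTest f) f =
      ((∫ k, shellWeight m k * ‖ftTest volume f (shellMomentum m k)‖ ^ 2 : ℝ) : ℂ) := by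
  rw [vacuumTwoPoint, ← integral_complex_ofReal]
  congr 1; funext k
  rw [← vacuumTwoPoint_conj_self_integrand, minkowskiFourier_eq, minkowskiFourier_eq]
  rfl

/-- Positivity of the state on Φ(f)*Φ(f), with the vacuum part evaluated as an integral over the
mass shell. -/
theorem IsNormalOrderedTwoPoint.positivity {m : ℝ} {σ : FieldState m}
    {W : Spacetime × Spacetime → ℝ} (hW : IsNormalOrderedTwoPoint σ W) (f : Test Spacetime) :
    0 ≤ (∫ k, shellWeight m k * ‖ftTest volume f (shellMomentum m k)‖ ^ 2) +
      (∫ z, tensorTest (conjTest f) f z * (W z : ℂ)).re := by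
  have h1 := σ.positive_re (field m f)
  rw [star_field] at h1
  have h2 := hW.2 (conjTest f) f
  rw [vacuumTwoPoint_conj_self] at h2
  have h3 : σ.ev (field m (conjTest f) * field m f) = ((∫ k, shellWeight m k *
      ‖ftTest volume f (shellMomentum m k)‖ ^ 2 : ℝ) : ℂ) +
      ∫ z, tensorTest (conjTest f) f z * (W z : ℂ) := eq_add_of_sub_eq' h2
  rw [h3, Complex.add_re, Complex.ofReal_re] at h1
  exact h1

theorem pdTest_tensorTest_left (v : Spacetime) (f h : Test Spacetime) :
    pdTest (v, (0 : Spacetime)) (tensorTest f h) = tensorTest (pdTest v f) h := by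
  ext z
  have h1 : HasFDerivAt (fun z : Spacetime × Spacetime => f z.1 * h z.2) _ z :=
    (((f.contDiff.differentiable (by simp) z.1).hasFDerivAt).comp z hasFDerivAt_fst).mul
      (((h.contDiff.differentiable (by simp) z.2).hasFDerivAt).comp z hasFDerivAt_snd)
  change fderiv ℝ (fun z : Spacetime × Spacetime => f z.1 * h z.2) z _ = fderiv ℝ f z.1 v * h z.2
  rw [h1.fderiv]
  simp [mul_comm]

theorem pdTest_tensorTest_right (v : Spacetime) (f h : Test Spacetime) :
    pdTest ((0 : Spacetime), v) (tensorTest f h) = tensorTest f (pdTest v h) := by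
  ext z
  have h1 : HasFDerivAt (fun z : Spacetime × Spacetime => f z.1 * h z.2) _ z :=
    (((f.contDiff.differentiable (by simp) z.1).hasFDerivAt).comp z hasFDerivAt_fst).mul
      (((h.contDiff.differentiable (by simp) z.2).hasFDerivAt).comp z hasFDerivAt_snd)
  change fderiv ℝ (fun z : Spacetime × Spacetime => f z.1 * h z.2) z _ = f z.1 * fderiv ℝ h z.2 v
  rw [h1.fderiv]
  simp

theorem conjTest_pdTest (v : Spacetime) (f : Test Spacetime) :
    conjTest (pdTest v f) = pdTest v (conjTest f) := by
  ext z
  exact (congr_fun (pd_conj v f) z).symm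

theorem pd_ofReal {E : Type} [NormedAddCommGroup E] [NormedSpace ℝ E] {W : E → ℝ}
    (hW : ContDiff ℝ ∞ W) (v : E) :
    pd v (fun z => (W z : ℂ)) = fun z => ((pd v W z : ℝ) : ℂ) := by
  funext z
  have h1 : HasFDerivAt (fun z => (W z : ℂ)) (Complex.ofRealCLM.comp (fderiv ℝ W z)) z :=
    Complex.ofRealCLM.hasFDerivAt.comp z (hW.differentiable (by simp) z).hasFDerivAt
  rw [pd, h1.fderiv]; rfl

theorem integral_tensorTest_pdTest (v : Spacetime) (q : Test Spacetime)
    {W : Spacetime × Spacetime → ℝ} (hW : ContDiff ℝ ∞ W) :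
    ∫ z, tensorTest (conjTest (pdTest v q)) (pdTest v q) z * (W z : ℂ) =
      ∫ z, tensorTest (conjTest q) q z *
        ((pd (v, (0 : Spacetime)) (pd ((0 : Spacetime), v) W) z : ℝ) : ℂ) := by
  have hWc : ContDiff ℝ ∞ fun z => (W z : ℂ) := Complex.ofRealCLM.contDiff.comp hW
  have key : ∀ (u : Spacetime × Spacetime) (φ : Test (Spacetime × Spacetime))
      (g : Spacetime × Spacetime → ℂ), ContDiff ℝ ∞ g →
      ∫ z, pdTest u φ z * g z = -∫ z, φ z * pd u g z := fun u φ g hg =>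
    integral_pd_mul u φ.contDiff φ.hasCompactSupport hg
  rw [conjTest_pdTest, ← pdTest_tensorTest_left, key _ _ _ hWc, ← pdTest_tensorTest_right,
    key _ _ _ (contDiff_pd _ hWc), neg_neg, pd_comm hWc, pd_ofReal hW, pd_ofReal (contDiff_pd _ hW)]

theorem norm_ftTest_pdTest_sq (v : Spacetime) (q : Test Spacetime) (ξ : Spacetime →L[ℝ] ℝ) :
    ‖ftTest volume (pdTest v q) ξ‖ ^ 2 = ξ v ^ 2 * ‖ftTest volume q ξ‖ ^ 2 := by
  rw [ftTest_pdTest]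
  simp [mul_pow]

/-- The point-split energy density `½ ∑_μ ∂_μ ∂'_μ W + ½ m² W`. -/
def splitEnergy (m : ℝ) (W : Spacetime × Spacetime → ℝ) (z : Spacetime × Spacetime) : ℝ :=
  (pd (eTime, (0 : Spacetime)) (pd ((0 : Spacetime), eTime) W) z +
    ∑ i, pd (eSpace i, (0 : Spacetime)) (pd ((0 : Spacetime), eSpace i) W) z) / 2 + m ^ 2 * W z / 2

theorem contDiff_splitEnergy (m : ℝ) {W : Spacetime × Spacetime → ℝ} (hW : ContDiff ℝ ∞ W) :
    ContDiff ℝ ∞ (splitEnergy m W) :=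
  (((contDiff_pd _ (contDiff_pd _ hW)).add (ContDiff.sum fun _ _ =>
    contDiff_pd _ (contDiff_pd _ hW))).div_const 2).add ((contDiff_const.mul hW).div_const 2)

theorem integrable_test_mul_ofReal (φ : Test (Spacetime × Spacetime))
    {F : Spacetime × Spacetime → ℝ} (hF : Continuous F) : Integrable fun z => φ z * (F z : ℂ) :=
  integrable_test_mul volume φ (Complex.continuous_ofReal.comp hF)

/-- Positivity is used for the four derivatives of q and, with weight m², for q itself. Integration
by parts moves the derivatives to W; on the vacuum side the squared momenta add up to ω² + ‖k‖² + m²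
= 2ω². -/
theorem IsNormalOrderedTwoPoint.splitEnergy_positivity {m : ℝ} {σ : FieldState m}
    {W : Spacetime × Spacetime → ℝ} (hW : IsNormalOrderedTwoPoint σ W) (q : Test Spacetime) :
    0 ≤ (∫ k, shellWeight m k * energy m k ^ 2 * ‖ftTest volume q (shellMomentum m k)‖ ^ 2) +
      (∫ z, tensorTest (conjTest q) q z * (splitEnergy m W z : ℂ)).re := by
  let V : Test Spacetime → ℝ := fun f =>
    ∫ k, shellWeight m k * ‖ftTest volume f (shellMomentum m k)‖ ^ 2
  let S : (Spacetime × Spacetime → ℝ) → ℂ := fun F => ∫ z, tensorTest (conjTest q) q z * (F z : ℂ)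
  let P : Spacetime → Spacetime × Spacetime → ℝ := fun v =>
    pd (v, (0 : Spacetime)) (pd ((0 : Spacetime), v) W)
  have hP : ∀ v, Continuous (P v) := fun v =>
    (contDiff_pd _ (contDiff_pd _ hW.1)).continuous
  have h1 : ∀ v, 0 ≤ V (pdTest v q) + (S (P v)).re := by
    intro v
    have := hW.positivity (pdTest v q)
    rwa [integral_tensorTest_pdTest v q hW.1] at this
  have h2 : 0 ≤ V q + (S W).re := hW.positivity q
  have hi := fun v => integrable_test_mul_ofReal (tensorTest (conjTest q) q) (hP v)
  have hS : S (splitEnergy m W) = (S (P eTime) + ∑ i, S (P (eSpace i))) / 2 + m ^ 2 * S W / 2 := by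
    have i1 := integrable_test_mul_ofReal (tensorTest (conjTest q) q) hW.1.continuous
    have e : ∀ z, tensorTest (conjTest q) q z * (splitEnergy m W z : ℂ) =
        (tensorTest (conjTest q) q z * (P eTime z : ℂ) +
          ∑ i, tensorTest (conjTest q) q z * (P (eSpace i) z : ℂ)) / 2 +
        (m : ℂ) ^ 2 / 2 * (tensorTest (conjTest q) q z * (W z : ℂ)) := by
      intro z
      simp only [splitEnergy, P, ← Finset.mul_sum]
      push_cast; ring
    have i3 : Integrable fun z => ∑ i, tensorTest (conjTest q) q z * (P (eSpace i) z : ℂ) :=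
      integrable_finsetSum Finset.univ fun i _ => hi (eSpace i)
    have i2 : Integrable fun z => tensorTest (conjTest q) q z * (P eTime z : ℂ) +
        ∑ i, tensorTest (conjTest q) q z * (P (eSpace i) z : ℂ) := (hi eTime).add i3
    simp only [S]
    simp_rw [e]
    rw [integral_add (i2.div_const 2) (i1.const_mul _), integral_const_mul, integral_div,
      integral_add (hi eTime) i3, integral_finsetSum Finset.univ fun i _ => hi (eSpace i)]
    ring
  have hV : ∫ k, shellWeight m k * energy m k ^ 2 * ‖ftTest volume q (shellMomentum m k)‖ ^ 2 =
      (V (pdTest eTime q) + ∑ i, V (pdTest (eSpace i) q)) / 2 + m ^ 2 * V q / 2 := by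
    have j := fun f => integrable_shellWeight_norm_sq m f
    have e : ∀ k, shellWeight m k * energy m k ^ 2 * ‖ftTest volume q (shellMomentum m k)‖ ^ 2 =
        (shellWeight m k * ‖ftTest volume (pdTest eTime q) (shellMomentum m k)‖ ^ 2 +
          ∑ i, shellWeight m k * ‖ftTest volume (pdTest (eSpace i) q) (shellMomentum m k)‖ ^ 2) / 2 +
        m ^ 2 / 2 * (shellWeight m k * ‖ftTest volume q (shellMomentum m k)‖ ^ 2) := by
      intro k
      simp_rw [norm_ftTest_pdTest_sq]
      have a : shellMomentum m k eTime = energy m k := by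
        rw [shellMomentum, minkowskiCovector_apply]; simp [eTime]
      have b : ∀ i, shellMomentum m k (eSpace i) = -k i := fun i => by
        rw [shellMomentum, minkowskiCovector_apply]
        simp [eSpace, EuclideanSpace.inner_single_right]
      have c := energy_sq m k
      rw [EuclideanSpace.real_norm_sq_eq] at c
      rw [a]
      simp only [b, Fin.sum_univ_three] at c ⊢
      linear_combination (shellWeight m k * ‖ftTest volume q (shellMomentum m k)‖ ^ 2) / 2 * c
    have i3 : Integrable fun k =>
        ∑ i, shellWeight m k * ‖ftTest volume (pdTest (eSpace i) q) (shellMomentum m k)‖ ^ 2 :=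
      integrable_finsetSum Finset.univ fun i _ => j (pdTest (eSpace i) q)
    have i2 : Integrable fun k =>
        shellWeight m k * ‖ftTest volume (pdTest eTime q) (shellMomentum m k)‖ ^ 2 +
        ∑ i, shellWeight m k * ‖ftTest volume (pdTest (eSpace i) q) (shellMomentum m k)‖ ^ 2 :=
      (j (pdTest eTime q)).add i3
    simp_rw [e]
    rw [integral_add (i2.div_const 2) ((j q).const_mul _), integral_const_mul, integral_div,
      integral_add (j _) i3, integral_finsetSum Finset.univ fun i _ => j (pdTest (eSpace i) q)]
    simp only [V]
    ring
  have h3 := h1 eTime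
  have h4 := fun i => h1 (eSpace i)
  have h5 : (S (splitEnergy m W)).re =
      ((S (P eTime)).re + ∑ i, (S (P (eSpace i))).re) / 2 + m ^ 2 * (S W).re / 2 := by
    rw [hS]
    have : (m : ℂ) ^ 2 * S W / 2 = ((m ^ 2 / 2 : ℝ) : ℂ) * S W := by push_cast; ring
    rw [Complex.add_re, this, Complex.re_ofReal_mul]
    simp [Complex.re_sum]
    ring
  change 0 ≤ _ + (S (splitEnergy m W)).re
  rw [hV, h5]
  have h6 : 0 ≤ ∑ i, (V (pdTest (eSpace i) q) + (S (P (eSpace i))).re) :=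
    Finset.sum_nonneg fun i _ => h4 i
  rw [Finset.sum_add_distrib] at h6
  have h7 : 0 ≤ m ^ 2 * (V q + (S W).re) := mul_nonneg (sq_nonneg m) h2
  linarith

end Positivity

/-! ### Restriction to a worldline -/

section Localization

/-- The test function `(t, 𝐱) ↦ a t * b 𝐱`. -/
def splitTest (a : Test ℝ) (b : Test (EuclideanSpace ℝ (Fin 3))) : Test Spacetime :=
  ⟨fun z => a z.1 * b z.2, (a.contDiff.comp contDiff_fst).mul (b.contDiff.comp contDiff_snd),
    HasCompactSupport.intro (a.hasCompactSupport.prod b.hasCompactSupport) (by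
      intro z hz
      by_contra hne
      exact hz ⟨subset_tsupport _ (left_ne_zero_of_mul hne),
        subset_tsupport _ (right_ne_zero_of_mul hne)⟩),
    fun _ _ => trivial⟩

/-- Multiplication by `u`, as a covector on the time axis. -/
def timeCovector (u : ℝ) : ℝ →L[ℝ] ℝ := u • ContinuousLinearMap.id ℝ ℝ

/-- The transform factorises and the spatial factor is bounded by the L¹ norm of b. A profile of
unit mass thus gives a bound that does not deteriorate as it concentrates. -/
theorem norm_ftTest_splitTest_le (m : ℝ) (a : Test ℝ) (b : Test (EuclideanSpace ℝ (Fin 3)))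
    (k : EuclideanSpace ℝ (Fin 3)) : ‖ftTest volume (splitTest a b) (shellMomentum m k)‖ ≤
      ‖ftTest volume a (timeCovector (energy m k))‖ * ∫ x, ‖b x‖ := by
  have h1 : ftTest volume (splitTest a b) (shellMomentum m k) =
      ftTest volume a (timeCovector (energy m k)) * ftTest volume b (innerSL ℝ (-k)) := by
    rw [ftTest, ftTest, ftTest, ← integral_prod_mul, Measure.volume_eq_prod]
    congr 1; funext z
    change _ * (a z.1 * b z.2) = _
    have : planeWave (shellMomentum m k) z =
        planeWave (timeCovector (energy m k)) z.1 * planeWave (innerSL ℝ (-k)) z.2 := by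
      rw [planeWave, planeWave, planeWave, ← Complex.exp_add, ← mul_add, ← Complex.ofReal_add]
      congr 3
      rw [shellMomentum, minkowskiCovector_apply]
      simp [timeCovector]
      ring
    rw [this]; ring
  rw [h1, norm_mul]
  exact mul_le_mul_of_nonneg_left (norm_ftTest_le _ _ _) (norm_nonneg _)

theorem exists_time_bound (m : ℝ) (a : Test ℝ) : ∃ C : ℝ, 0 ≤ C ∧ ∀ k,
    (1 + ‖k‖) ^ 4 * ‖((energy m k ^ 2 * ‖ftTest volume a (timeCovector (energy m k))‖ ^ 2 : ℝ) : ℂ)‖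
      ≤ C := by
  obtain ⟨C, hC, hb⟩ := exists_norm_ftTest_le (volume : Measure ℝ) a 3
  refine ⟨C ^ 2, by positivity, fun k => ?_⟩
  have h1 := hb (timeCovector (energy m k))
  have h2 : ‖timeCovector (energy m k)‖ = energy m k := by
    rw [timeCovector, norm_smul, ContinuousLinearMap.norm_id, mul_one,
      Real.norm_of_nonneg (energy_nonneg m k)]
  rw [h2] at h1
  have h3 := energy_nonneg m k
  have h4 := norm_le_energy m k
  rw [Complex.norm_real, Real.norm_of_nonneg (by positivity)]
  set A := ‖ftTest volume a (timeCovector (energy m k))‖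
  have hA : 0 ≤ A := norm_nonneg _
  calc (1 + ‖k‖) ^ 4 * (energy m k ^ 2 * A ^ 2) ≤
        (1 + energy m k) ^ 4 * ((1 + energy m k) ^ 2 * A ^ 2) := by
        gcongr; linarith
    _ = ((1 + energy m k) ^ 3 * A) ^ 2 := by ring
    _ ≤ C ^ 2 := by gcongr

theorem continuous_timeCovector : Continuous timeCovector :=
  continuous_id.smul continuous_const

theorem integrable_shell_time (m : ℝ) (a : Test ℝ) : Integrable fun k =>
    shellWeight m k * energy m k ^ 2 * ‖ftTest volume a (timeCovector (energy m k))‖ ^ 2 := by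
  obtain ⟨C, hC, hb⟩ := exists_time_bound m a
  have hc : Continuous fun k : EuclideanSpace ℝ (Fin 3) =>
      ((energy m k ^ 2 * ‖ftTest volume a (timeCovector (energy m k))‖ ^ 2 : ℝ) : ℂ) := by
    have h1 : Continuous fun k => ftTest volume a (timeCovector (energy m k)) :=
      (continuous_ftTest volume a).comp (continuous_timeCovector.comp (continuous_energy m))
    have h2 := continuous_energy m
    fun_prop
  refine (integrable_shellWeight_mul m hc hb).1.re.congr (Filter.Eventually.of_forall fun k => ?_)
  change RCLike.re (K := ℂ) _ = _
  rw [← Complex.ofReal_mul]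
  exact (Complex.ofReal_re _).trans (mul_assoc _ _ _).symm

/-- The spatial profile is concentrated at x. The vacuum side is bounded uniformly, while uniform
continuity of the kernel on a compact set brings the smeared energy within η of its worldline value.
The tolerance η' is η over A² + 1 because the smearing function has L¹ norm A². -/
theorem IsNormalOrderedTwoPoint.worldline_bound {m : ℝ} {σ : FieldState m}
    {W : Spacetime × Spacetime → ℝ} (hW : IsNormalOrderedTwoPoint σ W)
    (x : EuclideanSpace ℝ (Fin 3)) (a : Test ℝ) :
    -(∫ k, shellWeight m k * energy m k ^ 2 * ‖ftTest volume a (timeCovector (energy m k))‖ ^ 2) ≤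
      (∫ p : ℝ × ℝ, conjTest a p.1 * a p.2 * (splitEnergy m W ((p.1, x), (p.2, x)) : ℂ)).re := by
  set F := splitEnergy m W with hFdef
  have hF : Continuous F := (contDiff_splitEnergy m hW.1).continuous
  set π : Spacetime × Spacetime → Spacetime × Spacetime := fun z => ((z.1.1, x), (z.2.1, x)) with hπ
  have hπc : Continuous π := by fun_prop
  set A := ∫ t, ‖a t‖ with hA
  have hA0 : 0 ≤ A := integral_nonneg fun _ => norm_nonneg _
  set V := ∫ k, shellWeight m k * energy m k ^ 2 * ‖ftTest volume a (timeCovector (energy m k))‖ ^ 2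
  set D := ∫ p : ℝ × ℝ, conjTest a p.1 * a p.2 * (F ((p.1, x), (p.2, x)) : ℂ) with hD
  refine le_of_forall_pos_le_add fun η hη => ?_
  -- uniform closeness
  set η' := η / (A ^ 2 + 1) with hη'
  have hη'0 : 0 < η' := by positivity
  set K : Set (Spacetime × Spacetime) := (tsupport a ×ˢ Metric.closedBall x 1) ×ˢ
    (tsupport a ×ˢ Metric.closedBall x 1) with hK
  have hKc : IsCompact K := by
    have h1 : IsCompact (tsupport a) := a.hasCompactSupport
    exact (h1.prod (isCompact_closedBall _ _)).prod (h1.prod (isCompact_closedBall _ _))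
  have hu := hKc.uniformContinuousOn_of_continuous hF.continuousOn
  obtain ⟨δ, hδ, hclose⟩ := Metric.uniformContinuousOn_iff.1 hu η' hη'0
  let r := min (δ / 2) 1
  have hr : 0 < r := by positivity
  -- Its radius r is below the modulus of continuity δ and at most 1, which keeps the smearing
  -- inside K.
  let β : ContDiffBump x := ⟨r / 2, r, by positivity, by linarith⟩
  let b : Test (EuclideanSpace ℝ (Fin 3)) :=
    ⟨fun y => (β.normed volume y : ℂ), Complex.ofRealCLM.contDiff.comp β.contDiff_normed,
      β.hasCompactSupport_normed.comp_left (g := fun r : ℝ => (r : ℂ)) (by simp),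
      fun _ _ => trivial⟩
  have hbapp : ∀ y, b y = (β.normed volume y : ℂ) := fun _ => rfl
  have hb1 : ∫ y, ‖b y‖ = 1 := by
    rw [← β.integral_normed (μ := volume)]
    congr 1; funext y
    rw [hbapp, Complex.norm_real, Real.norm_of_nonneg (β.nonneg_normed y)]
  have hbi : ∫ y, b y = 1 := by
    simp_rw [hbapp]
    rw [integral_complex_ofReal, β.integral_normed, Complex.ofReal_one]
  have hbs : ∀ y, b y ≠ 0 → dist y x < r := by
    intro y hy
    have h1 : y ∈ Function.support (β.normed volume) := by
      intro hc; exact hy (by rw [hbapp, hc, Complex.ofReal_zero])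
    rw [β.support_normed_eq] at h1
    exact h1
  set q := splitTest a b with hq
  have hqapp : ∀ z, q z = a z.1 * b z.2 := fun _ => rfl
  set c := tensorTest (conjTest q) q with hc
  have hcapp : ∀ z, c z = (starRingEnd ℂ) (q z.1) * q z.2 := fun _ => rfl
  have hpos := hW.splitEnergy_positivity q
  have hVle : ∫ k, shellWeight m k * energy m k ^ 2 * ‖ftTest volume q (shellMomentum m k)‖ ^ 2 ≤
      V := by
    refine integral_mono_of_nonneg (Filter.Eventually.of_forall fun k => ?_)
      (integrable_shell_time m a) (Filter.Eventually.of_forall fun k => ?_)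
    · have := shellWeight_nonneg m k
      change 0 ≤ _
      positivity
    · have h1 := norm_ftTest_splitTest_le m a b k
      rw [hb1, mul_one] at h1
      have := shellWeight_nonneg m k
      change _ * _ ≤ _ * _
      gcongr
  -- the smeared kernel is close to its value on the worldline
  have i1 := integrable_test_mul_ofReal c hF
  have i2 : Integrable fun z => c z * (F (π z) : ℂ) :=
    integrable_test_mul_ofReal c (hF.comp hπc)
  have hqn : ∫ z, ‖q z‖ = A := by
    have h1 : ∫ z : Spacetime, ‖a z.1‖ * ‖b z.2‖ = A * 1 := by
      rw [hA, ← hb1, ← integral_prod_mul, Measure.volume_eq_prod]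
    rw [mul_one] at h1
    rw [← h1]
    congr 1; funext z; rw [hqapp, norm_mul]
  have hcn : ∫ z, ‖c z‖ = A * A := by
    rw [← hqn, ← integral_prod_mul, Measure.volume_eq_prod]
    congr 1; funext z; rw [hcapp, norm_mul, RCLike.norm_conj]
  have hdiff : ‖(∫ z, c z * (F z : ℂ)) - ∫ z, c z * (F (π z) : ℂ)‖ ≤ η := by
    have h1 : ∀ z, ‖c z * (F z : ℂ) - c z * (F (π z) : ℂ)‖ ≤ η' * ‖c z‖ := by
      intro z
      rw [← mul_sub, norm_mul, mul_comm]
      by_cases hz : c z = 0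
      · simp [hz]
      · refine mul_le_mul_of_nonneg_right ?_ (norm_nonneg _)
        rw [hcapp] at hz
        have n1 : q z.1 ≠ 0 := fun h => hz (by rw [h, map_zero, zero_mul])
        have n2 : q z.2 ≠ 0 := right_ne_zero_of_mul hz
        rw [hqapp] at n1 n2
        have d1 := hbs _ (right_ne_zero_of_mul n1)
        have d2 := hbs _ (right_ne_zero_of_mul n2)
        have s1 := subset_tsupport _ (left_ne_zero_of_mul n1)
        have s2 := subset_tsupport _ (left_ne_zero_of_mul n2)
        have r1 : r ≤ 1 := min_le_right _ _
        have r2 : r < δ := lt_of_le_of_lt (min_le_left _ _) (by linarith)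
        have hz1 : z ∈ K := ⟨⟨s1, (d1.trans_le r1).le⟩, ⟨s2, (d2.trans_le r1).le⟩⟩
        have hz2 : π z ∈ K := ⟨⟨s1, Metric.mem_closedBall_self zero_le_one⟩,
          ⟨s2, Metric.mem_closedBall_self zero_le_one⟩⟩
        have hd : dist z (π z) < δ := by
          rw [Prod.dist_eq, Prod.dist_eq, Prod.dist_eq]
          simp only [hπ, dist_self]
          exact max_lt (max_lt hδ (d1.trans r2)) (max_lt hδ (d2.trans r2))
        have := hclose z hz1 (π z) hz2 hd
        rw [← Complex.ofReal_sub, Complex.norm_real, Real.norm_eq_abs, ← Real.dist_eq]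
        exact this.le
    rw [← integral_sub i1 i2]
    refine (norm_integral_le_of_norm_le ((integrable_test volume c).norm.const_mul η')
      (Filter.Eventually.of_forall h1)).trans ?_
    rw [integral_const_mul, hcn, hη', div_mul_eq_mul_div, div_le_iff₀ (by positivity)]
    nlinarith
  have hDeq : ∫ z, c z * (F (π z) : ℂ) = D := by
    have i2' : Integrable (fun z : Spacetime × Spacetime => c z * (F (π z) : ℂ))
        (volume.prod volume) := by rw [← Measure.volume_eq_prod]; exact i2
    have hac : Continuous fun t => (conjTest a t) := (conjTest a).continuous
    have i3 : Integrable (fun p : ℝ × ℝ => conjTest a p.1 * a p.2 * (F ((p.1, x), (p.2, x)) : ℂ))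
        (volume.prod volume) := by
      rw [← Measure.volume_eq_prod]
      refine Continuous.integrable_of_hasCompactSupport ?_ ?_
      · exact ((hac.comp continuous_fst).mul (a.continuous.comp continuous_snd)).mul
          (Complex.continuous_ofReal.comp (hF.comp (by fun_prop)))
      · refine HasCompactSupport.intro (K := tsupport a ×ˢ tsupport a)
          ((show IsCompact (tsupport a) from a.hasCompactSupport).prod a.hasCompactSupport) ?_
        intro p hp
        by_contra hne
        have h1 := left_ne_zero_of_mul hne
        refine hp ⟨subset_tsupport _ fun h => left_ne_zero_of_mul h1 ?_,
          subset_tsupport _ (right_ne_zero_of_mul h1)⟩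
        change (starRingEnd ℂ) (a p.1) = 0
        rw [h, map_zero]
    have hD2 : D = ∫ t : ℝ, ∫ t' : ℝ, conjTest a t * a t' * (F ((t, x), (t', x)) : ℂ) := by
      rw [hD, Measure.volume_eq_prod, integral_prod _ i3]
    have hL : ∫ z, c z * (F (π z) : ℂ) =
        ∫ z1 : Spacetime, ∫ z2 : Spacetime, c (z1, z2) * (F (π (z1, z2)) : ℂ) :=
      integral_prod _ i2'
    rw [hL, hD2]
    have h1 : ∀ z1 : Spacetime, ∫ z2 : Spacetime, c (z1, z2) * (F (π (z1, z2)) : ℂ) =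
        (∫ t' : ℝ, conjTest a z1.1 * a t' * (F ((z1.1, x), (t', x)) : ℂ)) * b z1.2 := by
      intro z1
      have h2 : ∫ z2 : Spacetime, (conjTest a z1.1 * a z2.1 * (F ((z1.1, x), (z2.1, x)) : ℂ)) *
          b z2.2 = (∫ t' : ℝ, conjTest a z1.1 * a t' * (F ((z1.1, x), (t', x)) : ℂ)) * 1 := by
        rw [← hbi, ← integral_prod_mul, Measure.volume_eq_prod]
      rw [mul_one] at h2
      rw [← h2, ← integral_mul_const]
      congr 1; funext z2
      rw [hcapp, hqapp, hqapp, map_mul, hbapp z1.2, Complex.conj_ofReal]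
      change (starRingEnd ℂ) (a z1.1) * _ * (a z2.1 * _) * _ =
        (starRingEnd ℂ) (a z1.1) * a z2.1 * _ * _ * _
      ring
    simp_rw [h1]
    have h3 : ∫ z1 : Spacetime, (∫ t' : ℝ, conjTest a z1.1 * a t' * (F ((z1.1, x), (t', x)) : ℂ)) *
        b z1.2 = (∫ t : ℝ, ∫ t' : ℝ, conjTest a t * a t' * (F ((t, x), (t', x)) : ℂ)) * 1 := by
      rw [← hbi, ← integral_prod_mul, Measure.volume_eq_prod]
    rw [h3, mul_one]
  rw [hDeq] at hdiff
  have h8 := (Complex.abs_re_le_norm _).trans hdiff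
  rw [Complex.sub_re, abs_le] at h8
  linarith [h8.2]

end Localization

end QEI

end

noncomputable section

namespace QEI

/-! ### Recovering the diagonal by integrating over frequencies -/

section DiagonalTrace

/-- The covector `(t, t') ↦ α (t' - t)`. -/
def antidiagCovector (α : ℝ) : ℝ × ℝ →L[ℝ] ℝ :=
  α • (ContinuousLinearMap.snd ℝ ℝ ℝ - ContinuousLinearMap.fst ℝ ℝ ℝ)

theorem antidiagCovector_apply (α : ℝ) (p : ℝ × ℝ) : antidiagCovector α p = α * (p.2 - p.1) := by
  simp [antidiagCovector]

theorem continuous_antidiagCovector : Continuous antidiagCovector :=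
  continuous_id.smul continuous_const

theorem abs_le_norm_antidiagCovector (α : ℝ) : |α| ≤ ‖antidiagCovector α‖ := by
  have h := (antidiagCovector α).le_opNorm (0, 1)
  have h1 : ‖((0 : ℝ), (1 : ℝ))‖ = 1 := by simp [Prod.norm_def]
  rw [antidiagCovector_apply, h1, mul_one, sub_zero, mul_one] at h
  exact h

theorem integrable_one_add_abs_inv : Integrable fun u : ℝ => ((1 + |u|) ^ 2)⁻¹ := by
  refine (integrable_one_add_norm (E := ℝ) (μ := volume) (r := 2) (by simp)).congr
    (Filter.Eventually.of_forall fun u => ?_)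
  simp only
  rw [Real.rpow_neg (by positivity), Real.norm_eq_abs]
  norm_cast

theorem integrable_ftTest_antidiag (H : Test (ℝ × ℝ)) :
    Integrable fun α => ftTest volume H (antidiagCovector α) := by
  obtain ⟨C, hC, hb⟩ := exists_norm_ftTest_le (volume : Measure (ℝ × ℝ)) H 2
  refine (integrable_one_add_abs_inv.const_mul C).mono'
    ((continuous_ftTest volume H).comp continuous_antidiagCovector).aestronglyMeasurable
    (Filter.Eventually.of_forall fun α => ?_)
  rw [← div_eq_mul_inv, le_div_iff₀ (by positivity), mul_comm]
  refine le_trans ?_ (hb (antidiagCovector α))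
  have := abs_le_norm_antidiagCovector α
  gcongr

/-- The integral of `H` along the diagonal shifted by `s`. -/
def diagIntegral (H : Test (ℝ × ℝ)) (s : ℝ) : ℂ := ∫ t, H (t, t + s)

theorem continuous_diagIntegral (H : Test (ℝ × ℝ)) : Continuous (diagIntegral H) := by
  have hK : IsCompact (Prod.fst '' tsupport H) :=
    (show IsCompact (tsupport H) from H.hasCompactSupport).image continuous_fst
  have h1 : diagIntegral H = fun s => ∫ t in Prod.fst '' tsupport H, H (t, t + s) := by
    funext s
    rw [diagIntegral, setIntegral_eq_integral_of_forall_compl_eq_zero]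
    intro t ht
    by_contra hne
    exact ht ⟨_, subset_tsupport _ hne, rfl⟩
  rw [h1]
  refine continuous_parametric_integral_of_continuous ?_ hK
  exact H.continuous.comp (continuous_snd.prodMk (continuous_snd.add continuous_fst))

theorem measurePreserving_shear :
    MeasurePreserving (fun z : ℝ × ℝ => (z.1, z.1 + z.2)) volume volume :=
  measurePreserving_prod_add volume volume

theorem integrable_shear (H : Test (ℝ × ℝ)) : Integrable fun z : ℝ × ℝ => H (z.1, z.1 + z.2) :=
  measurePreserving_shear.integrable_comp_of_integrable (integrable_test volume H)

theorem integrable_diagIntegral (H : Test (ℝ × ℝ)) : Integrable (diagIntegral H) := by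
  have h := integrable_shear H
  rw [Measure.volume_eq_prod] at h
  exact h.integral_prod_right

/-- The shear (t, s) ↦ (t, t + s) preserves the measure and turns the phase into a function of s
alone, leaving a one-dimensional Fourier transform of `diagIntegral H`. -/
theorem ftTest_antidiag (H : Test (ℝ × ℝ)) (α : ℝ) :
    ftTest volume H (antidiagCovector α) =
      ∫ s, Complex.exp (Complex.I * (α * s : ℝ)) * diagIntegral H s := by
  have hint := integrable_shear H
  have h1 : ftTest volume H (antidiagCovector α) =
      ∫ z : ℝ × ℝ, Complex.exp (Complex.I * (α * z.2 : ℝ)) * H (z.1, z.1 + z.2) := by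
    rw [ftTest, ← measurePreserving_shear.integral_comp
      (MeasurableEquiv.shearAddRight ℝ).measurableEmbedding]
    congr 1; funext z
    rw [planeWave, antidiagCovector_apply]
    simp
  have h2 : Integrable (fun z : ℝ × ℝ => Complex.exp (Complex.I * (α * z.2 : ℝ)) *
      H (z.1, z.1 + z.2)) (volume.prod volume) := by
    rw [← Measure.volume_eq_prod]
    refine hint.bdd_mul (c := 1) (by fun_prop) (Filter.Eventually.of_forall fun z => ?_)
    rw [mul_comm, Complex.norm_exp_ofReal_mul_I]
  rw [h1, Measure.volume_eq_prod, integral_prod_symm _ h2]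
  congr 1; funext s
  rw [diagIntegral, ← integral_const_mul]

/-- Fourier inversion for `diagIntegral H` at s = 0; the factor 2π comes from rescaling the
frequency. -/
theorem integral_ftTest_antidiag (H : Test (ℝ × ℝ)) :
    ∫ α, ftTest volume H (antidiagCovector α) = 2 * Real.pi * ∫ t, H (t, t) := by
  have hpi := Real.pi_pos
  have h1 : ∀ w, FourierTransform.fourier (diagIntegral H) w =
      ftTest volume H (antidiagCovector (-(2 * Real.pi) * w)) := by
    intro w
    rw [Real.fourier_eq', ftTest_antidiag]
    congr 1; funext s
    rw [smul_eq_mul]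
    congr 2
    simp only [RCLike.inner_apply, conj_trivial]
    push_cast; ring
  have h2 : Integrable (FourierTransform.fourier (diagIntegral H)) := by
    have : FourierTransform.fourier (diagIntegral H) = fun w =>
      ftTest volume H (antidiagCovector (-(2 * Real.pi) * w)) := funext h1
    rw [this]
    exact (integrable_ftTest_antidiag H).comp_mul_left' (by simp [hpi.ne'])
  have h3 := (integrable_diagIntegral H).fourierInv_fourier_eq h2
    (continuous_diagIntegral H).continuousAt (v := 0)
  rw [Real.fourierInv_eq'] at h3
  simp only [inner_zero_right, mul_zero, Complex.ofReal_zero, zero_mul, Complex.exp_zero,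
    one_smul, h1] at h3
  rw [Measure.integral_comp_mul_left (fun α => ftTest volume H (antidiagCovector α))] at h3
  have h4 : diagIntegral H 0 = ∫ t, H (t, t) := by simp [diagIntegral]
  rw [← h4, ← h3, inv_neg, abs_neg, abs_of_pos (by positivity), Complex.real_smul, ← mul_assoc]
  push_cast
  have : (Real.pi : ℂ) ≠ 0 := by exact_mod_cast hpi.ne'
  field_simp

/-- For real H, opposite frequencies give conjugate values. The real part is therefore even, and the
half-line carries half of 2π. -/
theorem pi_mul_integral_diag (H : Test (ℝ × ℝ)) (hH : conjTest H = H) :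
    Real.pi * (∫ t, H (t, t)).re =
      ∫ α in Ioi (0 : ℝ), (ftTest volume H (antidiagCovector α)).re := by
  have heven : ∀ α, (ftTest volume H (antidiagCovector |α|)).re =
      (ftTest volume H (antidiagCovector α)).re := by
    intro α
    rcases abs_choice α with h | h
    · rw [h]
    · have h1 : antidiagCovector (-α) = -antidiagCovector α := by
        refine ContinuousLinearMap.ext fun p => ?_
        rw [neg_apply, antidiagCovector_apply, antidiagCovector_apply, neg_mul]
      rw [h, h1]
      conv_rhs => rw [← hH, ftTest_conjTest, Complex.conj_re]
  have h1 := integral_comp_abs (f := fun α => (ftTest volume H (antidiagCovector α)).re)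
  simp_rw [heven] at h1
  have h2 := congr_arg Complex.re (integral_ftTest_antidiag H)
  have h3 : (∫ α, ftTest volume H (antidiagCovector α)).re =
      ∫ α, (ftTest volume H (antidiagCovector α)).re :=
    (integral_re (integrable_ftTest_antidiag H)).symm
  rw [h3, h1] at h2
  have h4 : (2 * (Real.pi : ℂ) * ∫ t, H (t, t)).re = 2 * (Real.pi * (∫ t, H (t, t)).re) := by
    rw [show (2 * (Real.pi : ℂ)) = ((2 * Real.pi : ℝ) : ℂ) by push_cast; rfl,
      Complex.re_ofReal_mul]
    ring
  rw [h4] at h2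
  linarith

end DiagonalTrace

/-! ### The momentum ball integral and the function Q₃ -/

section BallIntegral

/-- For m > 0 by the explicit primitive A. At the upper limit √(r² + m²) = u, and subtracting log m
turns the logarithm into that of (u + √(u² - m²))/m. For m = 0 the integrand is r³. -/
theorem integral_sq_mul_sqrt {m u : ℝ} (hm : 0 ≤ m) (hu : m < u) :
    ∫ r in (0 : ℝ)..√(u ^ 2 - m ^ 2), r ^ 2 * √(r ^ 2 + m ^ 2) = u ^ 4 / 4 * Q3ratio m u := by
  have hu0 : 0 < u := lt_of_le_of_lt hm hu
  set R := √(u ^ 2 - m ^ 2) with hR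
  have hRsq : R ^ 2 = u ^ 2 - m ^ 2 := Real.sq_sqrt (by nlinarith)
  have hR0 : 0 ≤ R := Real.sqrt_nonneg _
  rcases hm.eq_or_lt with rfl | hm0
  · have hRu : R = u := by
      rw [hR]; simp [Real.sqrt_sq hu0.le]
    rw [hRu, Q3ratio, if_pos rfl]
    have h1 : ∫ r in (0 : ℝ)..u, r ^ 2 * √(r ^ 2 + 0 ^ 2) = ∫ r in (0 : ℝ)..u, r ^ 3 := by
      refine intervalIntegral.integral_congr fun r hr => ?_
      rw [uIcc_of_le hu0.le] at hr
      rw [zero_pow two_ne_zero, add_zero, Real.sqrt_sq hr.1]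
      ring
    rw [h1, integral_pow]
    norm_num
  · let A : ℝ → ℝ := fun r => r * (2 * r ^ 2 + m ^ 2) * √(r ^ 2 + m ^ 2) / 8 -
      m ^ 4 / 8 * Real.log (r + √(r ^ 2 + m ^ 2))
    have hA : ∀ r, HasDerivAt A (r ^ 2 * √(r ^ 2 + m ^ 2)) r := by
      intro r
      set s := √(r ^ 2 + m ^ 2) with hs
      have hpos : 0 < r ^ 2 + m ^ 2 := by positivity
      have hs0 : 0 < s := Real.sqrt_pos.2 hpos
      have hss : s ^ 2 = r ^ 2 + m ^ 2 := Real.sq_sqrt hpos.le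
      have hrs : 0 < r + s := by
        have : |r| < s := Real.lt_sqrt_of_sq_lt (by rw [sq_abs]; nlinarith)
        linarith [neg_abs_le r]
      have d0 : HasDerivAt (fun r : ℝ => r ^ 2 + m ^ 2) (2 * r) r := by
        simpa using (hasDerivAt_pow 2 r).add_const (m ^ 2)
      have d1 : HasDerivAt (fun r : ℝ => √(r ^ 2 + m ^ 2)) (2 * r / (2 * s)) r :=
        d0.sqrt hpos.ne'
      have d2 : HasDerivAt (fun r : ℝ => r * (2 * r ^ 2 + m ^ 2)) (6 * r ^ 2 + m ^ 2) r := by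
        have := (hasDerivAt_id r).mul (((hasDerivAt_pow 2 r).const_mul 2).add_const (m ^ 2))
        refine this.congr_deriv ?_
        simp; ring
      have d3 : HasDerivAt (fun r : ℝ => Real.log (r + √(r ^ 2 + m ^ 2)))
          ((1 + 2 * r / (2 * s)) / (r + s)) r := ((hasDerivAt_id r).add d1).log hrs.ne'
      have d := ((d2.mul d1).div_const 8).sub (d3.const_mul (m ^ 4 / 8))
      refine d.congr_deriv ?_
      rw [← hs]
      have e : (1 + 2 * r / (2 * s)) / (r + s) = 1 / s := by
        field_simp; ring
      rw [e]
      field_simp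
      have hm2 : m ^ 2 = s ^ 2 - r ^ 2 := by rw [hss]; ring
      rw [show m ^ 4 = (m ^ 2) ^ 2 by ring, hm2]
      ring
    have hI := intervalIntegral.integral_eq_sub_of_hasDerivAt (a := 0) (b := R) (fun r _ => hA r)
      (Continuous.intervalIntegrable (by fun_prop) _ _)
    rw [hI]
    have hRm : √(R ^ 2 + m ^ 2) = u := by
      rw [hRsq, sub_add_cancel, Real.sqrt_sq hu0.le]
    have h0 : A 0 = -(m ^ 4 / 8 * Real.log m) := by
      simp [A, Real.sqrt_sq hm0.le]
    have hAR : A R = R * (2 * R ^ 2 + m ^ 2) * u / 8 - m ^ 4 / 8 * Real.log (R + u) := by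
      simp only [A]; rw [hRm]
    rw [hAR, h0, Q3ratio, if_neg hm0.ne', Q3]
    have e1 : √(1 - 1 / (u / m) ^ 2) = R / u := by
      have : 1 - 1 / (u / m) ^ 2 = (u ^ 2 - m ^ 2) / u ^ 2 := by field_simp
      rw [this, Real.sqrt_div' _ (sq_nonneg u), Real.sqrt_sq hu0.le]
    have e2 : √((u / m) ^ 2 - 1) = R / m := by
      have : (u / m) ^ 2 - 1 = (u ^ 2 - m ^ 2) / m ^ 2 := by field_simp
      rw [this, Real.sqrt_div' _ (sq_nonneg m), Real.sqrt_sq hm0.le]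
    rw [e1, e2, ← add_div, Real.log_div (by positivity) hm0.ne', add_comm u R]
    field_simp
    rw [hRsq]
    ring

/-- In polar coordinates the sphere has area 4π, three times the volume of the unit ball, and energy
below u means radius below √(u² - m²). -/
theorem integral_ball_energy {m : ℝ} (hm : 0 ≤ m) (u : ℝ) :
    ∫ k : EuclideanSpace ℝ (Fin 3), (if energy m k < u then energy m k else 0) =
      if m < u then Real.pi * (u ^ 4 * Q3ratio m u) else 0 := by
  have h := integral_fun_norm_addHaar (volume : Measure (EuclideanSpace ℝ (Fin 3)))
    (fun y : ℝ => if √(y ^ 2 + m ^ 2) < u then √(y ^ 2 + m ^ 2) else 0)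
  have hv : (volume : Measure (EuclideanSpace ℝ (Fin 3))).real (Metric.ball 0 1) =
      Real.pi * 4 / 3 := by
    rw [Measure.real, EuclideanSpace.volume_ball_fin_three]
    have := Real.pi_pos
    simp only [ENNReal.ofReal_one, one_pow, one_mul]
    rw [ENNReal.toReal_ofReal (by positivity)]
  rw [hv, finrank_euclideanSpace_fin] at h
  change ∫ k : EuclideanSpace ℝ (Fin 3),
    (if √(‖k‖ ^ 2 + m ^ 2) < u then √(‖k‖ ^ 2 + m ^ 2) else 0) = _
  rw [h]
  have hle : ∀ y : ℝ, m ≤ √(y ^ 2 + m ^ 2) := fun y =>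
    Real.le_sqrt_of_sq_le (by nlinarith [sq_nonneg y])
  by_cases hu : m < u
  · have hu0 : 0 < u := lt_of_le_of_lt hm hu
    rw [if_pos hu]
    set R := √(u ^ 2 - m ^ 2) with hR
    have hR0 : 0 ≤ R := Real.sqrt_nonneg _
    have hiff : ∀ y : ℝ, 0 < y → (√(y ^ 2 + m ^ 2) < u ↔ y < R) := by
      intro y hy
      rw [Real.sqrt_lt' hu0, hR, Real.lt_sqrt hy.le]
      constructor <;> intro h <;> linarith
    have h1 : ∫ y in Ioi (0 : ℝ), y ^ (3 - 1) •
        (if √(y ^ 2 + m ^ 2) < u then √(y ^ 2 + m ^ 2) else 0) =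
        ∫ y in Ioi (0 : ℝ), (Iio R).indicator (fun y => y ^ 2 * √(y ^ 2 + m ^ 2)) y := by
      refine setIntegral_congr_fun measurableSet_Ioi fun y hy => ?_
      by_cases hyR : y < R
      · rw [if_pos ((hiff y hy).2 hyR), indicator_of_mem (show y ∈ Iio R from hyR)]
        simp
      · rw [if_neg (fun hc => hyR ((hiff y hy).1 hc)),
          indicator_of_notMem (show y ∉ Iio R from hyR)]
        simp
    rw [h1, setIntegral_indicator measurableSet_Iio, Ioi_inter_Iio, ← integral_Ioc_eq_integral_Ioo,
      ← intervalIntegral.integral_of_le hR0, integral_sq_mul_sqrt hm hu]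
    simp only [nsmul_eq_mul, smul_eq_mul]
    push_cast; ring
  · rw [if_neg hu]
    have h1 : ∀ y : ℝ, (if √(y ^ 2 + m ^ 2) < u then √(y ^ 2 + m ^ 2) else 0) = 0 := fun y =>
      if_neg (by have := hle y; push Not at hu ⊢; linarith)
    simp [h1]

/-- Up to the factor x⁴/4, Q₃(x) is the integral of a nonnegative function, by
`integral_sq_mul_sqrt` with m = 1. -/
theorem Q3_nonneg {x : ℝ} (hx : 1 ≤ x) : 0 ≤ Q3 x := by
  rcases hx.eq_or_lt with rfl | hx
  · simp [Q3]
  · have h := integral_sq_mul_sqrt (m := 1) zero_le_one hx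
    have h1 : 0 ≤ ∫ r in (0 : ℝ)..√(x ^ 2 - 1 ^ 2), r ^ 2 * √(r ^ 2 + 1 ^ 2) :=
      intervalIntegral.integral_nonneg (Real.sqrt_nonneg _) fun r _ => by positivity
    rw [h, Q3ratio, if_neg one_ne_zero, div_one] at h1
    have h2 : 0 < x ^ 4 / 4 := by positivity
    exact nonneg_of_mul_nonneg_right h1 h2

theorem Q3_le_one {x : ℝ} (hx : 1 ≤ x) : Q3 x ≤ 1 := by
  have hx0 : 0 < x := by linarith
  have h1 : √(1 - 1 / x ^ 2) ≤ 1 := by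
    rw [Real.sqrt_le_one]
    have : 0 ≤ 1 / x ^ 2 := by positivity
    linarith
  have h2 : 0 ≤ Real.log (x + √(x ^ 2 - 1)) :=
    Real.log_nonneg (by linarith [Real.sqrt_nonneg (x ^ 2 - 1)])
  have h3 : 0 ≤ 1 / (2 * x ^ 4) * Real.log (x + √(x ^ 2 - 1)) := by positivity
  have h4 : 1 - 1 / (2 * x ^ 2) ≤ 1 := by
    have : 0 ≤ 1 / (2 * x ^ 2) := by positivity
    linarith
  have h5 : √(1 - 1 / x ^ 2) * (1 - 1 / (2 * x ^ 2)) ≤ 1 := by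
    have h6 := Real.sqrt_nonneg (1 - 1 / x ^ 2)
    nlinarith
  unfold Q3
  linarith

theorem tendsto_Q3 : Filter.Tendsto Q3 Filter.atTop (𝓝 1) := by
  have hp : ∀ n : ℕ, n ≠ 0 → Filter.Tendsto (fun x : ℝ => (x ^ n)⁻¹) Filter.atTop (𝓝 0) :=
    fun n hn => (Filter.tendsto_pow_atTop hn).inv_tendsto_atTop
  have h1 : Filter.Tendsto (fun x : ℝ => √(1 - 1 / x ^ 2)) Filter.atTop (𝓝 1) := by
    have := ((hp 2 two_ne_zero).const_sub 1).sqrt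
    simpa using this
  have h2 : Filter.Tendsto (fun x : ℝ => 1 - 1 / (2 * x ^ 2)) Filter.atTop (𝓝 1) := by
    have := ((hp 2 two_ne_zero).const_mul (2⁻¹)).const_sub 1
    simpa [mul_comm] using this
  have h3 : Filter.Tendsto (fun x : ℝ => 1 / (2 * x ^ 4) * Real.log (x + √(x ^ 2 - 1)))
      Filter.atTop (𝓝 0) := by
    refine squeeze_zero' ?_ ?_ (hp 3 three_ne_zero)
    · filter_upwards [Filter.eventually_ge_atTop 1] with x hx
      have : 0 ≤ Real.log (x + √(x ^ 2 - 1)) :=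
        Real.log_nonneg (by linarith [Real.sqrt_nonneg (x ^ 2 - 1)])
      positivity
    · filter_upwards [Filter.eventually_ge_atTop 1] with x hx
      have hx0 : 0 < x := by linarith
      have h4 : √(x ^ 2 - 1) ≤ x := by
        rw [Real.sqrt_le_left hx0.le]; linarith
      -- The crude bound log y ≤ y - 1 suffices, since the prefactor decays like x⁻⁴.
      have h5 : Real.log (x + √(x ^ 2 - 1)) ≤ 2 * x := by
        have := Real.log_le_sub_one_of_pos (x := x + √(x ^ 2 - 1))
          (by linarith [Real.sqrt_nonneg (x ^ 2 - 1)])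
        linarith
      calc _ ≤ 1 / (2 * x ^ 4) * (2 * x) := by gcongr
        _ = (x ^ 3)⁻¹ := by field_simp
  have := (h1.mul h2).sub h3
  rw [mul_one, sub_zero] at this
  exact this

theorem Q3ratio_mem {m u : ℝ} (hm : 0 ≤ m) (hu : m < u) :
    0 ≤ Q3ratio m u ∧ Q3ratio m u ≤ 1 := by
  unfold Q3ratio
  split_ifs with h
  · simp
  · have hm0 : 0 < m := lt_of_le_of_ne hm (Ne.symm h)
    have : 1 ≤ u / m := by rw [le_div_iff₀ hm0]; linarith
    exact ⟨Q3_nonneg this, Q3_le_one this⟩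

theorem measurable_Q3ratio (m : ℝ) : Measurable (Q3ratio m) := by
  unfold Q3ratio
  split_ifs
  · exact measurable_const
  · unfold Q3
    fun_prop

end BallIntegral

end QEI

end

noncomputable section

namespace QEI

/-! ### The energy inequality for real sampling functions -/

section EnergyInequality

/-- A smooth compactly supported function of time as a test function. -/
def timeTest (g : ℝ → ℂ) (hg : ContDiff ℝ ∞ g) (hgc : HasCompactSupport g) : Test ℝ :=
  ⟨g, hg, hgc, fun _ _ => trivial⟩

theorem ftTest_timeTest {g : ℝ → ℂ} (hg : ContDiff ℝ ∞ g) (hgc : HasCompactSupport g) (u : ℝ) :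
    ftTest volume (timeTest g hg hgc) (timeCovector u) = ft g u := by
  rw [ftTest, ft]
  congr 1

theorem norm_timeCovector (u : ℝ) : ‖timeCovector u‖ = |u| := by
  rw [timeCovector, norm_smul, ContinuousLinearMap.norm_id, mul_one, Real.norm_eq_abs]

theorem exists_norm_ft_le {g : ℝ → ℂ} (hg : ContDiff ℝ ∞ g) (hgc : HasCompactSupport g) (N : ℕ) :
    ∃ C : ℝ, 0 ≤ C ∧ ∀ u, (1 + |u|) ^ N * ‖ft g u‖ ^ 2 ≤ C := by
  obtain ⟨C, hC, hb⟩ := exists_norm_ftTest_le (volume : Measure ℝ) (timeTest g hg hgc) N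
  refine ⟨C ^ 2, by positivity, fun u => ?_⟩
  have h1 := hb (timeCovector u)
  rw [norm_timeCovector, ftTest_timeTest] at h1
  have h2 : (1 : ℝ) ≤ (1 + |u|) ^ N := one_le_pow₀ (by linarith [abs_nonneg u])
  calc (1 + |u|) ^ N * ‖ft g u‖ ^ 2 ≤ (1 + |u|) ^ N * ((1 + |u|) ^ N * ‖ft g u‖ ^ 2) :=
        le_mul_of_one_le_left (by positivity) h2
    _ = ((1 + |u|) ^ N * ‖ft g u‖) ^ 2 := by ring
    _ ≤ C ^ 2 := by gcongr

theorem continuous_ft {g : ℝ → ℂ} (hg : ContDiff ℝ ∞ g) (hgc : HasCompactSupport g) :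
    Continuous (ft g) := by
  have : ft g = fun u => ftTest volume (timeTest g hg hgc) (timeCovector u) :=
    funext fun u => (ftTest_timeTest hg hgc u).symm
  rw [this]
  exact (continuous_ftTest volume _).comp continuous_timeCovector

theorem integrableOn_ft_mul_Q3ratio {m : ℝ} (hm : 0 ≤ m) {g : ℝ → ℂ} (hg : ContDiff ℝ ∞ g)
    (hgc : HasCompactSupport g) :
    IntegrableOn (fun u : ℝ => ‖ft g u‖ ^ 2 * u ^ 4 * Q3ratio m u) (Ioi m) := by
  obtain ⟨C, hC, hb⟩ := exists_norm_ft_le hg hgc 6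
  refine Integrable.mono' (g := fun u => C * ((1 + |u|) ^ 2)⁻¹)
    (integrable_one_add_abs_inv.const_mul C).integrableOn ?_ ?_
  · have := (continuous_ft hg hgc).norm.measurable
    have := measurable_Q3ratio m
    exact Measurable.aestronglyMeasurable (by fun_prop)
  · refine (ae_restrict_iff' measurableSet_Ioi).2 (Filter.Eventually.of_forall fun u hu => ?_)
    obtain ⟨h0, h1⟩ := Q3ratio_mem hm hu
    rw [Real.norm_of_nonneg (by positivity), ← div_eq_mul_inv, le_div_iff₀ (by positivity)]
    refine le_trans ?_ (hb u)
    have h2 : u ^ 4 ≤ (1 + |u|) ^ 4 := by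
      rw [← Even.pow_abs (by decide : Even 4) u]
      gcongr; linarith
    calc _ ≤ ‖ft g u‖ ^ 2 * (1 + |u|) ^ 4 * 1 * (1 + |u|) ^ 2 := by gcongr
      _ = _ := by ring

/-- A majorant for both Fubini arguments. The exponent 7 is 1 for the energy, 2 for integrability in
a, and 4 for integrability in k. -/
theorem energy_mul_le (m : ℝ) (k : EuclideanSpace ℝ (Fin 3)) {G C u a : ℝ} (hG : 0 ≤ G)
    (hC : (1 + |u|) ^ 7 * G ≤ C) (hu : energy m k ≤ u) (ha : |a| ≤ u) :
    energy m k * G ≤ C * (((1 + |a|) ^ 2)⁻¹ * ((1 + ‖k‖) ^ 4)⁻¹) := by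
  have h1 := energy_nonneg m k
  have h2 := norm_le_energy m k
  rw [← mul_inv, ← div_eq_mul_inv, le_div_iff₀ (by positivity)]
  refine le_trans ?_ hC
  have h3 : |u| = u := abs_of_nonneg (h1.trans hu)
  rw [h3]
  have h4 : 0 ≤ u := h1.trans hu
  calc energy m k * G * ((1 + |a|) ^ 2 * (1 + ‖k‖) ^ 4)
      ≤ (1 + u) * G * ((1 + u) ^ 2 * (1 + u) ^ 4) := by gcongr <;> linarith
    _ = _ := by ring

/-- Tonelli's theorem for the momentum space integrals. -/
theorem integral_integral_energy {m : ℝ} (hm : 0 ≤ m) {G : ℝ → ℝ} (hGc : Continuous G)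
    (hG : ∀ u, 0 ≤ G u) {C : ℝ} (hC : ∀ u, (1 + |u|) ^ 7 * G u ≤ C) :
    IntegrableOn (fun α => ∫ k : EuclideanSpace ℝ (Fin 3), energy m k * G (energy m k + α)) (Ioi 0) ∧
    ∫ α in Ioi (0 : ℝ), ∫ k : EuclideanSpace ℝ (Fin 3), energy m k * G (energy m k + α) =
      Real.pi * ∫ u in Ioi m, G u * u ^ 4 * Q3ratio m u := by
  -- Φ uses the coordinates (α, k) and Ψ uses (u, k). For fixed k they differ by the translation u =
  -- α + energy, which carries α > 0 to energy < u.
  let Φ : ℝ × EuclideanSpace ℝ (Fin 3) → ℝ := indicator {p | 0 < p.1} fun p =>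
    energy m p.2 * G (energy m p.2 + p.1)
  let Ψ : ℝ × EuclideanSpace ℝ (Fin 3) → ℝ := indicator {p | energy m p.2 < p.1} fun p =>
    energy m p.2 * G p.1
  have hE : Continuous fun p : ℝ × EuclideanSpace ℝ (Fin 3) => energy m p.2 :=
    (continuous_energy m).comp continuous_snd
  have hdom : Integrable (fun p : ℝ × EuclideanSpace ℝ (Fin 3) =>
      C * (((1 + |p.1|) ^ 2)⁻¹ * ((1 + ‖p.2‖) ^ 4)⁻¹)) (volume.prod volume) :=
    (integrable_one_add_abs_inv.mul_prod integrable_one_add_norm_inv).const_mul C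
  have hΦm : Measurable Φ := by
    refine Measurable.indicator ?_ (measurableSet_lt measurable_const measurable_fst)
    exact (hE.mul (hGc.comp (hE.add continuous_fst))).measurable
  have hΨm : Measurable Ψ := by
    refine Measurable.indicator ?_ (measurableSet_lt hE.measurable measurable_fst)
    exact (hE.mul (hGc.comp continuous_fst)).measurable
  have hC0 : 0 ≤ C := le_trans (mul_nonneg (by positivity) (hG 0)) (hC 0)
  have hΦi : Integrable Φ (volume.prod volume) := by
    refine hdom.mono' hΦm.aestronglyMeasurable (Filter.Eventually.of_forall fun p => ?_)
    have he := energy_nonneg m p.2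
    by_cases hp : 0 < p.1
    · simp only [Φ]
      rw [indicator_of_mem (show p ∈ {p : ℝ × EuclideanSpace ℝ (Fin 3) | 0 < p.1} from hp),
        Real.norm_of_nonneg (mul_nonneg he (hG _))]
      exact energy_mul_le m p.2 (hG _) (hC _) (by linarith) (by rw [abs_of_pos hp]; linarith)
    · simp only [Φ]
      rw [indicator_of_notMem (show p ∉ {p : ℝ × EuclideanSpace ℝ (Fin 3) | 0 < p.1} from hp),
        norm_zero]
      positivity
  have hΨi : Integrable Ψ (volume.prod volume) := by
    refine hdom.mono' hΨm.aestronglyMeasurable (Filter.Eventually.of_forall fun p => ?_)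
    have he := energy_nonneg m p.2
    by_cases hp : energy m p.2 < p.1
    · simp only [Ψ]
      rw [indicator_of_mem
        (show p ∈ {p : ℝ × EuclideanSpace ℝ (Fin 3) | energy m p.2 < p.1} from hp),
        Real.norm_of_nonneg (mul_nonneg he (hG _))]
      exact energy_mul_le m p.2 (hG _) (hC _) hp.le (by rw [abs_of_pos (he.trans_lt hp)])
    · simp only [Ψ]
      rw [indicator_of_notMem
        (show p ∉ {p : ℝ × EuclideanSpace ℝ (Fin 3) | energy m p.2 < p.1} from hp), norm_zero]
      positivity
  have hΦα : ∀ α, ∫ k, Φ (α, k) =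
      (Ioi (0 : ℝ)).indicator (fun α => ∫ k, energy m k * G (energy m k + α)) α := by
    intro α
    by_cases hα : 0 < α
    · rw [indicator_of_mem (show α ∈ Ioi (0 : ℝ) from hα)]
      congr 1; funext k
      exact indicator_of_mem (show (α, k) ∈ {p : ℝ × EuclideanSpace ℝ (Fin 3) | 0 < p.1} from hα) _
    · rw [indicator_of_notMem (show α ∉ Ioi (0 : ℝ) from hα)]
      have : ∀ k, Φ (α, k) = 0 := fun k => indicator_of_notMem
        (show (α, k) ∉ {p : ℝ × EuclideanSpace ℝ (Fin 3) | 0 < p.1} from hα) _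
      simp [this]
  have hΦΨ : ∀ k, ∫ α, Φ (α, k) = ∫ u, Ψ (u, k) := by
    intro k
    rw [← integral_add_left_eq_self (fun u => Ψ (u, k)) (energy m k)]
    congr 1; funext α
    simp only [Φ, Ψ, indicator, mem_ofPred_eq, lt_add_iff_pos_right]
  have hΨu : ∀ u, ∫ k, Ψ (u, k) = (Ioi m).indicator
      (fun u => Real.pi * (G u * u ^ 4 * Q3ratio m u)) u := by
    intro u
    have h1 : ∀ k, Ψ (u, k) = G u * (if energy m k < u then energy m k else 0) := by
      intro k
      simp only [Ψ, indicator, mem_ofPred_eq]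
      split_ifs <;> ring
    simp_rw [h1]
    rw [integral_const_mul, integral_ball_energy hm]
    by_cases hu : m < u
    · rw [if_pos hu, indicator_of_mem (show u ∈ Ioi m from hu)]; ring
    · rw [if_neg hu, indicator_of_notMem (show u ∉ Ioi m from hu)]; ring
  constructor
  · have h := hΦi.integral_prod_left
    simp_rw [hΦα] at h
    exact (integrable_indicator_iff measurableSet_Ioi).1 h
  · rw [← integral_indicator measurableSet_Ioi]
    simp_rw [← hΦα]
    rw [integral_integral_swap (f := fun α k => Φ (α, k)) hΦi]
    simp_rw [hΦΨ]
    rw [← integral_integral_swap (f := fun u k => Ψ (u, k)) hΨi]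
    simp_rw [hΨu]
    rw [integral_indicator measurableSet_Ioi, integral_const_mul]

/-- At zero energy the weight is 1/0 = 0, and both sides vanish. -/
theorem shellWeight_mul_energy_sq (m : ℝ) (k : EuclideanSpace ℝ (Fin 3)) :
    shellWeight m k * energy m k ^ 2 = (16 * Real.pi ^ 3)⁻¹ * energy m k := by
  by_cases h : energy m k = 0
  · simp [h]
  · have := Real.pi_pos.ne'
    rw [shellWeight]
    field_simp
    norm_num

/-- The worldline bound is integrated over all modulations exp(iαt) g with α > 0. One side becomes π
times the sampled energy density, the other the momentum integral, and a common π cancels. -/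
theorem IsNormalOrderedTwoPoint.energy_inequality_of_real {m : ℝ} (hm : 0 ≤ m) {σ : FieldState m}
    {W : Spacetime × Spacetime → ℝ} (hW : IsNormalOrderedTwoPoint σ W)
    (x : EuclideanSpace ℝ (Fin 3)) {g : ℝ → ℂ} (hg : ContDiff ℝ ∞ g) (hgc : HasCompactSupport g)
    (hgr : ∀ t, (g t).im = 0) :
    -(1 / (16 * Real.pi ^ 3)) * (∫ u in Ioi m, ‖ft g u‖ ^ 2 * u ^ 4 * Q3ratio m u) ≤
      ∫ t : ℝ, energyDensity m W (t, x) * ‖g t‖ ^ 2 := by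
  have hpi := Real.pi_pos
  have hFs := contDiff_splitEnergy m hW.1
  set G : ℝ → ℝ := fun u => ‖ft g u‖ ^ 2 with hGdef
  have hGc : Continuous G := (continuous_ft hg hgc).norm.pow 2
  obtain ⟨C, hC0, hC⟩ := exists_norm_ft_le hg hgc 7
  obtain ⟨hI, hval⟩ := integral_integral_energy hm hGc (fun u => sq_nonneg _) hC
  set a := timeTest g hg hgc with ha
  have haapp : ∀ t, a t = g t := fun _ => rfl
  have hgconj : ∀ t, (starRingEnd ℂ) (g t) = g t := fun t => Complex.conj_eq_iff_im.2 (hgr t)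
  let ι : ℝ × ℝ → Spacetime × Spacetime := fun p => ((p.1, x), (p.2, x))
  have hι : ContDiff ℝ ∞ ι :=
    (contDiff_fst.prodMk contDiff_const).prodMk (contDiff_snd.prodMk contDiff_const)
  let H : Test (ℝ × ℝ) :=
    ⟨fun p => g p.1 * g p.2 * (splitEnergy m W (ι p) : ℂ),
      ((hg.comp contDiff_fst).mul (hg.comp contDiff_snd)).mul
        (Complex.ofRealCLM.contDiff.comp (hFs.comp hι)),
      HasCompactSupport.intro (K := tsupport g ×ˢ tsupport g)
        ((show IsCompact (tsupport g) from hgc).prod hgc) (by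
        intro p hp
        by_contra hne
        have h1 := left_ne_zero_of_mul hne
        exact hp ⟨subset_tsupport _ (left_ne_zero_of_mul h1),
          subset_tsupport _ (right_ne_zero_of_mul h1)⟩),
      fun _ _ => trivial⟩
  have hHapp : ∀ p, H p = g p.1 * g p.2 * (splitEnergy m W (ι p) : ℂ) := fun _ => rfl
  have hHconj : conjTest H = H := by
    ext p
    change (starRingEnd ℂ) (H p) = H p
    rw [hHapp, map_mul, map_mul, hgconj, hgconj, Complex.conj_ofReal]
  have hdiag : (∫ t, H (t, t)).re = ∫ t : ℝ, energyDensity m W (t, x) * ‖g t‖ ^ 2 := by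
    have h1 : ∀ t, H (t, t) = ((energyDensity m W (t, x) * ‖g t‖ ^ 2 : ℝ) : ℂ) := by
      intro t
      rw [hHapp]
      have h2 : g t * g t = ((‖g t‖ ^ 2 : ℝ) : ℂ) := by
        rw [← Complex.normSq_eq_norm_sq, Complex.normSq_eq_conj_mul_self, hgconj]
      simp only
      rw [h2, ← Complex.ofReal_mul, mul_comm]
      rfl
    simp_rw [h1]
    rw [integral_complex_ofReal, Complex.ofReal_re]
  -- Modulation by α shifts the vacuum frequency from ω to ω + α and produces the phase exp(iα(t' -
  -- t)) in the smeared energy. Reality of g removes the remaining conjugation.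
  have hlow : ∀ α, -((16 * Real.pi ^ 3)⁻¹ * ∫ k : EuclideanSpace ℝ (Fin 3),
      energy m k * G (energy m k + α)) ≤ (ftTest volume H (antidiagCovector α)).re := by
    intro α
    have h := hW.worldline_bound x (modulate a (timeCovector α))
    have h1 : ∀ k, shellWeight m k * energy m k ^ 2 *
        ‖ftTest volume (modulate a (timeCovector α)) (timeCovector (energy m k))‖ ^ 2 =
        (16 * Real.pi ^ 3)⁻¹ * (energy m k * G (energy m k + α)) := by
      intro k
      have h2 : timeCovector α + timeCovector (energy m k) = timeCovector (energy m k + α) := by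
        rw [timeCovector, timeCovector, timeCovector, ← add_smul, add_comm]
      rw [ftTest_modulate, h2, ha, ftTest_timeTest, shellWeight_mul_energy_sq, mul_assoc]
    simp_rw [h1] at h
    rw [integral_const_mul] at h
    refine h.trans (le_of_eq ?_)
    congr 1
    rw [ftTest]
    congr 1; funext p
    change (starRingEnd ℂ) (planeWave (timeCovector α) p.1 * g p.1) *
      (planeWave (timeCovector α) p.2 * g p.2) * _ = planeWave (antidiagCovector α) p * H p
    have h3 : planeWave (antidiagCovector α) p =
        (starRingEnd ℂ) (planeWave (timeCovector α) p.1) * planeWave (timeCovector α) p.2 := by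
      rw [planeWave, planeWave, planeWave, ← Complex.exp_conj, ← Complex.exp_add]
      congr 1
      rw [antidiagCovector_apply]
      simp [timeCovector]
      ring
    rw [h3, hHapp, map_mul, hgconj]
    ring
  have hint := integrable_ftTest_antidiag H
  have h1 : ∫ α in Ioi (0 : ℝ), -((16 * Real.pi ^ 3)⁻¹ * ∫ k : EuclideanSpace ℝ (Fin 3),
      energy m k * G (energy m k + α)) ≤
      ∫ α in Ioi (0 : ℝ), (ftTest volume H (antidiagCovector α)).re :=
    integral_mono (hI.const_mul _).neg hint.re.integrableOn hlow
  rw [integral_neg, integral_const_mul, hval, ← pi_mul_integral_diag H hHconj, hdiag] at h1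
  have h2 : Real.pi * (-(1 / (16 * Real.pi ^ 3)) *
      (∫ u in Ioi m, ‖ft g u‖ ^ 2 * u ^ 4 * Q3ratio m u)) ≤
      Real.pi * ∫ t : ℝ, energyDensity m W (t, x) * ‖g t‖ ^ 2 := by
    refine le_trans (le_of_eq ?_) h1
    simp only [hGdef]
    ring
  exact le_of_mul_le_mul_left h2 hpi

end EnergyInequality

/-! ### Complex sampling functions and the mass-independent bound -/

section ComplexSampling

variable {g : ℝ → ℂ}

/-- The real part of a function, as a complex-valued function. -/
def rePart (g : ℝ → ℂ) (t : ℝ) : ℂ := ((g t).re : ℂ)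

/-- The imaginary part of a function, as a complex-valued function. -/
def imPart (g : ℝ → ℂ) (t : ℝ) : ℂ := ((g t).im : ℂ)

theorem contDiff_rePart (hg : ContDiff ℝ ∞ g) : ContDiff ℝ ∞ (rePart g) :=
  Complex.ofRealCLM.contDiff.comp (Complex.reCLM.contDiff.comp hg)

theorem contDiff_imPart (hg : ContDiff ℝ ∞ g) : ContDiff ℝ ∞ (imPart g) :=
  Complex.ofRealCLM.contDiff.comp (Complex.imCLM.contDiff.comp hg)

theorem hasCompactSupport_rePart (hg : HasCompactSupport g) : HasCompactSupport (rePart g) :=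
  hg.comp_left (g := fun z : ℂ => (z.re : ℂ)) (by simp)

theorem hasCompactSupport_imPart (hg : HasCompactSupport g) : HasCompactSupport (imPart g) :=
  hg.comp_left (g := fun z : ℂ => (z.im : ℂ)) (by simp)

theorem ft_neg_of_real (hr : ∀ t, (g t).im = 0) (u : ℝ) :
    ft g (-u) = (starRingEnd ℂ) (ft g u) := by
  rw [ft, ft, ← integral_conj]
  congr 1; funext t
  rw [map_mul, ← Complex.exp_conj, Complex.conj_eq_iff_im.2 (hr t)]
  simp

theorem ft_eq_rePart_add_imPart (hg : ContDiff ℝ ∞ g) (hgc : HasCompactSupport g) (u : ℝ) :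
    ft g u = ft (rePart g) u + Complex.I * ft (imPart g) u := by
  have hi : ∀ {f : ℝ → ℂ}, ContDiff ℝ ∞ f → HasCompactSupport f →
      Integrable fun t : ℝ => Complex.exp (Complex.I * ((u * t : ℝ) : ℂ)) * f t := fun hf hfc =>
    Continuous.integrable_of_hasCompactSupport
      ((by fun_prop : Continuous fun t : ℝ => Complex.exp (Complex.I * ((u * t : ℝ) : ℂ))).mul
        hf.continuous) hfc.mul_left
  rw [ft, ft, ft, ← integral_const_mul, ← integral_add
    (hi (contDiff_rePart hg) (hasCompactSupport_rePart hgc))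
    ((hi (contDiff_imPart hg) (hasCompactSupport_imPart hgc)).const_mul _)]
  congr 1; funext t
  have := Complex.re_add_im (g t)
  simp only [rePart, imPart]
  conv_lhs => rw [← this]
  ring

/-- The transforms A and B of the real and imaginary parts become their conjugates at -u. The cross
terms of |A + iB|² and |Ā + iB̄|² then cancel in the average. -/
theorem norm_ft_sq_add (hg : ContDiff ℝ ∞ g) (hgc : HasCompactSupport g) (u : ℝ) :
    (‖ft g u‖ ^ 2 + ‖ft g (-u)‖ ^ 2) / 2 = ‖ft (rePart g) u‖ ^ 2 + ‖ft (imPart g) u‖ ^ 2 := by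
  rw [ft_eq_rePart_add_imPart hg hgc, ft_eq_rePart_add_imPart hg hgc,
    ft_neg_of_real (g := rePart g) (fun t => Complex.ofReal_im _),
    ft_neg_of_real (g := imPart g) (fun t => Complex.ofReal_im _)]
  set A := ft (rePart g) u
  set B := ft (imPart g) u
  simp only [← Complex.normSq_eq_norm_sq, Complex.normSq_apply]
  simp
  ring

/-- Both sides are additive under |g|² = (Re g)² + (Im g)², so the real case applies to each part.
-/
theorem IsNormalOrderedTwoPoint.energy_inequality {m : ℝ} (hm : 0 ≤ m) {σ : FieldState m}
    {W : Spacetime × Spacetime → ℝ} (hW : IsNormalOrderedTwoPoint σ W)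
    (x : EuclideanSpace ℝ (Fin 3)) (hg : ContDiff ℝ ∞ g) (hgc : HasCompactSupport g) :
    -(1 / (16 * Real.pi ^ 3)) * (∫ u in Ioi m, (‖ft g u‖ ^ 2 + ‖ft g (-u)‖ ^ 2) / 2 * u ^ 4 *
        Q3ratio m u) ≤
      ∫ t : ℝ, energyDensity m W (t, x) * ‖g t‖ ^ 2 := by
  have hE : Continuous fun t : ℝ => energyDensity m W (t, x) := by
    have h1 : (fun t : ℝ => energyDensity m W (t, x)) =
        fun t => splitEnergy m W ((t, x), (t, x)) := rfl
    rw [h1]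
    exact (contDiff_splitEnergy m hW.1).continuous.comp (by fun_prop)
  have hi : ∀ {f : ℝ → ℂ}, ContDiff ℝ ∞ f → HasCompactSupport f →
      Integrable fun t : ℝ => energyDensity m W (t, x) * ‖f t‖ ^ 2 := fun hf hfc =>
    Continuous.integrable_of_hasCompactSupport (hE.mul (hf.continuous.norm.pow 2))
      (hfc.comp_left (g := fun z : ℂ => ‖z‖ ^ 2) (by simp)).mul_left
  have ha := hW.energy_inequality_of_real hm x (contDiff_rePart hg) (hasCompactSupport_rePart hgc)
    fun t => Complex.ofReal_im _
  have hb := hW.energy_inequality_of_real hm x (contDiff_imPart hg) (hasCompactSupport_imPart hgc)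
    fun t => Complex.ofReal_im _
  have h1 : ∫ t : ℝ, energyDensity m W (t, x) * ‖g t‖ ^ 2 =
      (∫ t : ℝ, energyDensity m W (t, x) * ‖rePart g t‖ ^ 2) +
        ∫ t : ℝ, energyDensity m W (t, x) * ‖imPart g t‖ ^ 2 := by
    rw [← integral_add (hi (contDiff_rePart hg) (hasCompactSupport_rePart hgc))
      (hi (contDiff_imPart hg) (hasCompactSupport_imPart hgc))]
    congr 1; funext t
    rw [← mul_add]
    congr 1
    simp only [rePart, imPart, ← Complex.normSq_eq_norm_sq, Complex.normSq_apply]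
    simp
  have h2 : ∫ u in Ioi m, (‖ft g u‖ ^ 2 + ‖ft g (-u)‖ ^ 2) / 2 * u ^ 4 * Q3ratio m u =
      (∫ u in Ioi m, ‖ft (rePart g) u‖ ^ 2 * u ^ 4 * Q3ratio m u) +
        ∫ u in Ioi m, ‖ft (imPart g) u‖ ^ 2 * u ^ 4 * Q3ratio m u := by
    rw [← integral_add
      (integrableOn_ft_mul_Q3ratio hm (contDiff_rePart hg) (hasCompactSupport_rePart hgc))
      (integrableOn_ft_mul_Q3ratio hm (contDiff_imPart hg) (hasCompactSupport_imPart hgc))]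
    congr 1; funext u
    rw [norm_ft_sq_add hg hgc]; ring
  rw [h1, h2]
  linarith

theorem ft_deriv (hg : ContDiff ℝ ∞ g) (hgc : HasCompactSupport g) (u : ℝ) :
    ft (deriv g) u = -(Complex.I * u) * ft g u := by
  have h1 : timeTest (deriv g) ((contDiff_infty_iff_deriv.1 hg).2) hgc.deriv =
      pdTest (1 : ℝ) (timeTest g hg hgc) := by
    ext t
    rfl
  rw [← ftTest_timeTest ((contDiff_infty_iff_deriv.1 hg).2) hgc.deriv, h1, ftTest_pdTest,
    ftTest_timeTest]
  simp [timeCovector]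

theorem norm_ft_deriv_deriv_sq (hg : ContDiff ℝ ∞ g) (hgc : HasCompactSupport g) (u : ℝ) :
    ‖ft (deriv (deriv g)) u‖ ^ 2 = ‖ft g u‖ ^ 2 * u ^ 4 := by
  rw [ft_deriv (contDiff_infty_iff_deriv.1 hg).2 hgc.deriv, ft_deriv hg hgc]
  simp only [norm_mul, norm_neg, Complex.norm_I, Complex.norm_real, Real.norm_eq_abs, one_mul]
  have : |u| * |u| = u ^ 2 := by rw [← sq, sq_abs]
  calc (|u| * (|u| * ‖ft g u‖)) ^ 2 = (|u| * |u|) ^ 2 * ‖ft g u‖ ^ 2 := by ring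
    _ = _ := by rw [this]; ring

/-- Plancherel's theorem. -/
theorem integral_norm_ft_sq (hg : ContDiff ℝ ∞ g) (hgc : HasCompactSupport g) :
    ∫ u, ‖ft g u‖ ^ 2 = 2 * Real.pi * ∫ t, ‖g t‖ ^ 2 := by
  have hpi := Real.pi_pos
  let gS : SchwartzMap ℝ ℂ := hgc.toSchwartzMap hg
  have h1 : ∀ w, FourierTransform.fourier g w = ft g (-(2 * Real.pi) * w) := by
    intro w
    rw [Real.fourier_eq', ft]
    congr 1; funext s
    rw [smul_eq_mul]
    congr 2
    simp only [RCLike.inner_apply, conj_trivial]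
    push_cast; ring
  have h2 := SchwartzMap.integral_norm_sq_fourier gS
  rw [SchwartzMap.fourier_coe] at h2
  have h3 : ∫ w, ‖ft g (-(2 * Real.pi) * w)‖ ^ 2 = ∫ t, ‖g t‖ ^ 2 := by
    simp_rw [← h1]; exact h2
  rw [Measure.integral_comp_mul_left (fun u => ‖ft g u‖ ^ 2), inv_neg, abs_neg,
    abs_of_pos (by positivity), smul_eq_mul] at h3
  rw [← h3]
  field_simp

/-- As 0 ≤ Q₃ ≤ 1 for u > m, dropping Q₃ and enlarging the range to u > 0 only increases the
integral. The symmetrised density |ĝ(u)|²u⁴ is even, so the half-line carries half of Plancherel's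
2π ∫ |g''|². -/
theorem integral_ft_mul_Q3ratio_le {m : ℝ} (hm : 0 ≤ m) (hg : ContDiff ℝ ∞ g)
    (hgc : HasCompactSupport g) :
    ∫ u in Ioi m, (‖ft g u‖ ^ 2 + ‖ft g (-u)‖ ^ 2) / 2 * u ^ 4 * Q3ratio m u ≤
      Real.pi * ∫ t, ‖deriv (deriv g) t‖ ^ 2 := by
  have hg2 := (contDiff_infty_iff_deriv.1 (contDiff_infty_iff_deriv.1 hg).2).2
  let P : ℝ → ℝ := fun u => ‖ft g u‖ ^ 2 * u ^ 4
  have hP : ∀ u, P u = ‖ft (deriv (deriv g)) u‖ ^ 2 := fun u =>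
    (norm_ft_deriv_deriv_sq hg hgc u).symm
  have hP0 : ∀ u, 0 ≤ P u := fun u => by rw [hP]; positivity
  have hPi : Integrable P := by
    obtain ⟨C, hC, hb⟩ := exists_norm_ft_le hg2 hgc.deriv.deriv 2
    refine (integrable_one_add_abs_inv.const_mul C).mono' ?_ (Filter.Eventually.of_forall fun u => ?_)
    · have := (continuous_ft hg hgc).norm
      exact (Continuous.aestronglyMeasurable (by fun_prop))
    · rw [Real.norm_of_nonneg (hP0 u), ← div_eq_mul_inv, le_div_iff₀ (by positivity), mul_comm, hP]
      exact hb u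
  let S : ℝ → ℝ := fun u => (P u + P (-u)) / 2
  have hSi : Integrable S := (hPi.add hPi.comp_neg).div_const 2
  have hS0 : ∀ u, 0 ≤ S u := fun u => by
    have h1 := hP0 u
    have h2 := hP0 (-u)
    simp only [S]; positivity
  have hS : ∫ u in Ioi (0 : ℝ), S u = Real.pi * ∫ t, ‖deriv (deriv g) t‖ ^ 2 := by
    have h1 := integral_comp_abs (f := S)
    have h2 : ∀ u, S |u| = S u := by
      intro u
      rcases abs_choice u with h | h
      · rw [h]
      · rw [h]; simp only [S, neg_neg]; ring
    simp_rw [h2] at h1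
    have h3 : ∫ u, S u = 2 * Real.pi * ∫ t, ‖deriv (deriv g) t‖ ^ 2 := by
      simp only [S]
      rw [integral_div, integral_add hPi hPi.comp_neg, integral_neg_eq_self]
      simp_rw [hP]
      rw [integral_norm_ft_sq hg2 hgc.deriv.deriv]
      ring
    linarith
  rw [← hS]
  refine (setIntegral_mono_on_ae (s := Ioi m) (g := S) ?_ hSi.integrableOn measurableSet_Ioi
    (Filter.Eventually.of_forall fun u hu => ?_)).trans
    (setIntegral_mono_set hSi.integrableOn (Filter.Eventually.of_forall hS0)
      (Ioi_subset_Ioi hm).eventuallyLE)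
  · have h1 := (integrableOn_ft_mul_Q3ratio hm (contDiff_rePart hg) (hasCompactSupport_rePart hgc)).add
      (integrableOn_ft_mul_Q3ratio hm (contDiff_imPart hg) (hasCompactSupport_imPart hgc))
    refine h1.congr (Filter.Eventually.of_forall fun u => ?_)
    simp only [Pi.add_apply]
    rw [norm_ft_sq_add hg hgc]; ring
  · obtain ⟨q0, q1⟩ := Q3ratio_mem hm hu
    have h1 : (‖ft g u‖ ^ 2 + ‖ft g (-u)‖ ^ 2) / 2 * u ^ 4 = S u := by
      simp only [S, P]; ring
    rw [h1]
    exact mul_le_of_le_one_right (hS0 u) q1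

end ComplexSampling

end QEI

end

/-! ### Assembly of the quantum energy inequalities -/

theorem mainTheorem2 :
    ((∀ x : ℝ, 1 ≤ x → 0 ≤ QEI.Q3 x ∧ QEI.Q3 x ≤ 1) ∧
      Filter.Tendsto QEI.Q3 Filter.atTop (𝓝 1)) ∧
    ∀ (m : ℝ), 0 ≤ m → ∀ σ : QEI.FieldState m, σ.IsHadamard →
      (∃ W : QEI.Spacetime × QEI.Spacetime → ℝ, QEI.IsNormalOrderedTwoPoint σ W) ∧
      ∀ W : QEI.Spacetime × QEI.Spacetime → ℝ, QEI.IsNormalOrderedTwoPoint σ W →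
        ∀ (x : EuclideanSpace ℝ (Fin 3)) (g : ℝ → ℂ), ContDiff ℝ ∞ g → HasCompactSupport g →
          IntegrableOn (fun u : ℝ => ‖QEI.ft g u‖ ^ 2 * u ^ 4 * QEI.Q3ratio m u) (Ioi m) ∧
          ((∀ t, (g t).im = 0) →
            (∫ t : ℝ, QEI.energyDensity m W (t, x) * ‖g t‖ ^ 2) ≥
              -(1 / (16 * Real.pi ^ 3)) *
                ∫ u in Ioi m, ‖QEI.ft g u‖ ^ 2 * u ^ 4 * QEI.Q3ratio m u) ∧
          ((∫ t : ℝ, QEI.energyDensity m W (t, x) * ‖g t‖ ^ 2) ≥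
            -(1 / (16 * Real.pi ^ 3)) *
              ∫ u in Ioi m, (‖QEI.ft g u‖ ^ 2 + ‖QEI.ft g (-u)‖ ^ 2) / 2 * u ^ 4 *
                QEI.Q3ratio m u) ∧
          ((∫ t : ℝ, QEI.energyDensity m W (t, x) * ‖g t‖ ^ 2) ≥
            -(1 / (16 * Real.pi ^ 2)) * ∫ t : ℝ, ‖deriv (deriv g) t‖ ^ 2) := by
  refine ⟨⟨fun x hx => ⟨QEI.Q3_nonneg hx, QEI.Q3_le_one hx⟩, QEI.tendsto_Q3⟩,
    fun m hm σ hσ => ⟨hσ.exists_normalOrdered, fun W hW x g hg hgc => ?_⟩⟩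
  have h := hW.energy_inequality hm x hg hgc
  refine ⟨QEI.integrableOn_ft_mul_Q3ratio hm hg hgc,
    fun hr => hW.energy_inequality_of_real hm x hg hgc hr, h, ge_iff_le.2 (le_trans ?_ h)⟩
  have h1 := QEI.integral_ft_mul_Q3ratio_le hm hg hgc
  have hpi := Real.pi_pos
  have h2 : -(1 / (16 * Real.pi ^ 2)) * ∫ t : ℝ, ‖deriv (deriv g) t‖ ^ 2 =
      -(1 / (16 * Real.pi ^ 3)) * (Real.pi * ∫ t : ℝ, ‖deriv (deriv g) t‖ ^ 2) := by
    field_simp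
  rw [h2]
  exact mul_le_mul_of_nonpos_left h1 (neg_nonpos.2 (by positivity))
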